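/- **Setting.** Let $G$ be a (finite-dimensional, Hausdorff, real) Lie group with Lie algebra $\mathfrak g$, and let $H\subseteq G$ be a connected abelian Lie subgroup (an injectively immersed connected abelian Lie group) with Lie algebra $\mathfrak h$. Fix a basis $(h_i)$ of $\mathfrak h$, with corresponding coordinates $(\lambda^i)$ on $\mathfrak h^*$, and put $M=\mathfrak h^*\times G$. For $u\in U\mathfrak g$ let $\vec u$ be the left-invariant differential operator on $M$ (acting along $G$). For $n\ge 1$, a smooth function $X:\mathfrak h^*\to (U\mathfrak g)^{\otimes n}[[\hbar]]$ means a series $X=\sum_k\hbar^kX_k$ with $X_k\in C^\infty(\mathfrak h^*)\otimes (U\mathfrak g)^{\otimes n}$; for $n=1,2$, $\vec X$ denotes the resulting series of left-invariant differential (for $n=2$ bidifferential) operators on $M$. $\Delta$ and $\epsilon$ are the coproduct and counit of $U\mathfrak g$. For such an $X$, constants $c\in\mathbb R$ and commuting elements $\eta_i\in (U\mathfrak g)^{\otimes n}$, put $$X(\lambda+c\hbar\,\eta)=\sum_{k\ge0}\frac{(c\hbar)^k}{k!}\sum_{i_1,\dots,i_k}\eta_{i_1}\cdots\eta_{i_k}\frac{\partial^kX}{\partial\lambda^{i_1}\cdots\partial\lambda^{i_k}}(\lambda),$$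 and write $h^{(j)}$ for $\eta_i=h_i$ placed in the $j$-th tensor factor. For $T:\mathfrak h^*\to U\mathfrak g[[\hbar]]$ put $T_1=T\otimes1$, $T_2=1\otimes T$. Let $r:\mathfrak h^*\to\wedge^2\mathfrak g$ be a *triangular dynamical $r$-matrix*: a smooth function with values in skew-symmetric elements of $\mathfrak g\otimes\mathfrak g$ that is $\mathfrak h$-invariant (zero weight) and satisfies $$\sum_i\Big(h_i^{(1)}\tfrac{\partial r^{23}}{\partial\lambda^i}-h_i^{(2)}\tfrac{\partial r^{13}}{\partial\lambda^i}+h_i^{(3)}\tfrac{\partial r^{12}}{\partial\lambda^i}\Big)+[r^{12},r^{13}]+[r^{12},r^{23}]+[r^{13},r^{23}]=0 .$$ Equip $M$ with the Poisson structure $\pi=\sum_i\vec h_i\wedge\frac{\partial}{\partial\lambda^i}+\vec r(\lambda)$, where $X\wedge Y=X\otimes Y-Y\otimes X$ and $\{f,g\}=\pi(f,g)$. A *star product* on $M$ is an associative $\mathbb R[[\hbar]]$-bilinear product $f*g=fg+\sum_{k\ge1}\hbar^kB_k(f,g)$ on $C^\infty(M)[[\hbar]]$, with bidifferential operators $B_k$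 (of finite order), unit $1$, and $B_1(f,g)-B_1(g,f)=\{f,g\}$. It is *compatible* if it is invariant under left translations by $G$ and right translations by $H$ on the factor $G$ and 1. $f*g=fg$ for $f,g\in C^\infty(\mathfrak h^*)$; 2. $f*g=\vec\Theta(f,g)$ and $g*f=\vec\Theta(g,f)$ for $f\in C^\infty(\mathfrak h^*)$, $g\in C^\infty(G)$, where $\Theta=\exp(\hbar\theta)$ and $\theta=\frac12\sum_i\big(\vec h_i\otimes\frac{\partial}{\partial\lambda^i}-\frac{\partial}{\partial\lambda^i}\otimes\vec h_i\big)$; 3. there is a smooth $F:\mathfrak h^*\to(U\mathfrak g\otimes U\mathfrak g)[[\hbar]]$ with $f*g=\vec F(f,g)$ for $f,g\in C^\infty(G)$. A *quantization* of $r$ is a smooth $F:\mathfrak h^*\to (U\mathfrak g\otimes U\mathfrak g)[[\hbar]]$ such that: $F\equiv1\bmod\hbar$; $F$ is $\mathfrak h$-invariant (it commutes with $h\otimes1+1\otimes h$ for all $h\in\mathfrak h$); $F$ satisfies the shifted cocycle condition $$(\Delta\otimes\mathrm{id})F(\lambda)\;F^{12}\big(\lambda-\tfrac12\hbar h^{(3)}\big)=(\mathrm{id}\otimes\Delta)F(\lambda)\;F^{23}\big(\lambda+\tfrac12\hbar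 h^{(1)}\big);$$ $(\epsilon\otimes\mathrm{id})F=1=(\mathrm{id}\otimes\epsilon)F$; and $F_1-F_1^{21}=r$, where $F_1$ is the coefficient of $\hbar$ in $F$. **Theorem.** Let $*$ be a compatible star product on the Poisson manifold $(M,\pi)$ associated with a triangular dynamical $r$-matrix $r$, and let $T:\mathfrak h^*\to(U\mathfrak g)^{\mathfrak h}[[\hbar]]$ be smooth with $T\equiv1\bmod\hbar$ and $\epsilon(T)=1$. Then $$f\,\tilde*\,g=\vec T^{-1}\big(\vec Tf*\vec Tg\big)$$ is again a compatible star product on $(M,\pi)$. Moreover, if $F$ is such that $f*g=\vec F(f,g)$ for all $f,g\in C^\infty(G)$, then for all $f,g\in C^\infty(G)$ $$f\,\tilde*\,g=\vec E(f,g),\qquad E(\lambda)=\Delta T(\lambda)^{-1}\,F(\lambda)\,T_1\big(\lambda-\tfrac12\hbar h^{(2)}\big)\,T_2\big(\lambda+\tfrac12\hbar h^{(1)}\big),$$ and $E$ is a quantization of $r$. -/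

import Mathlib

open scoped Manifold ContDiff TensorProduct
open PowerSeries (coeff constantCoeff)

noncomputable section

namespace DynStar

/-! ### Derivatives along vector fields and the Lie bracket -/

section Bracket

open VectorField

variable {E : Type*} [NormedAddCommGroup E] [NormedSpace ℝ E]
  {M : Type*} [TopologicalSpace M] [ChartedSpace E M]

theorem mvfderiv_apply_eq_fderiv (f : E → ℝ) (x v : E) :
    mvfderiv 𝓘(ℝ,E) f x v = fderiv ℝ f x v := by
  have h : mfderiv 𝓘(ℝ,E) 𝓘(ℝ,ℝ) f x = fderiv ℝ f x := mfderiv_eq_fderiv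
  exact congrArg (fun L : E →L[ℝ] ℝ => L v) h

theorem inverse_of_isInvertible {A B : Type*} [TopologicalSpace A] [TopologicalSpace B] [AddCommGroup A]
   [AddCommGroup B] [Module ℝ A] [Module ℝ B] (L : A →L[ℝ] B) (h : L.IsInvertible) (b : B) :
   L (L.inverse b) = b := by
  obtain ⟨e, rfl⟩ := h
  rw [ContinuousLinearMap.inverse_equiv]
  simp

/-- A vector field on `M` read in the chart at `x`. -/
noncomputable def chartField (V : Π x : M, TangentSpace 𝓘(ℝ,E) x) (x : M) : E → E := fun z =>
  (mfderiv 𝓘(ℝ,E) 𝓘(ℝ,E) (extChartAt 𝓘(ℝ,E) x).symm z).inverse (V ((extChartAt 𝓘(ℝ,E) x).symm z))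

theorem chartField_eq (V : Π x : M, TangentSpace 𝓘(ℝ,E) x) (x : M) :
    mpullbackWithin 𝓘(ℝ,E) 𝓘(ℝ,E) (extChartAt 𝓘(ℝ,E) x).symm V (Set.range 𝓘(ℝ,E))
      = chartField V x := by
  rw [ModelWithCorners.range_eq_univ, mpullbackWithin_univ]
  rfl

variable [IsManifold 𝓘(ℝ,E) ∞ M]

theorem mvfderiv_apply_eq_chart (V : Π x : M, TangentSpace 𝓘(ℝ,E) x) (f : M → ℝ) (x : M) (z : E)
    (hz : z ∈ (extChartAt 𝓘(ℝ,E) x).target)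
    (hf : MDifferentiableAt 𝓘(ℝ,E) 𝓘(ℝ,ℝ) f ((extChartAt 𝓘(ℝ,E) x).symm z)) :
    mvfderiv 𝓘(ℝ,E) f ((extChartAt 𝓘(ℝ,E) x).symm z) (V ((extChartAt 𝓘(ℝ,E) x).symm z))
     = fderiv ℝ (f ∘ (extChartAt 𝓘(ℝ,E) x).symm) z (chartField (E := E) V x z) := by
  have : IsManifold 𝓘(ℝ,E) 1 M := IsManifold.of_le (n := ∞) (by simp)
  have hinv := isInvertible_mfderivWithin_extChartAt_symm (I := 𝓘(ℝ,E)) hz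
  have hs := mdifferentiableWithinAt_extChartAt_symm (I := 𝓘(ℝ,E)) hz
  rw [ModelWithCorners.range_eq_univ] at hs hinv
  rw [mdifferentiableWithinAt_univ] at hs
  rw [mfderivWithin_univ] at hinv
  rw [← mvfderiv_apply_eq_fderiv]
  have h1 := mvfderiv_comp_apply (I := 𝓘(ℝ,E)) (I' := 𝓘(ℝ,E)) z hf hs (chartField (E := E) V x z)
  have h2 : mfderiv 𝓘(ℝ,E) 𝓘(ℝ,E) (extChartAt 𝓘(ℝ,E) x).symm z (chartField (E := E) V x z)
    = V ((extChartAt 𝓘(ℝ,E) x).symm z) := inverse_of_isInvertible _ hinv _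
  rw [h2] at h1
  exact h1.symm

variable [CompleteSpace E]

theorem mvfderiv_mlieBracket_apply (V W : Π x : M, TangentSpace 𝓘(ℝ,E) x) (f : M → ℝ) (x : M)
    (hV : MDifferentiableAt 𝓘(ℝ,E) (𝓘(ℝ,E).prod 𝓘(ℝ,E)) (fun y => (V y : TangentBundle 𝓘(ℝ,E) M)) x)
    (hW : MDifferentiableAt 𝓘(ℝ,E) (𝓘(ℝ,E).prod 𝓘(ℝ,E)) (fun y => (W y : TangentBundle 𝓘(ℝ,E) M)) x)
    (hf : ContMDiff 𝓘(ℝ,E) 𝓘(ℝ,ℝ) ∞ f)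
    (hVf : MDifferentiableAt 𝓘(ℝ,E) 𝓘(ℝ,ℝ) (fun y => mvfderiv 𝓘(ℝ,E) f y (V y)) x)
    (hWf : MDifferentiableAt 𝓘(ℝ,E) 𝓘(ℝ,ℝ) (fun y => mvfderiv 𝓘(ℝ,E) f y (W y)) x) :
    mvfderiv 𝓘(ℝ,E) f x (mlieBracket 𝓘(ℝ,E) V W x) =
      mvfderiv 𝓘(ℝ,E) (fun y => mvfderiv 𝓘(ℝ,E) f y (W y)) x (V x) -
      mvfderiv 𝓘(ℝ,E) (fun y => mvfderiv 𝓘(ℝ,E) f y (V y)) x (W x) := by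
  have : IsManifold 𝓘(ℝ,E) 1 M := IsManifold.of_le (n := ∞) (by simp)
  have : IsManifold 𝓘(ℝ,E) 2 M := IsManifold.of_le (n := ∞) (by norm_cast)
  have hfd : ∀ y, MDifferentiableAt 𝓘(ℝ,E) 𝓘(ℝ,ℝ) f y := fun y => hf.mdifferentiable (by simp) y
  have hxt : extChartAt 𝓘(ℝ,E) x x ∈ (extChartAt 𝓘(ℝ,E) x).target := mem_extChartAt_target x
  have hxx : (extChartAt 𝓘(ℝ,E) x).symm (extChartAt 𝓘(ℝ,E) x x) = x := extChartAt_to_inv x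
  have htn : (extChartAt 𝓘(ℝ,E) x).target ∈ nhds (extChartAt 𝓘(ℝ,E) x x) := extChartAt_target_mem_nhds x
  have key : ∀ U : (Π x : M, TangentSpace 𝓘(ℝ,E) x), ∀ g : M → ℝ, MDifferentiableAt 𝓘(ℝ,E) 𝓘(ℝ,ℝ) g x →
     mvfderiv 𝓘(ℝ,E) g x (U x) = fderiv ℝ (g ∘ (extChartAt 𝓘(ℝ,E) x).symm) (extChartAt 𝓘(ℝ,E) x x)
        (chartField U x (extChartAt 𝓘(ℝ,E) x x)) := by
    intro U g hg
    rw [← mvfderiv_apply_eq_chart U g x _ hxt (by rw [hxx]; exact hg), hxx]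
  have key2 : ∀ U : (Π x : M, TangentSpace 𝓘(ℝ,E) x),
     ((fun y => mvfderiv 𝓘(ℝ,E) f y (U y)) ∘ (extChartAt 𝓘(ℝ,E) x).symm) =ᶠ[nhds (extChartAt 𝓘(ℝ,E) x x)]
       fun z => fderiv ℝ (f ∘ (extChartAt 𝓘(ℝ,E) x).symm) z (chartField U x z) := by
    intro U
    filter_upwards [htn] with z hz
    exact mvfderiv_apply_eq_chart U f x z hz (hfd _)
  have hdiff : ∀ U : (Π x : M, TangentSpace 𝓘(ℝ,E) x),
      MDifferentiableAt 𝓘(ℝ,E) (𝓘(ℝ,E).prod 𝓘(ℝ,E)) (fun y => (U y : TangentBundle 𝓘(ℝ,E) M)) x →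
      DifferentiableAt ℝ (chartField U x) (extChartAt 𝓘(ℝ,E) x x) := by
    intro U hU
    have h := MDifferentiableWithinAt.differentiableWithinAt_mpullbackWithin_vectorField
      (mdifferentiableWithinAt_univ.2 hU)
    rw [Set.preimage_univ, Set.univ_inter, chartField_eq] at h
    exact h.differentiableAt (by rw [ModelWithCorners.range_eq_univ]; exact Filter.univ_mem)
  have hsm := contMDiffWithinAt_extChartAt_symm_range (n := ∞) (I := 𝓘(ℝ,E)) x hxt
  rw [ModelWithCorners.range_eq_univ, contMDiffWithinAt_univ] at hsm
  have hfs : ContDiffAt ℝ ∞ (f ∘ (extChartAt 𝓘(ℝ,E) x).symm) (extChartAt 𝓘(ℝ,E) x x) :=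
    contMDiffAt_iff_contDiffAt.1 (ContMDiffAt.comp _ hf.contMDiffAt hsm)
  have e2 : f =ᶠ[nhds x] (f ∘ (extChartAt 𝓘(ℝ,E) x).symm) ∘ (extChartAt 𝓘(ℝ,E) x) := by
    filter_upwards [extChartAt_source_mem_nhds (I := 𝓘(ℝ,E)) x] with y hy
    exact congrArg f ((extChartAt 𝓘(ℝ,E) x).left_inv hy).symm
  have hinv := isInvertible_mfderiv_extChartAt (I := 𝓘(ℝ,E)) (mem_extChartAt_source (I := 𝓘(ℝ,E)) x)
  have e3 : ∀ w : E, mvfderiv 𝓘(ℝ,E) f x ((mfderiv 𝓘(ℝ,E) 𝓘(ℝ,E) (extChartAt 𝓘(ℝ,E) x) x).inverse w)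
      = fderiv ℝ (f ∘ (extChartAt 𝓘(ℝ,E) x).symm) (extChartAt 𝓘(ℝ,E) x x) w := by
    intro w
    have h0 : mfderiv 𝓘(ℝ,E) 𝓘(ℝ,ℝ) f x = mfderiv 𝓘(ℝ,E) 𝓘(ℝ,ℝ) ((f ∘ (extChartAt 𝓘(ℝ,E) x).symm) ∘ (extChartAt 𝓘(ℝ,E) x)) x :=
      e2.mfderiv_eq
    have h1 := mvfderiv_comp_apply (I := 𝓘(ℝ,E)) (I' := 𝓘(ℝ,E)) x
      (g := f ∘ (extChartAt 𝓘(ℝ,E) x).symm) (f := extChartAt 𝓘(ℝ,E) x)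
      (hfs.differentiableAt (by simp)).mdifferentiableAt
      (mdifferentiableAt_extChartAt (mem_chart_source E x))
      ((mfderiv 𝓘(ℝ,E) 𝓘(ℝ,E) (extChartAt 𝓘(ℝ,E) x) x).inverse w)
    have h2 : mfderiv 𝓘(ℝ,E) 𝓘(ℝ,E) (extChartAt 𝓘(ℝ,E) x) x
      ((mfderiv 𝓘(ℝ,E) 𝓘(ℝ,E) (extChartAt 𝓘(ℝ,E) x) x).inverse w) = w := inverse_of_isInvertible _ hinv _
    refine Eq.trans (congrArg (fun L : E →L[ℝ] ℝ => L ((mfderiv 𝓘(ℝ,E) 𝓘(ℝ,E) (extChartAt 𝓘(ℝ,E) x) x).inverse w)) h0) ?_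
    refine h1.trans ?_
    refine Eq.trans ?_ (mvfderiv_apply_eq_fderiv _ _ _)
    exact congrArg (fun v : E => (mvfderiv 𝓘(ℝ,E) (f ∘ (extChartAt 𝓘(ℝ,E) x).symm) (extChartAt 𝓘(ℝ,E) x x) : E → ℝ) v) h2
  have e4 : mlieBracket 𝓘(ℝ,E) V W x = (mfderiv 𝓘(ℝ,E) 𝓘(ℝ,E) (extChartAt 𝓘(ℝ,E) x) x).inverse
      (lieBracket ℝ (E := E) (chartField (E := E) V x) (chartField (E := E) W x) (extChartAt 𝓘(ℝ,E) x x)) := by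
    rw [← mlieBracketWithin_univ, mlieBracketWithin_apply, chartField_eq, chartField_eq,
      Set.preimage_univ, Set.univ_inter, ModelWithCorners.range_eq_univ]
    exact congrArg _ (congrFun lieBracketWithin_univ _)
  rw [key V _ hWf, key W _ hVf, (key2 W).fderiv_eq, (key2 V).fderiv_eq,
    ← fderiv_apply_lieBracket (n := ∞) hfs (by rw [minSmoothness_of_isRCLikeNormedField]; norm_cast) (hdiff W hW) (hdiff V hV), e4, e3]

end Bracket

/-! ### Function algebras -/

/-- A smooth Lie group over `ℝ` has the regularity Mathlib asks for in order to define the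
bracket on its tangent space at the identity. -/
instance instLieGroupMinSmoothness {E : Type*} [NormedAddCommGroup E] [NormedSpace ℝ E]
    {G : Type*} [TopologicalSpace G] [ChartedSpace E G] [Group G] [h : LieGroup 𝓘(ℝ, E) ∞ G] :
    LieGroup 𝓘(ℝ, E) (minSmoothness ℝ 3) G := by
  have h3 : LieGroup 𝓘(ℝ, E) 3 G := inferInstance
  rw [minSmoothness_of_isRCLikeNormedField]
  exact h3

/-- The Lie algebra `𝔤 = T₁G` of the Lie group `G`. -/
abbrev LieAlg (E : Type*) [NormedAddCommGroup E] [NormedSpace ℝ E]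
    (G : Type*) [TopologicalSpace G] [ChartedSpace E G] [Group G] : Type _ :=
  GroupLieAlgebra 𝓘(ℝ, E) G

/-- The universal enveloping algebra `U𝔤`. -/
abbrev UEnv (E : Type*) [NormedAddCommGroup E] [NormedSpace ℝ E] [CompleteSpace E]
    (G : Type*) [TopologicalSpace G] [ChartedSpace E G] [Group G] [LieGroup 𝓘(ℝ, E) ∞ G] :
    Type _ :=
  UniversalEnvelopingAlgebra ℝ (LieAlg E G)

/-- The dual `𝔥*` of the Lie algebra `𝔥 = T₁H` of a Lie group `H` modelled on `F`
(in Mathlib, the vector space underlying `T₁H` is `F`). -/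
abbrev LieDual (F : Type*) [NormedAddCommGroup F] [NormedSpace ℝ F] : Type _ := F →L[ℝ] ℝ

/-- `C^∞(𝔥*)`. -/
abbrev BaseFun (F : Type*) [NormedAddCommGroup F] [NormedSpace ℝ F] : Type _ :=
  C^∞⟮𝓘(ℝ, LieDual F), LieDual F; ℝ⟯

/-- `C^∞(G)`. -/
abbrev GroupFun (E : Type*) [NormedAddCommGroup E] [NormedSpace ℝ E]
    (G : Type*) [TopologicalSpace G] [ChartedSpace E G] : Type _ :=
  C^∞⟮𝓘(ℝ, E), G; ℝ⟯

/-- `C^∞(M)` for `M = 𝔥* × G`. -/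
abbrev TotalFun (F : Type*) [NormedAddCommGroup F] [NormedSpace ℝ F]
    (E : Type*) [NormedAddCommGroup E] [NormedSpace ℝ E]
    (G : Type*) [TopologicalSpace G] [ChartedSpace E G] : Type _ :=
  C^∞⟮𝓘(ℝ, LieDual F).prod 𝓘(ℝ, E), LieDual F × G; ℝ⟯

section Pullback

variable {A : Type*} [NormedAddCommGroup A] [NormedSpace ℝ A]
  {P : Type*} [TopologicalSpace P] {I : ModelWithCorners ℝ A P}
  {M : Type*} [TopologicalSpace M] [ChartedSpace P M]
  {A' : Type*} [NormedAddCommGroup A'] [NormedSpace ℝ A']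
  {P' : Type*} [TopologicalSpace P'] {I' : ModelWithCorners ℝ A' P'}
  {M' : Type*} [TopologicalSpace M'] [ChartedSpace P' M']

/-- Pullback of smooth functions along a smooth map. -/
def pullback (φ : C^∞⟮I, M; I', M'⟯) : C^∞⟮I', M'; ℝ⟯ →ₐ[ℝ] C^∞⟮I, M; ℝ⟯ where
  toFun f := f.comp φ
  map_one' := rfl
  map_mul' _ _ := rfl
  map_zero' := rfl
  map_add' _ _ := rfl
  commutes' _ := rfl

end Pullback

section Total

variable {F : Type*} [NormedAddCommGroup F] [NormedSpace ℝ F]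
  {E : Type*} [NormedAddCommGroup E] [NormedSpace ℝ E]
  {G : Type*} [TopologicalSpace G] [ChartedSpace E G]

/-- A function on `𝔥*` regarded as a function on `M`. -/
def baseIncl : BaseFun F →ₐ[ℝ] TotalFun F E G := pullback ContMDiffMap.fst

/-- A function on `G` regarded as a function on `M`. -/
def groupIncl : GroupFun E G →ₐ[ℝ] TotalFun F E G := pullback ContMDiffMap.snd

variable [Group G] [LieGroup 𝓘(ℝ, E) ∞ G]

/-- `f ↦ ((μ, x) ↦ f (μ, a x))`. -/
def leftTranslate (a : G) : TotalFun F E G →ₐ[ℝ] TotalFun F E G :=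
  pullback ⟨fun p => (p.1, a * p.2),
    contMDiff_fst.prodMk (contMDiff_mul_left.comp contMDiff_snd)⟩

/-- `f ↦ ((μ, x) ↦ f (μ, x a))`. -/
def rightTranslate (a : G) : TotalFun F E G →ₐ[ℝ] TotalFun F E G :=
  pullback ⟨fun p => (p.1, p.2 * a),
    contMDiff_fst.prodMk (contMDiff_mul_right.comp contMDiff_snd)⟩

end Total

/-! ### Smooth dependence of derivatives on parameters -/

section Param

variable {A : Type*} [NormedAddCommGroup A] [NormedSpace ℝ A]
  {P : Type*} [TopologicalSpace P] {I : ModelWithCorners ℝ A P}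
  {N : Type*} [TopologicalSpace N] [ChartedSpace P N] [IsManifold I ∞ N]
  {E : Type*} [NormedAddCommGroup E] [NormedSpace ℝ E]
  {M : Type*} [TopologicalSpace M] [ChartedSpace E M] [IsManifold 𝓘(ℝ, E) ∞ M]

theorem contMDiff_mvfderiv_param (Φ : N → M → ℝ)
    (hΦ : ContMDiff (I.prod 𝓘(ℝ, E)) 𝓘(ℝ, ℝ) ∞ (Function.uncurry Φ))
    (y : M) (v : TangentSpace 𝓘(ℝ, E) y) :
    ContMDiff I 𝓘(ℝ, ℝ) ∞ (fun p => mvfderiv 𝓘(ℝ, E) (Φ p) y v) := by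
  have i1 : IsManifold 𝓘(ℝ, E) 1 M := IsManifold.of_le (n := ∞) (by simp)
  have i2 : IsManifold I 1 N := IsManifold.of_le (n := ∞) (by simp)
  intro p
  have h := ContMDiffAt.mfderiv_apply (I := 𝓘(ℝ, E)) (I' := 𝓘(ℝ, ℝ)) (J := I) (J' := I)
    (n := ∞) (m := ∞) (x₀ := p) Φ (fun _ => y) id (fun _ => (v : E))
    hΦ.contMDiffAt contMDiffAt_const contMDiffAt_id contMDiffAt_const le_rfl
  refine h.congr_of_eventuallyEq (Filter.Eventually.of_forall fun q => ?_)
  have e := inTangentCoordinates_eq (I := 𝓘(ℝ, E)) (I' := 𝓘(ℝ, ℝ)) (fun _ : N => y)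
    (fun q : N => Φ q y) (fun q : N => mfderiv 𝓘(ℝ, E) 𝓘(ℝ, ℝ) (Φ q) y)
    (x₀ := p) (x := q) (mem_chart_source E y) (mem_chart_source ℝ (Φ p y))
  have e' := congrArg (fun L : E →L[ℝ] ℝ => L v) e
  refine Eq.trans ?_ e'.symm
  have c1 := (tangentBundleCore 𝓘(ℝ, E) M).coordChange_self (achart E y) y (mem_achart_source E y) v
  have c2 : ∀ t : ℝ, (tangentBundleCore 𝓘(ℝ, ℝ) ℝ).coordChange (achart ℝ (Φ q y))
      (achart ℝ (Φ p y)) (Φ q y) t = t := fun t => by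
    rw [TangentBundle.coordChange_model_space]; rfl
  refine Eq.trans ?_ (c2 _).symm
  exact congrArg (fun w : E => (mfderiv 𝓘(ℝ, E) 𝓘(ℝ, ℝ) (Φ q) y : E → ℝ) w) c1.symm

end Param

/-! ### Left-invariant vector fields and derivatives in `𝔥*` -/

section Derivatives

variable {F : Type*} [NormedAddCommGroup F] [NormedSpace ℝ F]

/-- The directional derivative `∂_ξ` on `C^∞(𝔥*)`. -/
def baseDeriv (ξ : LieDual F) : Module.End ℝ (BaseFun F) where
  toFun f := ⟨fun μ => fderiv ℝ f μ ξ, by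
    have hf : ContDiff ℝ ∞ f := f.contMDiff.contDiff
    exact ((ContDiff.fderiv_right (m := ∞) (n := ∞) hf le_rfl).clm_apply contDiff_const).contMDiff⟩
  map_add' f g := by
    ext μ
    have hf : Differentiable ℝ f := f.contMDiff.contDiff.differentiable (by simp)
    have hg : Differentiable ℝ g := g.contMDiff.contDiff.differentiable (by simp)
    exact congrArg (fun L : LieDual F →L[ℝ] ℝ => L ξ) (fderiv_add (hf μ) (hg μ))
  map_smul' c f := by
    ext μ
    have hf : Differentiable ℝ f := f.contMDiff.contDiff.differentiable (by simp)
    exact congrArg (fun L : LieDual F →L[ℝ] ℝ => L ξ) (fderiv_const_smul (hf μ) c)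

variable {E : Type*} [NormedAddCommGroup E] [NormedSpace ℝ E]
  {G : Type*} [TopologicalSpace G] [ChartedSpace E G]

theorem contDiff_slice (f : TotalFun F E G) (x : G) :
    ContDiff ℝ ∞ (fun μ : LieDual F => f (μ, x)) :=
  (f.contMDiff.comp (contMDiff_id.prodMk contMDiff_const)).contDiff

theorem contMDiff_slice (f : TotalFun F E G) (μ : LieDual F) :
    ContMDiff 𝓘(ℝ, E) 𝓘(ℝ, ℝ) ∞ (fun x : G => f (μ, x)) :=
  f.contMDiff.comp (contMDiff_const.prodMk contMDiff_id)

variable [IsManifold 𝓘(ℝ, E) ∞ G]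

/-- The partial derivative `∂_ξ` on `C^∞(M)`, in the direction of `ξ ∈ 𝔥*`. -/
def totalDeriv (ξ : LieDual F) : Module.End ℝ (TotalFun F E G) where
  toFun f := ⟨fun p => fderiv ℝ (fun μ => f (μ, p.2)) p.1 ξ, by
    have h := contMDiff_mvfderiv_param (I := 𝓘(ℝ, LieDual F).prod 𝓘(ℝ, E)) (M := LieDual F)
      (fun (p : LieDual F × G) (μ : LieDual F) => f (p.1 + μ, p.2))
      (f.contMDiff.comp (((contMDiff_fst.comp contMDiff_fst).add contMDiff_snd).prodMk
        (contMDiff_snd.comp contMDiff_fst))) 0 ξ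
    refine h.congr fun p => ?_
    rw [mvfderiv_apply_eq_fderiv, fderiv_comp_add_left (f := fun μ => f (μ, p.2)), add_zero]⟩
  map_add' f g := by
    ext p
    exact congrArg (fun L : LieDual F →L[ℝ] ℝ => L ξ)
      (fderiv_add ((contDiff_slice f p.2).differentiable (by simp) p.1)
        ((contDiff_slice g p.2).differentiable (by simp) p.1))
  map_smul' c f := by
    ext p
    exact congrArg (fun L : LieDual F →L[ℝ] ℝ => L ξ)
      (fderiv_const_smul ((contDiff_slice f p.2).differentiable (by simp) p.1) c)

end Derivatives

section LeftInvariant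

variable {F : Type*} [NormedAddCommGroup F] [NormedSpace ℝ F]
  {E : Type*} [NormedAddCommGroup E] [NormedSpace ℝ E]
  {G : Type*} [TopologicalSpace G] [ChartedSpace E G] [Group G] [LieGroup 𝓘(ℝ, E) ∞ G]

/-- The left-invariant vector field on `M = 𝔥* × G` generated by `X ∈ 𝔤`, as an operator on
`C^∞(M)`. -/
def leftDeriv (X : LieAlg E G) : Module.End ℝ (TotalFun F E G) where
  toFun f := ⟨fun p => mvfderiv 𝓘(ℝ, E) (fun y => f (p.1, y)) p.2 (mulInvariantVectorField X p.2),
    by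
    have h := contMDiff_mvfderiv_param (I := 𝓘(ℝ, LieDual F).prod 𝓘(ℝ, E)) (M := G)
      (fun (p : LieDual F × G) (y : G) => f (p.1, p.2 * y))
      (f.contMDiff.comp ((contMDiff_fst.comp contMDiff_fst).prodMk
        ((contMDiff_snd.comp contMDiff_fst).mul contMDiff_snd))) 1 X
    refine h.congr fun p => ?_
    have hm : MDifferentiableAt 𝓘(ℝ, E) 𝓘(ℝ, E) (fun y : G => p.2 * y) 1 :=
      (contMDiff_mul_left (I := 𝓘(ℝ, E)) (n := ∞)).mdifferentiable (by simp) 1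
    have h1 := mvfderiv_comp_apply_of_eq (I := 𝓘(ℝ, E)) (I' := 𝓘(ℝ, E)) (x := (1 : G))
      (y := p.2) (g := fun y => f (p.1, y)) (f := fun y => p.2 * y)
      ((contMDiff_slice f p.1).mdifferentiable (by simp) p.2) hm (mul_one p.2) X
    exact h1.symm⟩
  map_add' f g := by
    ext p
    exact congrArg (fun L : E →L[ℝ] ℝ => L (mulInvariantVectorField X p.2))
      (mvfderiv_add (I := 𝓘(ℝ, E)) ((contMDiff_slice f p.1).mdifferentiable (by simp) p.2)
        ((contMDiff_slice g p.1).mdifferentiable (by simp) p.2))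
  map_smul' c f := by
    ext p
    have h := mvfderiv_smul (I := 𝓘(ℝ, E)) (a := fun _ : G => c) (x := p.2)
      mdifferentiableAt_const ((contMDiff_slice f p.1).mdifferentiable (by simp) p.2)
    have h' := congrArg (fun L : E →L[ℝ] ℝ => L (mulInvariantVectorField X p.2)) h
    refine h'.trans ?_
    rw [mvfderiv_const]
    simp
    rfl

theorem leftDeriv_apply (X : LieAlg E G) (f : TotalFun F E G) (μ : LieDual F) (x : G) :
    leftDeriv X f (μ, x) =
      mvfderiv 𝓘(ℝ, E) (fun y => f (μ, y)) x (mulInvariantVectorField X x) := rfl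

variable [CompleteSpace E]

attribute [local instance] LieRing.ofAssociativeRing LieAlgebra.ofAssociativeAlgebra

/-- `X ↦ X⃗` is a morphism of Lie algebras. -/
def leftDerivHom : LieAlg E G →ₗ⁅ℝ⁆ Module.End ℝ (TotalFun F E G) where
  toFun := leftDeriv
  map_add' X Y := by
    ext f p
    change mvfderiv 𝓘(ℝ, E) (fun y => f (p.1, y)) p.2 (mulInvariantVectorField (X + Y) p.2) = _
    rw [mulInvariantVectorField_add]
    exact map_add (mvfderiv 𝓘(ℝ, E) (fun y => f (p.1, y)) p.2) _ _
  map_smul' c X := by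
    ext f p
    change mvfderiv 𝓘(ℝ, E) (fun y => f (p.1, y)) p.2 (mulInvariantVectorField (c • X) p.2) = _
    rw [mulInvariantVectorField_smul]
    exact map_smul (mvfderiv 𝓘(ℝ, E) (fun y => f (p.1, y)) p.2) _ _
  map_lie' {X Y} := by
    ext f p
    change mvfderiv 𝓘(ℝ, E) (fun y => f (p.1, y)) p.2 (mulInvariantVectorField ⁅X, Y⁆ p.2) =
      leftDeriv X (leftDeriv Y f) p - leftDeriv Y (leftDeriv X f) p
    rw [GroupLieAlgebra.bracket_def, mulInvariantVector_mlieBracket]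
    exact mvfderiv_mlieBracket_apply _ _ (fun y => f (p.1, y)) p.2
      (mdifferentiableAt_mulInvariantVectorField X) (mdifferentiableAt_mulInvariantVectorField Y)
      (contMDiff_slice f p.1)
      ((contMDiff_slice (leftDeriv X f) p.1).mdifferentiable (by simp) p.2)
      ((contMDiff_slice (leftDeriv Y f) p.1).mdifferentiable (by simp) p.2)

/-- The action of `U𝔤` on `C^∞(M)` by left-invariant differential operators. -/
def leftAction : UEnv E G →ₐ[ℝ] Module.End ℝ (TotalFun F E G) :=
  UniversalEnvelopingAlgebra.lift ℝ leftDerivHom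

end LeftInvariant

/-! ### The bialgebra structure of `U𝔤` and functions on `𝔥*` with values in `U𝔤^{⊗n}` -/

section Algebra

variable {F : Type*} [NormedAddCommGroup F] [NormedSpace ℝ F]
  {E : Type*} [NormedAddCommGroup E] [NormedSpace ℝ E] [CompleteSpace E]
  {G : Type*} [TopologicalSpace G] [ChartedSpace E G] [Group G] [LieGroup 𝓘(ℝ, E) ∞ G]

attribute [local instance] LieRing.ofAssociativeRing LieAlgebra.ofAssociativeAlgebra

/-- The canonical map `𝔤 → U𝔤`. -/
def toU : LieAlg E G →ₗ[ℝ] UEnv E G :=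
  (UniversalEnvelopingAlgebra.ι ℝ : LieAlg E G →ₗ⁅ℝ⁆ UEnv E G).toLinearMap

/-- `X ↦ X ⊗ 1 + 1 ⊗ X`. -/
def primitiveHom : LieAlg E G →ₗ⁅ℝ⁆ UEnv E G ⊗[ℝ] UEnv E G where
  toFun X := toU X ⊗ₜ[ℝ] 1 + 1 ⊗ₜ[ℝ] toU X
  map_add' X Y := by
    simp only [map_add, TensorProduct.add_tmul, TensorProduct.tmul_add]
    abel
  map_smul' c X := by
    simp only [map_smul, TensorProduct.smul_tmul', TensorProduct.tmul_smul, smul_add,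
      RingHom.id_apply]
  map_lie' {X Y} := by
    have h : toU ⁅X, Y⁆ = toU X * toU Y - toU Y * toU X :=
      LieHom.map_lie (UniversalEnvelopingAlgebra.ι ℝ : LieAlg E G →ₗ⁅ℝ⁆ UEnv E G) X Y
    rw [h, LieRing.of_associative_ring_bracket]
    simp only [add_mul, mul_add, Algebra.TensorProduct.tmul_mul_tmul, one_mul, mul_one,
      TensorProduct.sub_tmul, TensorProduct.tmul_sub]
    abel

/-- The comultiplication `Δ` of `U𝔤`. -/
def comul : UEnv E G →ₐ[ℝ] UEnv E G ⊗[ℝ] UEnv E G :=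
  UniversalEnvelopingAlgebra.lift ℝ primitiveHom

/-- The counit `ε` of `U𝔤`. -/
def counit : UEnv E G →ₐ[ℝ] ℝ :=
  UniversalEnvelopingAlgebra.lift ℝ 0

variable (F) in
/-- `C^∞(𝔥*) ⊗ A`: the smooth functions on `𝔥*` with values in the (possibly infinite-dimensional)
vector space `A` that take values in a finite-dimensional subspace, i.e. the finite sums
`∑ a_j(λ) v_j` with `a_j ∈ C^∞(𝔥*)` and `v_j ∈ A`. -/
abbrev FunTensor (A : Type*) [AddCommGroup A] [Module ℝ A] : Type _ := BaseFun F ⊗[ℝ] A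

/-- A morphism `A → A'` applied to the values of functions on `𝔥*`. -/
def onValues {A A' : Type*} [Ring A] [Algebra ℝ A] [Ring A'] [Algebra ℝ A'] (φ : A →ₐ[ℝ] A') :
    FunTensor F A →ₐ[ℝ] FunTensor F A' :=
  Algebra.TensorProduct.map (AlgHom.id ℝ (BaseFun F)) φ

/-- The same for formal power series in `ħ`. -/
def onSeries {A A' : Type*} [Ring A] [Algebra ℝ A] [Ring A'] [Algebra ℝ A'] (φ : A →ₐ[ℝ] A') :
    PowerSeries (FunTensor F A) →+* PowerSeries (FunTensor F A') :=
  PowerSeries.map (onValues (F := F) φ).toRingHom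

/-- The constant function on `𝔥*` with value `a`. -/
def constFun {A : Type*} [Ring A] [Algebra ℝ A] : A →ₐ[ℝ] FunTensor F A :=
  Algebra.TensorProduct.includeRight

/-- `∂_ξ` on `A`-valued functions on `𝔥*`. -/
def valDeriv (A : Type*) [AddCommGroup A] [Module ℝ A] (ξ : LieDual F) :
    Module.End ℝ (FunTensor F A) :=
  LinearMap.rTensor A (baseDeriv ξ)

section Slots

variable {A : Type*} [Ring A] [Algebra ℝ A]

/-- `u ⊗ v ↦ u ⊗ v ⊗ 1`. -/
def emb12 : A ⊗[ℝ] A →ₐ[ℝ] A ⊗[ℝ] (A ⊗[ℝ] A) :=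
  Algebra.TensorProduct.map (AlgHom.id ℝ A) Algebra.TensorProduct.includeLeft

/-- `u ⊗ v ↦ u ⊗ 1 ⊗ v`. -/
def emb13 : A ⊗[ℝ] A →ₐ[ℝ] A ⊗[ℝ] (A ⊗[ℝ] A) :=
  Algebra.TensorProduct.map (AlgHom.id ℝ A) Algebra.TensorProduct.includeRight

/-- `u ⊗ v ↦ 1 ⊗ u ⊗ v`. -/
def emb23 : A ⊗[ℝ] A →ₐ[ℝ] A ⊗[ℝ] (A ⊗[ℝ] A) := Algebra.TensorProduct.includeRight

/-- `u ↦ u ⊗ 1 ⊗ 1`. -/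
def slot1 (u : A) : A ⊗[ℝ] (A ⊗[ℝ] A) := u ⊗ₜ[ℝ] (1 ⊗ₜ[ℝ] 1)

/-- `u ↦ 1 ⊗ u ⊗ 1`. -/
def slot2 (u : A) : A ⊗[ℝ] (A ⊗[ℝ] A) := 1 ⊗ₜ[ℝ] (u ⊗ₜ[ℝ] 1)

/-- `u ↦ 1 ⊗ 1 ⊗ u`. -/
def slot3 (u : A) : A ⊗[ℝ] (A ⊗[ℝ] A) := 1 ⊗ₜ[ℝ] (1 ⊗ₜ[ℝ] u)

/-- `u ⊗ v ↦ v ⊗ u`. -/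
def swap : A ⊗[ℝ] A →ₐ[ℝ] A ⊗[ℝ] A := (Algebra.TensorProduct.comm ℝ A A).toAlgHom

end Slots

/-- `Δ ⊗ id`. -/
def comulLeft : UEnv E G ⊗[ℝ] UEnv E G →ₐ[ℝ] UEnv E G ⊗[ℝ] (UEnv E G ⊗[ℝ] UEnv E G) :=
  (Algebra.TensorProduct.assoc ℝ ℝ ℝ (UEnv E G) (UEnv E G) (UEnv E G)).toAlgHom.comp
    (Algebra.TensorProduct.map comul (AlgHom.id ℝ (UEnv E G)))

/-- `id ⊗ Δ`. -/
def comulRight : UEnv E G ⊗[ℝ] UEnv E G →ₐ[ℝ] UEnv E G ⊗[ℝ] (UEnv E G ⊗[ℝ] UEnv E G) :=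
  Algebra.TensorProduct.map (AlgHom.id ℝ (UEnv E G)) comul

/-- `ε ⊗ id`. -/
def counitLeft : UEnv E G ⊗[ℝ] UEnv E G →ₐ[ℝ] UEnv E G :=
  (Algebra.TensorProduct.lid ℝ (UEnv E G)).toAlgHom.comp
    (Algebra.TensorProduct.map counit (AlgHom.id ℝ (UEnv E G)))

/-- `id ⊗ ε`. -/
def counitRight : UEnv E G ⊗[ℝ] UEnv E G →ₐ[ℝ] UEnv E G :=
  (Algebra.TensorProduct.rid ℝ ℝ (UEnv E G)).toAlgHom.comp
    (Algebra.TensorProduct.map (AlgHom.id ℝ (UEnv E G)) counit)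

end Algebra

/-! ### The abelian Lie subgroup, coordinates and shifted arguments -/

section Subgroup

variable {F : Type*} [NormedAddCommGroup F] [NormedSpace ℝ F]
  {E : Type*} [NormedAddCommGroup E] [NormedSpace ℝ E]
  {G : Type*} [TopologicalSpace G] [ChartedSpace E G] [Group G]
  {H : Type*} [TopologicalSpace H] [ChartedSpace F H] [CommGroup H]

/-- `ι : H → G` exhibits the Lie group `H` as an (immersed) Lie subgroup of `G`. -/
structure IsLieSubgroup (ι : H →* G) : Prop where
  smooth : ContMDiff 𝓘(ℝ, F) 𝓘(ℝ, E) ∞ ι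
  injective : Function.Injective ι
  immersion : ∀ s : H, Function.Injective (mfderiv 𝓘(ℝ, F) 𝓘(ℝ, E) ι s)

/-- The inclusion `𝔥 → 𝔤`, i.e. the derivative of `ι` at the identity
(the vector space underlying `𝔥 = T₁H` is `F`). -/
def lieIncl (ι : H →* G) : F →ₗ[ℝ] LieAlg E G :=
  (show F →L[ℝ] E from mfderiv 𝓘(ℝ, F) 𝓘(ℝ, E) ι 1).toLinearMap

end Subgroup

section Coordinates

variable {F : Type*} [NormedAddCommGroup F] [NormedSpace ℝ F] [FiniteDimensional ℝ F]
  {κ : Type*} [Fintype κ] (b : Module.Basis κ ℝ F)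

/-- The dual basis of `𝔥*`. For `b = (h_i)`, the derivative in the direction `dualVec b i`
is `∂/∂λ^i`. -/
def dualVec (i : κ) : LieDual F := LinearMap.toContinuousLinearMap (b.coord i)

variable {A : Type*} [Ring A] [Algebra ℝ A]

/-- The operator `∑_i η_i ∂/∂λ^i` on `A`-valued functions. -/
def shiftOp (η : κ → A) : Module.End ℝ (FunTensor F A) :=
  ∑ i, (LinearMap.mulLeft ℝ (constFun (F := F) (η i))).comp (valDeriv A (dualVec b i))

/-- The Taylor series `X(λ + c ħ η) = ∑_k ((c ħ)^k / k!) (∑_i η_i ∂/∂λ^i)^k X(λ)`; for commuting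
`η_i` the `k`-th term is
`((c ħ)^k / k!) ∑_{i_1 … i_k} η_{i_1} ⋯ η_{i_k} ∂^k X / ∂λ^{i_1} ⋯ ∂λ^{i_k}`. -/
def shift (c : ℝ) (η : κ → A) (X : PowerSeries (FunTensor F A)) : PowerSeries (FunTensor F A) :=
  PowerSeries.mk fun n => ∑ p ∈ Finset.HasAntidiagonal.antidiagonal n,
    (c ^ p.2 / (p.2.factorial : ℝ)) • ((shiftOp b η) ^ p.2) (coeff p.1 X)

end Coordinates

/-! ### Differential operators and star products -/

section StarProduct

variable {C : Type*} [CommRing C] [Algebra ℝ C]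

/-- Linear differential operators of order at most `n` on a commutative algebra: those of order
at most `0` are the multiplication operators, and `D` has order at most `n + 1` if all
commutators `[D, f]` have order at most `n`. -/
def IsDiffOp : ℕ → Module.End ℝ C → Prop
  | 0, D => ∀ f g, D (f * g) = f * D g
  | n + 1, D => ∀ f, IsDiffOp n (D * LinearMap.mulLeft ℝ f - LinearMap.mulLeft ℝ f * D)

/-- Bidifferential operators: of bounded order in each argument. -/
def IsBidiffOp (B : C →ₗ[ℝ] C →ₗ[ℝ] C) : Prop :=
  ∃ n, ∀ g, IsDiffOp n (B g) ∧ IsDiffOp n (B.flip g)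

/-- A star product on `C[[ħ]]` quantizing the bracket `{·,·}`: an associative product of the form
`f ⋆ g = fg + ħ B₁(f, g) + ħ² B₂(f, g) + ⋯`, extended `ħ`-linearly, with bidifferential operators
`B_k`, unit `1`, and `B₁(f, g) - B₁(g, f) = {f, g}`. -/
structure IsStarProduct (bracket : C → C → C)
    (S : PowerSeries C → PowerSeries C → PowerSeries C) : Prop where
  cochains : ∃ B : ℕ → C →ₗ[ℝ] C →ₗ[ℝ] C,
    (∀ k, IsBidiffOp (B k)) ∧
    (∀ f g, B 0 f g = f * g) ∧
    (∀ f g, B 1 f g - B 1 g f = bracket f g) ∧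
    ∀ f g n, coeff n (S f g) = ∑ p ∈ Finset.HasAntidiagonal.antidiagonal n,
      ∑ q ∈ Finset.HasAntidiagonal.antidiagonal p.2,
      B p.1 (coeff q.1 f) (coeff q.2 g)
  assoc : ∀ f g h, S (S f g) h = S f (S g h)
  one_left : ∀ f, S 1 f = f
  one_right : ∀ f, S f 1 = f

end StarProduct

section Operators

variable {F : Type*} [NormedAddCommGroup F] [NormedSpace ℝ F]
  {E : Type*} [NormedAddCommGroup E] [NormedSpace ℝ E] [CompleteSpace E]
  {G : Type*} [TopologicalSpace G] [ChartedSpace E G] [Group G] [LieGroup 𝓘(ℝ, E) ∞ G]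

/-- The left-invariant differential operator on `M` given by `T ∈ C^∞(𝔥*) ⊗ U𝔤`. -/
def opOne : FunTensor F (UEnv E G) →ₗ[ℝ] Module.End ℝ (TotalFun F E G) :=
  TensorProduct.lift (LinearMap.compl₁₂ (LinearMap.mul ℝ (Module.End ℝ (TotalFun F E G)))
    ((Algebra.lmul ℝ (TotalFun F E G)).toLinearMap.comp baseIncl.toLinearMap)
    leftAction.toLinearMap)

theorem opOne_tmul (a : BaseFun F) (u : UEnv E G) (f : TotalFun F E G) :
    opOne (a ⊗ₜ[ℝ] u) f = baseIncl a * leftAction u f := rfl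

/-- The bidifferential operator `(f, g) ↦ u⃗ f · v⃗ g` given by `u ⊗ v ∈ U𝔤 ⊗ U𝔤`. -/
def leftAction₂ :
    UEnv E G ⊗[ℝ] UEnv E G →ₗ[ℝ] TotalFun F E G →ₗ[ℝ] TotalFun F E G →ₗ[ℝ] TotalFun F E G :=
  TensorProduct.lift (LinearMap.mk₂ ℝ
    (fun u v => (LinearMap.mul ℝ (TotalFun F E G)).compl₁₂ (leftAction u) (leftAction v))
    (fun u u' v => by ext1 f; ext1 g; simp)
    (fun c u v => by ext1 f; ext1 g; simp)
    (fun u v v' => by ext1 f; ext1 g; simp [mul_add])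
    (fun c u v => by ext1 f; ext1 g; simp))

/-- The left-invariant bidifferential operator on `M` given by `K ∈ C^∞(𝔥*) ⊗ U𝔤 ⊗ U𝔤`. -/
def opTwo : FunTensor F (UEnv E G ⊗[ℝ] UEnv E G) →ₗ[ℝ]
    TotalFun F E G →ₗ[ℝ] TotalFun F E G →ₗ[ℝ] TotalFun F E G :=
  TensorProduct.lift (LinearMap.mk₂ ℝ
    (fun a w => (leftAction₂ w).compr₂ (LinearMap.mulLeft ℝ (baseIncl a)))
    (fun a a' w => by ext1 f; ext1 g; simp [add_mul])
    (fun c a w => by ext1 f; ext1 g; simp)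
    (fun a w w' => by ext1 f; ext1 g; simp [mul_add])
    (fun c a w => by ext1 f; ext1 g; simp))

theorem opTwo_tmul (a : BaseFun F) (u v : UEnv E G) (f g : TotalFun F E G) :
    opTwo (a ⊗ₜ[ℝ] (u ⊗ₜ[ℝ] v)) f g = baseIncl a * (leftAction u f * leftAction v g) := rfl

/-- `T⃗ f` for `T ∈ (C^∞(𝔥*) ⊗ U𝔤)[[ħ]]` and `f ∈ C^∞(M)[[ħ]]`. -/
def seriesOp (T : PowerSeries (FunTensor F (UEnv E G))) (f : PowerSeries (TotalFun F E G)) :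
    PowerSeries (TotalFun F E G) :=
  PowerSeries.mk fun n => ∑ p ∈ Finset.HasAntidiagonal.antidiagonal n, opOne (coeff p.1 T) (coeff p.2 f)

/-- `K⃗(f, g)` for `K ∈ (C^∞(𝔥*) ⊗ U𝔤 ⊗ U𝔤)[[ħ]]` and `f, g ∈ C^∞(M)`. -/
def seriesOp₂ (K : PowerSeries (FunTensor F (UEnv E G ⊗[ℝ] UEnv E G))) (f g : TotalFun F E G) :
    PowerSeries (TotalFun F E G) :=
  PowerSeries.mk fun n => opTwo (coeff n K) f g

end Operators

/-! ### Dynamical `r`-matrices, compatible star products, quantizations -/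

section Dynamical

variable {F : Type*} [NormedAddCommGroup F] [NormedSpace ℝ F] [FiniteDimensional ℝ F]
  {E : Type*} [NormedAddCommGroup E] [NormedSpace ℝ E] [CompleteSpace E]
  {G : Type*} [TopologicalSpace G] [ChartedSpace E G] [Group G] [LieGroup 𝓘(ℝ, E) ∞ G]
  {H : Type*} [TopologicalSpace H] [ChartedSpace F H] [CommGroup H]
  {κ : Type*} [Fintype κ] (ι : H →* G) (b : Module.Basis κ ℝ F)

/-- The basis element `h_i` of `𝔥`, as an element of `U𝔤`. -/
def hU (i : κ) : UEnv E G := toU (lieIncl ι (b i))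

/-- A function `𝔥* → 𝔤 ⊗ 𝔤` regarded as a function `𝔥* → U𝔤 ⊗ U𝔤`. -/
def rToU : FunTensor F (LieAlg E G ⊗[ℝ] LieAlg E G) →ₗ[ℝ]
    FunTensor F (UEnv E G ⊗[ℝ] UEnv E G) :=
  LinearMap.lTensor (BaseFun F) (TensorProduct.map toU toU)

/-- Triangular dynamical `r`-matrices `r : 𝔥* → ∧²𝔤`, where `∧²𝔤` is the space of skew-symmetric
tensors in `𝔤 ⊗ 𝔤` and `X ∧ Y = X ⊗ Y - Y ⊗ X`. The classical dynamical Yang–Baxter equation is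
`∑_i (h_i^{(1)} ∂_i r^{23} - h_i^{(2)} ∂_i r^{13} + h_i^{(3)} ∂_i r^{12})
  + [r^{12}, r^{13}] + [r^{12}, r^{23}] + [r^{13}, r^{23}] = 0`,
which for skew-symmetric `r` reads `∑_i h_i ∧ ∂_i r + ½ [r, r] = 0`. -/
structure IsTriangularDynamicalRMatrix
    (r : FunTensor F (LieAlg E G ⊗[ℝ] LieAlg E G)) : Prop where
  skew : LinearMap.lTensor (BaseFun F)
    (TensorProduct.comm ℝ (LieAlg E G) (LieAlg E G)).toLinearMap r = -r
  zero_weight : ∀ h : F, LinearMap.lTensor (BaseFun F)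
    (LinearMap.rTensor (LieAlg E G) (LieAlgebra.ad ℝ (LieAlg E G) (lieIncl ι h)) +
      LinearMap.lTensor (LieAlg E G) (LieAlgebra.ad ℝ (LieAlg E G) (lieIncl ι h))) r = 0
  cdybe :
    (∑ i, (constFun (slot1 (hU ι b i)) *
          onValues emb23 (valDeriv _ (dualVec b i) (rToU r)) -
        constFun (slot2 (hU ι b i)) *
          onValues emb13 (valDeriv _ (dualVec b i) (rToU r)) +
        constFun (slot3 (hU ι b i)) *
          onValues emb12 (valDeriv _ (dualVec b i) (rToU r)))) +
      (onValues emb12 (rToU r) * onValues emb13 (rToU r) -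
        onValues emb13 (rToU r) * onValues emb12 (rToU r)) +
      (onValues emb12 (rToU r) * onValues emb23 (rToU r) -
        onValues emb23 (rToU r) * onValues emb12 (rToU r)) +
      (onValues emb13 (rToU r) * onValues emb23 (rToU r) -
        onValues emb23 (rToU r) * onValues emb13 (rToU r)) = 0

/-- The Poisson bracket on `C^∞(M)` of `π = ∑_i h⃗_i ∧ ∂/∂λ^i + r⃗(λ)`. -/
def poissonBracket (r : FunTensor F (LieAlg E G ⊗[ℝ] LieAlg E G)) (f g : TotalFun F E G) :
    TotalFun F E G :=
  (∑ i, (leftDeriv (lieIncl ι (b i)) f * totalDeriv (dualVec b i) g -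
    totalDeriv (dualVec b i) f * leftDeriv (lieIncl ι (b i)) g)) + opTwo (rToU r) f g

/-- `θ = ½ ∑_i (h_i ⊗ ∂/∂λ^i - ∂/∂λ^i ⊗ h_i)`, acting on `C^∞(M) ⊗ C^∞(M)`. -/
def theta : Module.End ℝ (TotalFun F E G ⊗[ℝ] TotalFun F E G) :=
  (1 / 2 : ℝ) • ∑ i,
    (TensorProduct.map (leftDeriv (lieIncl ι (b i))) (totalDeriv (dualVec b i)) -
      TensorProduct.map (totalDeriv (dualVec b i)) (leftDeriv (lieIncl ι (b i))))

/-- `Θ⃗(f, g)` for `Θ = exp(ħ θ)`. -/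
def Theta (f g : TotalFun F E G) : PowerSeries (TotalFun F E G) :=
  PowerSeries.mk fun k => (1 / (k.factorial : ℝ)) •
    LinearMap.mul' ℝ (TotalFun F E G) ((theta ι b ^ k) (f ⊗ₜ[ℝ] g))

/-- A function on `M` as a constant power series. -/
abbrev cst (f : TotalFun F E G) : PowerSeries (TotalFun F E G) := PowerSeries.C f

/-- `f ⋆ g = K⃗(f, g)` for all `f, g ∈ C^∞(G)`. -/
def IsSymbol (S : PowerSeries (TotalFun F E G) → PowerSeries (TotalFun F E G) →
      PowerSeries (TotalFun F E G))
    (K : PowerSeries (FunTensor F (UEnv E G ⊗[ℝ] UEnv E G))) : Prop :=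
  ∀ f g : GroupFun E G,
    S (cst (groupIncl f)) (cst (groupIncl g)) = seriesOp₂ K (groupIncl f) (groupIncl g)

/-- Compatible star products on the Poisson manifold `M = 𝔥* × G` associated with `r`: star
products invariant under left translations by `G` and right translations by `H` such that
`f ⋆ g = fg` for `f, g ∈ C^∞(𝔥*)`, `f ⋆ g = Θ⃗(f, g)` and `g ⋆ f = Θ⃗(g, f)` for
`f ∈ C^∞(𝔥*)`, `g ∈ C^∞(G)`, and `f ⋆ g = K⃗(f, g)` for `f, g ∈ C^∞(G)`, for some
smooth `K : 𝔥* → (U𝔤 ⊗ U𝔤)[[ħ]]`. -/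
structure IsCompatible (r : FunTensor F (LieAlg E G ⊗[ℝ] LieAlg E G))
    (S : PowerSeries (TotalFun F E G) → PowerSeries (TotalFun F E G) →
      PowerSeries (TotalFun F E G)) : Prop where
  star : IsStarProduct (poissonBracket ι b r) S
  left_invariant : ∀ (a : G) (f g : PowerSeries (TotalFun F E G)),
    S (PowerSeries.map (leftTranslate a).toRingHom f)
        (PowerSeries.map (leftTranslate a).toRingHom g) =
      PowerSeries.map (leftTranslate a).toRingHom (S f g)
  right_invariant : ∀ (s : H) (f g : PowerSeries (TotalFun F E G)),
    S (PowerSeries.map (rightTranslate (ι s)).toRingHom f)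
        (PowerSeries.map (rightTranslate (ι s)).toRingHom g) =
      PowerSeries.map (rightTranslate (ι s)).toRingHom (S f g)
  base_base : ∀ f g : BaseFun F,
    S (cst (baseIncl f)) (cst (baseIncl g)) = cst (baseIncl f * baseIncl g)
  base_group : ∀ (f : BaseFun F) (g : GroupFun E G),
    S (cst (baseIncl f)) (cst (groupIncl g)) = Theta ι b (baseIncl f) (groupIncl g)
  group_base : ∀ (f : BaseFun F) (g : GroupFun E G),
    S (cst (groupIncl g)) (cst (baseIncl f)) = Theta ι b (groupIncl g) (baseIncl f)
  group_group : ∃ K, IsSymbol S K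

/-- Quantizations of a dynamical `r`-matrix. -/
structure IsQuantization (r : FunTensor F (LieAlg E G ⊗[ℝ] LieAlg E G))
    (K : PowerSeries (FunTensor F (UEnv E G ⊗[ℝ] UEnv E G))) : Prop where
  constant_term : constantCoeff K = 1
  zero_weight : ∀ (h : F) (n : ℕ), Commute
    (constFun (1 ⊗ₜ[ℝ] toU (lieIncl ι h) + toU (lieIncl ι h) ⊗ₜ[ℝ] 1)) (coeff n K)
  shifted_cocycle :
    onSeries comulLeft K *
        shift b (-1 / 2) (fun i => slot3 (hU ι b i)) (onSeries emb12 K) =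
      onSeries comulRight K *
        shift b (1 / 2) (fun i => slot1 (hU ι b i)) (onSeries emb23 K)
  normal_left : onSeries counitLeft K = 1
  normal_right : onSeries counitRight K = 1
  classical_limit : coeff 1 K - onValues swap (coeff 1 K) = rToU r

/-- The inverse of a formal power series with constant term `1`. -/
def inv₁ {A : Type*} [Ring A] (T : PowerSeries A) : PowerSeries A := PowerSeries.invOfUnit T 1

theorem mul_inv₁ {A : Type*} [Ring A] (T : PowerSeries A) (h : constantCoeff T = 1) :
    T * inv₁ T = 1 := PowerSeries.mul_invOfUnit T 1 h

theorem inv₁_mul {A : Type*} [Ring A] (T : PowerSeries A) (h : constantCoeff T = 1) :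
    inv₁ T * T = 1 := PowerSeries.invOfUnit_mul T 1 h

/-- Gauge elements: `T : 𝔥* → (U𝔤)^𝔥[[ħ]]` with `T ≡ 1 mod ħ` and `ε(T) = 1`. -/
structure IsGauge (T : PowerSeries (FunTensor F (UEnv E G))) : Prop where
  constant_term : constantCoeff T = 1
  invariant : ∀ (h : F) (n : ℕ), Commute (constFun (toU (lieIncl ι h))) (coeff n T)
  counit : onSeries counit T = 1

/-- The product `(f, g) ↦ T⃗⁻¹(T⃗ f ⋆ T⃗ g)`. -/
def conjugate (T : PowerSeries (FunTensor F (UEnv E G)))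
    (S : PowerSeries (TotalFun F E G) → PowerSeries (TotalFun F E G) →
      PowerSeries (TotalFun F E G)) (f g : PowerSeries (TotalFun F E G)) :
    PowerSeries (TotalFun F E G) :=
  seriesOp (inv₁ T) (S (seriesOp T f) (seriesOp T g))

/-- `ΔT(λ)⁻¹ K(λ) T₁(λ - ½ħh^{(2)}) T₂(λ + ½ħh^{(1)})`. -/
def gauge (T : PowerSeries (FunTensor F (UEnv E G)))
    (K : PowerSeries (FunTensor F (UEnv E G ⊗[ℝ] UEnv E G))) :
    PowerSeries (FunTensor F (UEnv E G ⊗[ℝ] UEnv E G)) :=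
  onSeries comul (inv₁ T) * K *
    shift b (-1 / 2) (fun i => (1 : UEnv E G) ⊗ₜ[ℝ] hU ι b i)
      (onSeries Algebra.TensorProduct.includeLeft T) *
    shift b (1 / 2) (fun i => hU ι b i ⊗ₜ[ℝ] (1 : UEnv E G))
      (onSeries Algebra.TensorProduct.includeRight T)

end Dynamical

end DynStar

end

open scoped Manifold ContDiff TensorProduct
open PowerSeries (coeff constantCoeff)

noncomputable section

set_option linter.unusedSectionVars false

namespace DynStar

/-! Conjugation by the invertible series `T⃗` preserves associativity, the unit and the finite order
of the cochains. The first-order cochain changes only by terms symmetric in `f` and `g`, so the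
Poisson bracket stays the same. Left-invariant operators act on functions of `λ` through `ε`, hence
`ε(T) = 1` makes `T⃗` fix `C^∞(𝔥*)`. Because `T` is `𝔥`-invariant, `T⃗` commutes with right
translations by the connected group `H`, and on functions on `G` it also commutes with star
multiplication by functions of `λ`.

The formula for `E` comes from associativity. Left star multiplication of functions on `G` by
functions of `λ` is the Taylor shift `exp(-½ħ ∑ h_i ∂_i)`. The shift is invertible, so a pointwise
product of a function of `λ` with a function on `G` is a series of star products `a ⋆ f`. Then `(a ⋆
f) ⋆ k = a ⋆ (f ⋆ k)`, and on `f ⋆ k = F⃗(f, k)` the factor `a` acts by the shift along `Δh_i =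
h_i^{(1)} + h_i^{(2)}`. The `h^{(1)}` part cancels the inverse shift, and `-½ħh^{(2)}` remains. This
is `IsBaseProduct.mapCoeff_left`. Applied to the star product and to its opposite (where `-½`
becomes `½`) it produces the factors `T_1` and `T_2` with their shifts, while `T⃗⁻¹` acts on a
product through `Δ` (`gAct_ev₂`). Applied to `(f ⋆ g) ⋆ k` and `f ⋆ (g ⋆ k)` it produces the two
sides of the shifted cocycle condition.

Identities of operators become identities in `(U𝔤)^{⊗n}` because `U𝔤` acts faithfully on functions
at the identity: powers of a function vanishing at `1` with prescribed differential detect leading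
symbols (`eq_zero_of_ev₁`, `eq_zero_of_ev₂`, `eq_zero_of_ev₃`). Zero weight of a symbol follows by
differentiating right `H`-invariance along curves in `H`. Thus the symbol of any compatible star
product is a quantization (`IsSymbol.isQuantization`), and `E` is the symbol of the conjugated one.
-/

/-! ### `ħ`-linear maps between rings of formal power series -/

section HLin

variable {A B : Type*} [Semiring A] [Semiring B]

/-- Additive maps of formal power series that commute with multiplication by `ħ`. -/
structure HLin (Φ : PowerSeries A → PowerSeries B) : Prop where
  add : ∀ x y, Φ (x + y) = Φ x + Φ y
  mul_X : ∀ x, Φ (PowerSeries.X * x) = PowerSeries.X * Φ x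

theorem HLin.id : HLin (id : PowerSeries A → PowerSeries A) := ⟨fun _ _ => rfl, fun _ => rfl⟩

theorem HLin.comp {D : Type*} [Semiring D] {Ψ : PowerSeries B → PowerSeries D} {Φ : PowerSeries A → PowerSeries B}
    (hΨ : HLin Ψ) (hΦ : HLin Φ) : HLin (fun x => Ψ (Φ x)) :=
  ⟨fun x y => by rw [hΦ.add, hΨ.add], fun x => by rw [hΦ.mul_X, hΨ.mul_X]⟩

theorem HLin.mul_left (a : PowerSeries A) : HLin (fun x => a * x) :=
  ⟨fun x y => mul_add a x y, fun x => by
    rw [← mul_assoc, ← mul_assoc, (PowerSeries.commute_X a).eq]⟩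

theorem HLin.mul_right (a : PowerSeries A) : HLin (fun x => x * a) :=
  ⟨fun x y => add_mul x y a, fun x => by rw [mul_assoc]⟩

theorem HLin.map (φ : A →+* B) : HLin (PowerSeries.map φ) :=
  ⟨fun x y => map_add _ x y, fun x => by rw [map_mul, PowerSeries.map_X]⟩

theorem eq_X_mul_add_C (x : PowerSeries A) :
    x = PowerSeries.X * (PowerSeries.mk fun n => coeff (n + 1) x) +
      PowerSeries.C (constantCoeff x) :=
  PowerSeries.eq_X_mul_shift_add_const x

/-- Commuting with `ħ` already forces `ħ`-adic continuity: splitting off the constant term and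
pulling `ħ` out, the coefficient of order `n` sees only finitely many coefficients of `x`. No
linearity over `ℝ` is needed. -/
theorem HLin.coeff_eq {Φ : PowerSeries A → PowerSeries B} (h : HLin Φ) (n : ℕ)
    (x : PowerSeries A) :
    coeff n (Φ x) = ∑ p ∈ Finset.HasAntidiagonal.antidiagonal n,
      coeff p.2 (Φ (PowerSeries.C (coeff p.1 x))) := by
  induction n generalizing x with
  | zero =>
    conv_lhs => rw [eq_X_mul_add_C x, h.add, h.mul_X]
    simp
  | succ n ih =>
    conv_lhs => rw [eq_X_mul_add_C x, h.add, h.mul_X, map_add, PowerSeries.coeff_succ_X_mul, ih]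
    rw [Finset.Nat.sum_antidiagonal_succ, add_comm]
    simp

/-- Only the coefficients of the given `x` are tested, which matters when they are known to lie in a
subspace such as a centralizer. -/
theorem HLin.ext_coeff {Φ Ψ : PowerSeries A → PowerSeries B} (hΦ : HLin Φ) (hΨ : HLin Ψ)
    (x : PowerSeries A)
    (h : ∀ n, Φ (PowerSeries.C (coeff n x)) = Ψ (PowerSeries.C (coeff n x))) : Φ x = Ψ x := by
  ext n
  rw [hΦ.coeff_eq, hΨ.coeff_eq]
  exact Finset.sum_congr rfl fun p _ => by rw [h]

theorem HLin.ext {Φ Ψ : PowerSeries A → PowerSeries B} (hΦ : HLin Φ) (hΨ : HLin Ψ)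
    (h : ∀ a, Φ (PowerSeries.C a) = Ψ (PowerSeries.C a)) (x : PowerSeries A) : Φ x = Ψ x :=
  hΦ.ext_coeff hΨ x fun _ => h _

theorem HLin.map_zero {B' : Type*} [Ring B'] {Φ : PowerSeries A → PowerSeries B'}
    (h : HLin Φ) : Φ 0 = 0 := by
  have := h.add 0 0
  simpa using this

/-- Reduces identities between `ħ`-linear operations to constant series `a ⊗ w`, on which the axioms
of a star product can be applied. -/
theorem HLin.ext_tensor {R N B : Type*} [Ring R] [Algebra ℝ R] [Ring N] [Algebra ℝ N] [Ring B]
    {Φ Ψ : PowerSeries (R ⊗[ℝ] N) → PowerSeries B} (hΦ : HLin Φ) (hΨ : HLin Ψ)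
    (h : ∀ a w, Φ (PowerSeries.C (a ⊗ₜ[ℝ] w)) = Ψ (PowerSeries.C (a ⊗ₜ[ℝ] w)))
    (x : PowerSeries (R ⊗[ℝ] N)) : Φ x = Ψ x := by
  refine hΦ.ext hΨ (fun z => ?_) x
  induction z using TensorProduct.induction_on with
  | zero => rw [_root_.map_zero, hΦ.map_zero, hΨ.map_zero]
  | tmul a w => exact h a w
  | add z z' hz hz' => rw [map_add, hΦ.add, hΨ.add, hz, hz']

end HLin

/-- A linear map applied to all coefficients of a formal power series. -/
def mapCoeff {A B : Type*} [Ring A] [Algebra ℝ A] [Ring B] [Algebra ℝ B] (φ : A →ₗ[ℝ] B)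
    (x : PowerSeries A) : PowerSeries B :=
  PowerSeries.mk fun n => φ (coeff n x)

section MapCoeff

variable {A B : Type*} [Ring A] [Algebra ℝ A] [Ring B] [Algebra ℝ B]

@[simp] theorem coeff_mapCoeff (φ : A →ₗ[ℝ] B) (x : PowerSeries A) (n : ℕ) :
    coeff n (mapCoeff φ x) = φ (coeff n x) := PowerSeries.coeff_mk _ _

theorem HLin.mapCoeff (φ : A →ₗ[ℝ] B) : HLin (mapCoeff φ) :=
  ⟨fun x y => by ext n; simp, fun x => by
    ext n; cases n <;> simp [PowerSeries.coeff_succ_X_mul]⟩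

theorem mapCoeff_C (φ : A →ₗ[ℝ] B) (a : A) : mapCoeff φ (PowerSeries.C a) = PowerSeries.C (φ a) := by
  ext n; rw [coeff_mapCoeff, PowerSeries.coeff_C, PowerSeries.coeff_C]; split_ifs <;> simp

end MapCoeff

/-! ### Exponentials of operators -/

section ExpOp

variable {V W : Type*} [Ring V] [Algebra ℝ V] [Ring W] [Algebra ℝ W]

/-- The operator `exp (c ħ D)` on formal power series. -/
def expOp (c : ℝ) (D : Module.End ℝ V) (x : PowerSeries V) : PowerSeries V :=
  PowerSeries.mk fun n => ∑ p ∈ Finset.HasAntidiagonal.antidiagonal n,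
    (c ^ p.2 / (p.2.factorial : ℝ)) • (D ^ p.2) (coeff p.1 x)

theorem coeff_expOp (c : ℝ) (D : Module.End ℝ V) (x : PowerSeries V) (n : ℕ) :
    coeff n (expOp c D x) = ∑ p ∈ Finset.HasAntidiagonal.antidiagonal n,
    (c ^ p.2 / (p.2.factorial : ℝ)) • (D ^ p.2) (coeff p.1 x) := PowerSeries.coeff_mk _ _

theorem HLin.expOp (c : ℝ) (D : Module.End ℝ V) : HLin (expOp c D) :=
  ⟨fun x y => by ext n; simp [coeff_expOp, Finset.sum_add_distrib], fun x => by
    ext n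
    cases n with
    | zero => simp [coeff_expOp]
    | succ n =>
      rw [PowerSeries.coeff_succ_X_mul, coeff_expOp, coeff_expOp,
        Finset.Nat.sum_antidiagonal_succ]
      simp [PowerSeries.coeff_succ_X_mul]⟩

theorem coeff_expOp_C (c : ℝ) (D : Module.End ℝ V) (a : V) (n : ℕ) :
    coeff n (expOp c D (PowerSeries.C a)) = (c ^ n / (n.factorial : ℝ)) • (D ^ n) a := by
  rw [coeff_expOp, Finset.sum_eq_single (0, n)]
  · simp
  · rintro ⟨i, j⟩ h h'
    rw [PowerSeries.coeff_C, if_neg, _root_.map_zero, smul_zero]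
    rintro rfl
    exact h' (by simpa using h)
  · simp

/-- `exp (D + D') = exp D exp D'` for commuting operators, in degree `n`. -/
theorem exp_add_coeff {R : Type*} [Semiring R] [Algebra ℝ R] (x y : R) (h : Commute x y) (n : ℕ) :
    ((1 : ℝ) / n.factorial) • (x + y) ^ n =
      ∑ p ∈ Finset.HasAntidiagonal.antidiagonal n,
        (((1 : ℝ) / p.1.factorial) • x ^ p.1) * (((1 : ℝ) / p.2.factorial) • y ^ p.2) := by
  rw [h.add_pow', Finset.smul_sum]
  refine Finset.sum_congr rfl fun p hp => ?_
  obtain rfl : p.1 + p.2 = n := by simpa using hp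
  rw [smul_mul_smul_comm, ← Nat.cast_smul_eq_nsmul ℝ, smul_smul]
  congr 1
  have h1 : ((p.1 + p.2).factorial : ℝ) ≠ 0 := by positivity
  rw [Nat.cast_add_choose]
  field_simp

theorem expOp_add (c : ℝ) (D D' : Module.End ℝ V) (h : Commute D D') (x : PowerSeries V) :
    expOp c (D + D') x = expOp c D (expOp c D' x) := by
  refine HLin.ext (HLin.expOp _ _) ((HLin.expOp _ _).comp (HLin.expOp _ _)) (fun a => ?_) x
  ext n
  have key := LinearMap.congr_fun (exp_add_coeff D D' h n) a
  rw [coeff_expOp_C, coeff_expOp, div_eq_mul_one_div, mul_smul]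
  rw [LinearMap.smul_apply] at key
  rw [key, LinearMap.sum_apply, Finset.smul_sum, ← Finset.Nat.sum_antidiagonal_swap]
  refine Finset.sum_congr rfl fun p hp => ?_
  obtain rfl : p.1 + p.2 = n := by simpa using hp
  rw [coeff_expOp_C]
  simp only [Prod.fst_swap, Prod.snd_swap, Module.End.mul_apply, LinearMap.smul_apply, map_smul,
    smul_smul]
  congr 1
  rw [pow_add]
  ring

theorem expOp_smul (c d : ℝ) (D : Module.End ℝ V) (x : PowerSeries V) :
    expOp c (d • D) x = expOp (c * d) D x := by
  ext n
  simp only [coeff_expOp]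
  refine Finset.sum_congr rfl fun p _ => ?_
  rw [smul_pow, LinearMap.smul_apply, smul_smul, mul_pow]
  congr 1
  ring

theorem expOp_zero (D : Module.End ℝ V) (x : PowerSeries V) : expOp 0 D x = x := by
  refine HLin.ext (HLin.expOp _ _) HLin.id (fun a => ?_) x
  ext n
  rw [coeff_expOp_C, id, PowerSeries.coeff_C]
  cases n <;> simp

/-- Invertibility of the Taylor shift is what allows a pointwise product to be rewritten as star
products. -/
theorem expOp_neg_cancel (c : ℝ) (D : Module.End ℝ V) (x : PowerSeries V) :
    expOp c D (expOp (-c) D x) = x := by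
  have h : expOp (-c) D x = expOp c (-D) x := by
    rw [← neg_one_smul ℝ D, expOp_smul, mul_neg_one]
  -- The zero operator is rewritten as `0 • 0`, so that `expOp_smul` turns its exponential into one
  -- with parameter `0`.
  rw [h, ← expOp_add _ _ _ (Commute.neg_right (Commute.refl D)), add_neg_cancel,
    ← zero_smul ℝ (0 : Module.End ℝ V), expOp_smul, mul_zero, expOp_zero]

theorem pow_intertwine {V W : Type*} [AddCommMonoid V] [Module ℝ V] [AddCommMonoid W] [Module ℝ W]
    {D : Module.End ℝ V} {D' : Module.End ℝ W} {φ : V →ₗ[ℝ] W}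
    (h : ∀ v, φ (D v) = D' (φ v)) (n : ℕ) (v : V) : φ ((D ^ n) v) = (D' ^ n) (φ v) := by
  induction n generalizing v with
  | zero => rfl
  | succ n ih => rw [pow_succ, pow_succ, Module.End.mul_apply, Module.End.mul_apply, ih, h]

theorem mapCoeff_expOp (c : ℝ) {D : Module.End ℝ V} {D' : Module.End ℝ W} {φ : V →ₗ[ℝ] W}
    (h : ∀ v, φ (D v) = D' (φ v)) (x : PowerSeries V) :
    mapCoeff φ (expOp c D x) = expOp c D' (mapCoeff φ x) := by
  ext n
  simp [coeff_expOp, pow_intertwine h]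

/-- The Leibniz rule for powers of an operator which is a derivation on products `x * y` with `x`
in an invariant subspace. -/
theorem leibniz_coeff (D : Module.End ℝ V) (N : Submodule ℝ V) (hN : ∀ x ∈ N, D x ∈ N)
    (hD : ∀ x ∈ N, ∀ y, D (x * y) = D x * y + x * D y) (x y : V) (hx : x ∈ N) (n : ℕ) :
    ((1 : ℝ) / n.factorial) • (D ^ n) (x * y) =
      ∑ p ∈ Finset.HasAntidiagonal.antidiagonal n,
        (((1 : ℝ) / p.1.factorial) • (D ^ p.1) x) * (((1 : ℝ) / p.2.factorial) • (D ^ p.2) y) := by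
  -- Multiplication `m : N ⊗ V → V` intertwines `D` with `D ⊗ 1 + 1 ⊗ D`. The two summands `L` and
  -- `R` commute, so the claim is `exp_add_coeff` pushed forward along `m`.
  let D₀ : Module.End ℝ N := D.restrict hN
  let m : N ⊗[ℝ] V →ₗ[ℝ] V := TensorProduct.lift ((LinearMap.mul ℝ V).comp N.subtype)
  let L : Module.End ℝ (N ⊗[ℝ] V) := LinearMap.rTensor V D₀
  let R : Module.End ℝ (N ⊗[ℝ] V) := LinearMap.lTensor N D
  have hLR : Commute L R := LinearMap.ext fun z => by
    induction z using TensorProduct.induction_on with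
    | zero => simp
    | tmul a b => rfl
    | add z z' h h' => rw [map_add, h, h', map_add]
  have hm : ∀ z, m ((L + R) z) = D (m z) := fun z => by
    induction z using TensorProduct.induction_on with
    | zero => simp
    | tmul a b => exact (hD a a.2 b).symm
    | add z z' h h' => rw [map_add, map_add, h, h', map_add, map_add]
  have hLn : ∀ (k : ℕ) (a : N) (b : V), (L ^ k) (a ⊗ₜ[ℝ] b) = ((D₀ ^ k) a) ⊗ₜ[ℝ] b := fun k a b => by
    induction k generalizing a with
    | zero => rfl
    | succ k ih => rw [pow_succ, pow_succ, Module.End.mul_apply, Module.End.mul_apply, ← ih]; rfl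
  have hRn : ∀ (k : ℕ) (a : N) (b : V), (R ^ k) (a ⊗ₜ[ℝ] b) = a ⊗ₜ[ℝ] ((D ^ k) b) := fun k a b => by
    induction k generalizing b with
    | zero => rfl
    | succ k ih => rw [pow_succ, pow_succ, Module.End.mul_apply, Module.End.mul_apply, ← ih]; rfl
  have hDn : ∀ (k : ℕ) (a : N), (((D₀ ^ k) a : N) : V) = (D ^ k) a := fun k a =>
    pow_intertwine (φ := N.subtype) (fun _ => rfl) k a
  have key := congrArg (fun T : Module.End ℝ (N ⊗[ℝ] V) => m (T ((⟨x, hx⟩ : N) ⊗ₜ[ℝ] y)))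
    (exp_add_coeff L R hLR n)
  simp only [LinearMap.smul_apply, map_smul, pow_intertwine hm, LinearMap.sum_apply, map_sum,
    Module.End.mul_apply, hRn, hLn] at key
  refine Eq.trans key (Finset.sum_congr rfl fun p _ => ?_)
  rw [smul_mul_smul_comm, smul_smul, mul_comm, ← hDn p.1 ⟨x, hx⟩]
  rfl

/-- The exponential of a derivation is multiplicative. The Leibniz rule is required only for left
factors in `N`, since `∑ η_i ∂_i` satisfies it only on elements commuting with the `η_i`. -/
theorem expOp_mul (c : ℝ) (D : Module.End ℝ V) (N : Submodule ℝ V) (hN : ∀ x ∈ N, D x ∈ N)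
    (hD : ∀ x ∈ N, ∀ y, D (x * y) = D x * y + x * D y)
    (x y : PowerSeries V) (hx : ∀ n, coeff n x ∈ N) :
    expOp c D (x * y) = expOp c D x * expOp c D y := by
  refine HLin.ext_coeff ((HLin.expOp _ _).comp (HLin.mul_right y))
    ((HLin.mul_right _).comp (HLin.expOp _ _)) x fun m => ?_
  refine HLin.ext ((HLin.expOp _ _).comp (HLin.mul_left _))
    ((HLin.mul_left _).comp (HLin.expOp _ _)) (fun b => ?_) y
  ext n
  rw [← map_mul, coeff_expOp_C, PowerSeries.coeff_mul, div_eq_mul_one_div, mul_smul,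
    leibniz_coeff D N hN hD _ b (hx m), Finset.smul_sum]
  refine Finset.sum_congr rfl fun p hp => ?_
  obtain rfl : p.1 + p.2 = n := by simpa using hp
  rw [coeff_expOp_C, coeff_expOp_C, smul_mul_smul_comm, smul_mul_smul_comm, smul_smul]
  congr 1
  rw [pow_add]
  ring

end ExpOp

/-! ### Shifted arguments -/

section Values

variable {F : Type*} [NormedAddCommGroup F] [NormedSpace ℝ F] {κ : Type*}
  {A A' : Type*} [Ring A] [Algebra ℝ A] [Ring A'] [Algebra ℝ A']

theorem baseDeriv_comm (ξ ζ : LieDual F) (a : BaseFun F) :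
    baseDeriv ξ (baseDeriv ζ a) = baseDeriv ζ (baseDeriv ξ a) := by
  ext μ
  have ha : ContDiff ℝ ∞ a := a.contMDiff.contDiff
  have hd : Differentiable ℝ (fderiv ℝ a) :=
    (ContDiff.fderiv_right (m := ∞) (n := ∞) ha le_rfl).differentiable (by simp)
  have hs : IsSymmSndFDerivAt ℝ a μ :=
    ha.contDiffAt.isSymmSndFDerivAt (by rw [minSmoothness_of_isRCLikeNormedField]; norm_cast)
  have h : ∀ v w : LieDual F, fderiv ℝ (fun ν => fderiv ℝ a ν v) μ w = fderiv ℝ (fderiv ℝ a) μ w v :=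
    fun v w => by rw [fderiv_clm_apply (hd μ) (differentiableAt_const v)]; simp
  change fderiv ℝ (fun ν => fderiv ℝ a ν ζ) μ ξ = fderiv ℝ (fun ν => fderiv ℝ a ν ξ) μ ζ
  rw [h, h]
  exact hs.eq ξ ζ

theorem onSeries_eq_mapCoeff (φ : A →ₐ[ℝ] A') (x : PowerSeries (FunTensor F A)) :
    onSeries φ x = mapCoeff (onValues φ).toLinearMap x := by
  ext n; rw [coeff_mapCoeff]; rfl

theorem coeff_onSeries (φ : A →ₐ[ℝ] A') (x : PowerSeries (FunTensor F A)) (n : ℕ) :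
    coeff n (onSeries φ x) = onValues φ (coeff n x) := by
  rw [onSeries_eq_mapCoeff, coeff_mapCoeff]; rfl

theorem onSeries_C (φ : A →ₐ[ℝ] A') (z : FunTensor F A) :
    onSeries φ (PowerSeries.C z) = PowerSeries.C (onValues φ z) := by
  rw [onSeries_eq_mapCoeff, mapCoeff_C]; rfl

theorem HLin.onSeries (φ : A →ₐ[ℝ] A') : HLin (onSeries (F := F) φ) := HLin.map _

theorem onValues_tmul (φ : A →ₐ[ℝ] A') (a : BaseFun F) (w : A) :
    onValues φ (a ⊗ₜ[ℝ] w) = a ⊗ₜ[ℝ] φ w := rfl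

/-- The `A`-valued functions on `𝔥*` that commute with all constants `η i`. -/
def centralizing (F : Type*) [NormedAddCommGroup F] [NormedSpace ℝ F] (η : κ → A) :
    Subalgebra ℝ (FunTensor F A) :=
  Subalgebra.centralizer ℝ (Set.range fun i => constFun (η i))

theorem mem_centralizing {η : κ → A} {z : FunTensor F A} :
    z ∈ centralizing F η ↔ ∀ i, Commute (constFun (η i)) z := by
  rw [centralizing, Subalgebra.mem_centralizer_iff]
  simp [Commute, SemiconjBy]

theorem baseDeriv_mul (ξ : LieDual F) (f g : BaseFun F) :
    baseDeriv ξ (f * g) = baseDeriv ξ f * g + f * baseDeriv ξ g := by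
  ext μ
  have hf : Differentiable ℝ f := f.contMDiff.contDiff.differentiable (by simp)
  have hg : Differentiable ℝ g := g.contMDiff.contDiff.differentiable (by simp)
  have h := congrArg (fun L : LieDual F →L[ℝ] ℝ => L ξ) (fderiv_fun_mul (hf μ) (hg μ))
  change fderiv ℝ (fun y => f y * g y) μ ξ = fderiv ℝ f μ ξ * g μ + f μ * fderiv ℝ g μ ξ
  rw [h]
  simp
  ring

theorem baseDeriv_one (ξ : LieDual F) : baseDeriv ξ (1 : BaseFun F) = 0 := by
  have h := baseDeriv_mul ξ (1 : BaseFun F) 1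
  rw [mul_one, one_mul, mul_one] at h
  simpa using h

theorem valDeriv_tmul (ξ : LieDual F) (a : BaseFun F) (v : A) :
    valDeriv A ξ (a ⊗ₜ[ℝ] v) = baseDeriv ξ a ⊗ₜ[ℝ] v := rfl

theorem valDeriv_mul (ξ : LieDual F) (x y : FunTensor F A) :
    valDeriv A ξ (x * y) = valDeriv A ξ x * y + x * valDeriv A ξ y := by
  induction x using TensorProduct.induction_on with
  | zero => simp
  | add x x' hx hx' => rw [add_mul, map_add, hx, hx', map_add, add_mul, add_mul]; abel
  | tmul a v =>
    induction y using TensorProduct.induction_on with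
    | zero => simp
    | add y y' hy hy' => rw [mul_add, map_add, hy, hy', map_add, mul_add, mul_add]; abel
    | tmul a' v' =>
      rw [Algebra.TensorProduct.tmul_mul_tmul, valDeriv_tmul, valDeriv_tmul, valDeriv_tmul,
        Algebra.TensorProduct.tmul_mul_tmul, Algebra.TensorProduct.tmul_mul_tmul, baseDeriv_mul,
        TensorProduct.add_tmul]

theorem valDeriv_constFun (ξ : LieDual F) (v : A) :
    valDeriv A ξ (constFun (F := F) v) = 0 := by
  change baseDeriv ξ 1 ⊗ₜ[ℝ] v = 0
  rw [baseDeriv_one, TensorProduct.zero_tmul]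

/-- The `η i` are constant in `λ`, so differentiating the commutation relation gives the same
relation for the derivative. -/
theorem valDeriv_mem_centralizing {η : κ → A} (ξ : LieDual F) {z : FunTensor F A}
    (hz : z ∈ centralizing F η) : valDeriv A ξ z ∈ centralizing F η := by
  rw [mem_centralizing] at hz ⊢
  intro i
  have h := congrArg (valDeriv A ξ) (hz i).eq
  rw [valDeriv_mul, valDeriv_mul, valDeriv_constFun, zero_mul, mul_zero, zero_add, add_zero] at h
  exact h

theorem constFun_mem_centralizing {η : κ → A} {v : A} (hv : ∀ i, Commute (η i) v) :
    constFun (F := F) v ∈ centralizing F η :=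
  mem_centralizing.2 fun i => (hv i).map constFun

theorem mul_coeff_mem_centralizing {η : κ → A} {x y : PowerSeries (FunTensor F A)}
    (hx : ∀ n, coeff n x ∈ centralizing F η) (hy : ∀ n, coeff n y ∈ centralizing F η) (n : ℕ) :
    coeff n (x * y) ∈ centralizing F η := by
  rw [PowerSeries.coeff_mul]
  exact Subalgebra.sum_mem _ fun p _ => Subalgebra.mul_mem _ (hx _) (hy _)

theorem onValues_mem_centralizing {η : κ → A} (φ : A →ₐ[ℝ] A') {z : FunTensor F A}
    (hz : z ∈ centralizing F η) : onValues φ z ∈ centralizing F fun i => φ (η i) := by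
  rw [mem_centralizing] at hz ⊢
  exact fun i => (hz i).map (onValues φ)

end Values

/-! ### Taylor shifts: composition, naturality and multiplicativity. -/

section Shift

variable {F : Type*} [NormedAddCommGroup F] [NormedSpace ℝ F] [FiniteDimensional ℝ F]
  {κ : Type*} [Fintype κ] (b : Module.Basis κ ℝ F)
  {A A' : Type*} [Ring A] [Algebra ℝ A] [Ring A'] [Algebra ℝ A']

theorem shift_eq_expOp (c : ℝ) (η : κ → A) : shift (F := F) b c η = expOp c (shiftOp b η) := rfl

theorem HLin.shift (c : ℝ) (η : κ → A) : HLin (shift (F := F) b c η) := HLin.expOp _ _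

theorem shiftOp_tmul (η : κ → A) (a : BaseFun F) (w : A) :
    shiftOp b η (a ⊗ₜ[ℝ] w) = ∑ i, baseDeriv (dualVec b i) a ⊗ₜ[ℝ] (η i * w) := by
  rw [shiftOp, LinearMap.sum_apply]
  refine Finset.sum_congr rfl fun i _ => ?_
  change (1 ⊗ₜ[ℝ] η i) * (baseDeriv (dualVec b i) a ⊗ₜ[ℝ] w) = _
  rw [Algebra.TensorProduct.tmul_mul_tmul, one_mul]

theorem shiftOp_add (η η' : κ → A) :
    shiftOp (F := F) b (fun i => η i + η' i) = shiftOp b η + shiftOp b η' := by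
  refine TensorProduct.ext' fun a w => ?_
  rw [LinearMap.add_apply, shiftOp_tmul, shiftOp_tmul, shiftOp_tmul, ← Finset.sum_add_distrib]
  exact Finset.sum_congr rfl fun i _ => by rw [add_mul, TensorProduct.tmul_add]

theorem shiftOp_commute (η η' : κ → A) (h : ∀ i j, Commute (η i) (η' j)) :
    Commute (shiftOp (F := F) b η) (shiftOp b η') := by
  refine TensorProduct.ext' fun a w => ?_
  simp only [Module.End.mul_apply, shiftOp_tmul, map_sum]
  rw [Finset.sum_comm]
  refine Finset.sum_congr rfl fun i _ => Finset.sum_congr rfl fun j _ => ?_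
  rw [baseDeriv_comm, ← mul_assoc, ← mul_assoc, (h _ _).eq]

/-- Used to split the shift along a coproduct `Δ(h_i)` into shifts along its separate tensor slots.
-/
theorem shift_add (c : ℝ) (η η' : κ → A) (h : ∀ i j, Commute (η i) (η' j))
    (x : PowerSeries (FunTensor F A)) :
    shift b c (fun i => η i + η' i) x = shift b c η (shift b c η' x) := by
  rw [shift_eq_expOp, shiftOp_add, expOp_add _ _ _ (shiftOp_commute b η η' h)]
  rfl

theorem shift_neg_cancel (c : ℝ) (η : κ → A) (x : PowerSeries (FunTensor F A)) :
    shift b c η (shift b (-c) η x) = x := expOp_neg_cancel c _ x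

theorem onSeries_shift (φ : A →ₐ[ℝ] A') (c : ℝ) (η : κ → A) (x : PowerSeries (FunTensor F A)) :
    onSeries φ (shift b c η x) = shift b c (fun i => φ (η i)) (onSeries φ x) := by
  rw [onSeries_eq_mapCoeff, onSeries_eq_mapCoeff]
  refine mapCoeff_expOp c (fun v => ?_) x
  refine LinearMap.congr_fun (f := (onValues φ).toLinearMap ∘ₗ shiftOp b η)
    (g := shiftOp b (fun i => φ (η i)) ∘ₗ (onValues φ).toLinearMap)
    (TensorProduct.ext' fun a w => ?_) v
  simp only [LinearMap.comp_apply, AlgHom.toLinearMap_apply, onValues_tmul, shiftOp_tmul, map_sum,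
    map_mul]

theorem shiftOp_apply (η : κ → A) (z : FunTensor F A) :
    shiftOp b η z = ∑ i, constFun (η i) * valDeriv A (dualVec b i) z := by
  rw [shiftOp, LinearMap.sum_apply]
  rfl

theorem shiftOp_mem_centralizing {ζ : κ → A} {η : κ → A} (h : ∀ i j, Commute (ζ i) (η j))
    {z : FunTensor F A} (hz : z ∈ centralizing F ζ) : shiftOp b η z ∈ centralizing F ζ := by
  rw [shiftOp_apply]
  exact Subalgebra.sum_mem _ fun i _ => Subalgebra.mul_mem _
    (constFun_mem_centralizing fun j => h j i) (valDeriv_mem_centralizing _ hz)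

theorem shift_mem_centralizing {ζ : κ → A} {η : κ → A} (h : ∀ i j, Commute (ζ i) (η j)) (c : ℝ)
    {x : PowerSeries (FunTensor F A)} (hx : ∀ n, coeff n x ∈ centralizing F ζ) (n : ℕ) :
    coeff n (shift b c η x) ∈ centralizing F ζ := by
  rw [shift_eq_expOp, coeff_expOp]
  refine Subalgebra.sum_mem _ fun p _ => Subalgebra.smul_mem _ ?_ _
  generalize p.2 = k
  induction k with
  | zero => exact hx _
  | succ k ih =>
    rw [pow_succ', Module.End.mul_apply]
    exact shiftOp_mem_centralizing b h ih

/-- The shift inserts the `η_i` on the left, so in the term where the derivative falls on `y` they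
have to be moved past `x`; this is why `x` must commute with them. -/
theorem shift_mul (c : ℝ) {η : κ → A} (h : ∀ i j, Commute (η i) (η j))
    (x y : PowerSeries (FunTensor F A)) (hx : ∀ n, coeff n x ∈ centralizing F η) :
    shift b c η (x * y) = shift b c η x * shift b c η y := by
  refine expOp_mul c _ (Subalgebra.toSubmodule (centralizing F η))
    (fun z hz => shiftOp_mem_centralizing b h hz) (fun z hz y => ?_) x y hx
  rw [shiftOp_apply, shiftOp_apply, shiftOp_apply, Finset.sum_mul, Finset.mul_sum,
    ← Finset.sum_add_distrib]
  refine Finset.sum_congr rfl fun i _ => ?_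
  rw [valDeriv_mul, mul_add, ← mul_assoc, ← mul_assoc, ← mul_assoc,
    (mem_centralizing.1 hz i).eq]

theorem shift_C_constFun (c : ℝ) (η : κ → A) (v : A) :
    shift b c η (PowerSeries.C (constFun v)) = PowerSeries.C (constFun v) := by
  ext n
  rw [shift_eq_expOp, coeff_expOp_C, PowerSeries.coeff_C]
  cases n with
  | zero => simp
  | succ n =>
    have h : shiftOp b η (constFun (F := F) v) = 0 := by
      rw [shiftOp_apply]
      simp [valDeriv_constFun]
    rw [pow_succ (shiftOp b η), Module.End.mul_apply, h, _root_.map_zero, smul_zero, if_neg (by simp)]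

end Shift

/-! ### The action of `U𝔤` on `C^∞(G)` -/

section GroupAction

variable {F : Type*} [NormedAddCommGroup F] [NormedSpace ℝ F]
  {E : Type*} [NormedAddCommGroup E] [NormedSpace ℝ E] [CompleteSpace E]
  {G : Type*} [TopologicalSpace G] [ChartedSpace E G] [Group G] [LieGroup 𝓘(ℝ, E) ∞ G]

attribute [local instance] LieRing.ofAssociativeRing LieAlgebra.ofAssociativeAlgebra

theorem toU_lie (X Y : LieAlg E G) : toU ⁅X, Y⁆ = toU X * toU Y - toU Y * toU X :=
  LieHom.map_lie (UniversalEnvelopingAlgebra.ι ℝ : LieAlg E G →ₗ⁅ℝ⁆ UEnv E G) X Y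

/-- The map from `𝔤` into the generated subalgebra `N` lifts to `U𝔤 → N`. Followed by the inclusion
it is the identity, by uniqueness in the universal property, so every element lies in `N`. -/
theorem adjoin_range_toU :
    Algebra.adjoin ℝ (Set.range (toU : LieAlg E G →ₗ[ℝ] UEnv E G)) = ⊤ := by
  set N := Algebra.adjoin ℝ (Set.range (toU : LieAlg E G →ₗ[ℝ] UEnv E G)) with hN
  have hmem : ∀ X : LieAlg E G, toU X ∈ N := fun X => Algebra.subset_adjoin ⟨X, rfl⟩
  let j : LieAlg E G →ₗ⁅ℝ⁆ N :=
    { toFun := fun X => ⟨toU X, hmem X⟩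
      map_add' := fun X Y => Subtype.ext (map_add toU X Y)
      map_smul' := fun c X => Subtype.ext (map_smul toU c X)
      map_lie' := fun {X Y} => Subtype.ext (toU_lie X Y) }
  have h : N.val.comp (UniversalEnvelopingAlgebra.lift ℝ j) = AlgHom.id ℝ (UEnv E G) := by
    refine UniversalEnvelopingAlgebra.hom_ext ℝ (LieHom.ext fun X => ?_)
    exact congrArg N.val (UniversalEnvelopingAlgebra.lift_ι_apply ℝ j X)
  refine eq_top_iff.2 fun u _ => ?_
  have hu := AlgHom.congr_fun h u
  have hu' : ((UniversalEnvelopingAlgebra.lift ℝ j u : N) : UEnv E G) = u := hu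
  rw [← hu']
  exact (UniversalEnvelopingAlgebra.lift ℝ j u).2

theorem uEnv_induction {p : UEnv E G → Prop} (one : p 1) (smul : ∀ (c : ℝ) u, p u → p (c • u))
    (add : ∀ u v, p u → p v → p (u + v)) (mul : ∀ X u, p u → p (toU X * u)) (u : UEnv E G) :
    p u := by
  -- Strengthened to left multiplication by `u` preserving `p`, a property that is stable under
  -- products of such `u`.
  have h : ∀ v, p v → p (u * v) := by
    have hu : u ∈ Algebra.adjoin ℝ (Set.range (toU : LieAlg E G →ₗ[ℝ] UEnv E G)) := by
      rw [adjoin_range_toU]; trivial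
    induction hu using Algebra.adjoin_induction with
    | mem x hx =>
      obtain ⟨X, rfl⟩ := hx
      exact mul X
    | algebraMap c => exact fun v hv => by rw [← Algebra.smul_def]; exact smul c v hv
    | add x y _ _ hx hy => exact fun v hv => by rw [add_mul]; exact add _ _ (hx v hv) (hy v hv)
    | mul x y _ _ hx hy => exact fun v hv => by rw [mul_assoc]; exact hx _ (hy v hv)
  simpa using h 1 one

theorem leftAction_toU (X : LieAlg E G) :
    leftAction (F := F) (toU X) = leftDeriv X :=
  UniversalEnvelopingAlgebra.lift_ι_apply ℝ leftDerivHom X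

theorem comul_toU (X : LieAlg E G) : comul (toU X) = toU X ⊗ₜ[ℝ] 1 + 1 ⊗ₜ[ℝ] toU X :=
  UniversalEnvelopingAlgebra.lift_ι_apply ℝ primitiveHom X

theorem counit_toU (X : LieAlg E G) : counit (toU X) = 0 :=
  UniversalEnvelopingAlgebra.lift_ι_apply ℝ (0 : LieAlg E G →ₗ⁅ℝ⁆ ℝ) X

/-- The restriction of a function on `M` to `{μ} × G`. -/
def restr (μ : LieDual F) : TotalFun F E G →ₐ[ℝ] GroupFun E G :=
  pullback ⟨fun x => (μ, x), contMDiff_const.prodMk contMDiff_id⟩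

theorem ext_restr {f g : TotalFun F E G} (h : ∀ μ, restr μ f = restr μ g) : f = g :=
  ContMDiffMap.ext fun p => DFunLike.congr_fun (h p.1) p.2

/-- The left-invariant vector field on `G` generated by `X ∈ 𝔤`. -/
def gDeriv (X : LieAlg E G) : Module.End ℝ (GroupFun E G) :=
  (restr (0 : LieDual ℝ)).toLinearMap ∘ₗ leftDeriv X ∘ₗ groupIncl.toLinearMap

/-- The field of `X` does not involve the parameter, so the auxiliary base point used to define
`gDeriv` is immaterial and the identity is definitional. -/
theorem restr_leftDeriv (X : LieAlg E G) (μ : LieDual F) (f : TotalFun F E G) :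
    restr μ (leftDeriv X f) = gDeriv X (restr μ f) := rfl

/-- `X ↦ X⃗` on `C^∞(G)`, as a morphism of Lie algebras. -/
def gDerivHom : LieAlg E G →ₗ⁅ℝ⁆ Module.End ℝ (GroupFun E G) where
  toFun := gDeriv
  map_add' X Y := LinearMap.ext fun f =>
    congrArg (fun T : Module.End ℝ (TotalFun ℝ E G) => restr 0 (T (groupIncl f)))
      (map_add leftDerivHom X Y)
  map_smul' c X := LinearMap.ext fun f =>
    congrArg (fun T : Module.End ℝ (TotalFun ℝ E G) => restr 0 (T (groupIncl f)))
      (map_smul leftDerivHom c X)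
  map_lie' {X Y} := LinearMap.ext fun f =>
    congrArg (fun T : Module.End ℝ (TotalFun ℝ E G) => restr 0 (T (groupIncl f)))
      (LieHom.map_lie leftDerivHom X Y)

/-- The action of `U𝔤` on `C^∞(G)` by left-invariant differential operators. -/
def gAct : UEnv E G →ₐ[ℝ] Module.End ℝ (GroupFun E G) :=
  UniversalEnvelopingAlgebra.lift ℝ gDerivHom

theorem gAct_toU (X : LieAlg E G) : gAct (toU X) = gDeriv X :=
  UniversalEnvelopingAlgebra.lift_ι_apply ℝ gDerivHom X

theorem gAct_toU_mul (X : LieAlg E G) (u : UEnv E G) (f : GroupFun E G) :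
    gAct (toU X * u) f = gDeriv X (gAct u f) := by
  rw [map_mul, gAct_toU, Module.End.mul_apply]

theorem restr_leftAction (u : UEnv E G) (μ : LieDual F) (f : TotalFun F E G) :
    restr μ (leftAction u f) = gAct u (restr μ f) := by
  induction u using uEnv_induction with
  | one => rw [map_one, map_one]; rfl
  | smul c u h => rw [map_smul, map_smul, LinearMap.smul_apply, LinearMap.smul_apply, map_smul, h]
  | add u v hu hv =>
    rw [map_add, map_add, LinearMap.add_apply, LinearMap.add_apply, map_add, hu, hv]
  | mul X u h =>
    rw [map_mul, leftAction_toU, Module.End.mul_apply, restr_leftDeriv, h, gAct_toU_mul]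

theorem restr_groupIncl (μ : LieDual F) (f : GroupFun E G) : restr μ (groupIncl f) = f := rfl

theorem restr_baseIncl (μ : LieDual F) (a : BaseFun F) :
    restr (E := E) (G := G) μ (baseIncl a) = algebraMap ℝ _ (a μ) := rfl

theorem restr_baseIncl_mul (μ : LieDual F) (a : BaseFun F) (f : TotalFun F E G) :
    restr μ (baseIncl a * f) = a μ • restr μ f := by
  rw [map_mul, restr_baseIncl, ← Algebra.smul_def]

theorem leftAction_groupIncl (u : UEnv E G) (f : GroupFun E G) :
    leftAction (F := F) u (groupIncl f) = groupIncl (gAct u f) :=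
  ext_restr fun μ => by rw [restr_leftAction, restr_groupIncl, restr_groupIncl]

theorem gDeriv_mul (X : LieAlg E G) (f g : GroupFun E G) :
    gDeriv X (f * g) = gDeriv X f * g + f * gDeriv X g := by
  ext x
  have h := congrArg (fun L : E →L[ℝ] ℝ => L (mulInvariantVectorField X x))
    (mvfderiv_mul (f.contMDiff.mdifferentiable (by simp) x)
      (g.contMDiff.mdifferentiable (by simp) x))
  refine h.trans ?_
  change f x * gDeriv X g x + g x * gDeriv X f x = gDeriv X f x * g x + f x * gDeriv X g x
  ring

theorem gDeriv_one (X : LieAlg E G) : gDeriv X (1 : GroupFun E G) = 0 := by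
  have h := gDeriv_mul X (1 : GroupFun E G) 1
  rw [mul_one, one_mul, mul_one] at h
  simpa using h

theorem gAct_one (u : UEnv E G) : gAct u (1 : GroupFun E G) = counit u • (1 : GroupFun E G) := by
  induction u using uEnv_induction with
  | one => rw [map_one counit, one_smul, map_one gAct]; rfl
  | smul c u h => rw [map_smul, map_smul, LinearMap.smul_apply, h, smul_assoc]
  | add u v hu hv => rw [map_add, map_add, LinearMap.add_apply, hu, hv, add_smul]
  | mul X u h =>
    rw [gAct_toU_mul, h, map_smul, gDeriv_one, map_mul, counit_toU, zero_mul, zero_smul, smul_zero]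

/-- Functions of `λ` are constant along `G`. This is why the normalization `ε(T) = 1` makes `T⃗` fix
`C^∞(𝔥*)`. -/
theorem leftAction_baseIncl (u : UEnv E G) (a : BaseFun F) :
    leftAction u (baseIncl a : TotalFun F E G) = counit u • baseIncl a :=
  ext_restr fun μ => by
    rw [restr_leftAction, restr_baseIncl, map_smul, restr_baseIncl, Algebra.algebraMap_eq_smul_one,
      map_smul, gAct_one, smul_comm]

/-! ### Multilinear evaluations -/

section TensorEval

variable {A B Q : Type*} [Ring A] [Algebra ℝ A] [Ring B] [Algebra ℝ B] [CommRing Q] [Algebra ℝ Q]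

/-- The product of the values of two linear maps, as a linear map on the tensor product. -/
def evTensor (φ : A →ₗ[ℝ] Q) (ψ : B →ₗ[ℝ] Q) : A ⊗[ℝ] B →ₗ[ℝ] Q :=
  LinearMap.mul' ℝ Q ∘ₗ TensorProduct.map φ ψ

end TensorEval

/-- `u ↦ u⃗ f`. -/
def ev₁ (f : GroupFun E G) : UEnv E G →ₗ[ℝ] GroupFun E G :=
  (LinearMap.applyₗ f) ∘ₗ gAct.toLinearMap

theorem ev₁_apply (f : GroupFun E G) (u : UEnv E G) : ev₁ f u = gAct u f := rfl

/-- `u ⊗ v ↦ u⃗ f · v⃗ g`. -/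
def ev₂ (f g : GroupFun E G) : UEnv E G ⊗[ℝ] UEnv E G →ₗ[ℝ] GroupFun E G :=
  evTensor (ev₁ f) (ev₁ g)

theorem ev₂_tmul (f g : GroupFun E G) (u v : UEnv E G) :
    ev₂ f g (u ⊗ₜ[ℝ] v) = gAct u f * gAct v g := rfl

/-- `u ⊗ v ⊗ w ↦ u⃗ f · v⃗ g · w⃗ k`. -/
def ev₃ (f g k : GroupFun E G) : UEnv E G ⊗[ℝ] (UEnv E G ⊗[ℝ] UEnv E G) →ₗ[ℝ] GroupFun E G :=
  evTensor (ev₁ f) (ev₂ g k)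

theorem ev₃_tmul (f g k : GroupFun E G) (u : UEnv E G) (w : UEnv E G ⊗[ℝ] UEnv E G) :
    ev₃ f g k (u ⊗ₜ[ℝ] w) = gAct u f * ev₂ g k w := rfl

theorem ev₁_toU_mul (X : LieAlg E G) (f : GroupFun E G) (u : UEnv E G) :
    ev₁ f (toU X * u) = gDeriv X (ev₁ f u) := gAct_toU_mul X u f

/-- The Leibniz rule for `X⃗`, expressed as left multiplication by `Δ(X)`. -/
theorem ev₂_primitive_mul (X : LieAlg E G) (f g : GroupFun E G) (w : UEnv E G ⊗[ℝ] UEnv E G) :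
    ev₂ f g ((toU X ⊗ₜ[ℝ] 1 + 1 ⊗ₜ[ℝ] toU X) * w) = gDeriv X (ev₂ f g w) := by
  induction w using TensorProduct.induction_on with
  | zero => simp
  | add w w' h h' => rw [mul_add, map_add, map_add, map_add, h, h']
  | tmul u v =>
    rw [add_mul, Algebra.TensorProduct.tmul_mul_tmul, Algebra.TensorProduct.tmul_mul_tmul, map_add,
      ev₂_tmul, ev₂_tmul, ev₂_tmul, one_mul, one_mul, gDeriv_mul, gAct_toU_mul, gAct_toU_mul]

theorem ev₃_primitive_mul (X : LieAlg E G) (f g k : GroupFun E G)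
    (w : UEnv E G ⊗[ℝ] (UEnv E G ⊗[ℝ] UEnv E G)) :
    ev₃ f g k ((slot1 (toU X) + slot2 (toU X) + slot3 (toU X)) * w) =
      gDeriv X (ev₃ f g k w) := by
  induction w using TensorProduct.induction_on with
  | zero => simp
  | add w w' h h' => rw [mul_add, map_add, map_add, map_add, h, h']
  | tmul u w =>
    have e : slot1 (toU X) + slot2 (toU X) + slot3 (toU X) = toU X ⊗ₜ[ℝ] 1 +
        (1 : UEnv E G) ⊗ₜ[ℝ] (toU X ⊗ₜ[ℝ] 1 + 1 ⊗ₜ[ℝ] toU X) := by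
      rw [TensorProduct.tmul_add, add_assoc]; rfl
    rw [e, add_mul, Algebra.TensorProduct.tmul_mul_tmul, Algebra.TensorProduct.tmul_mul_tmul,
      map_add, ev₃_tmul, ev₃_tmul, ev₃_tmul, one_mul, one_mul, gDeriv_mul, gAct_toU_mul,
      ev₂_primitive_mul]

/-- An operator acts on a product through its coproduct. This is the origin of the factor `ΔT⁻¹` in
the gauge formula. -/
theorem gAct_ev₂ (f g : GroupFun E G) (u : UEnv E G) (w : UEnv E G ⊗[ℝ] UEnv E G) :
    gAct u (ev₂ f g w) = ev₂ f g (comul u * w) := by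
  induction u using uEnv_induction with
  | one => rw [map_one, map_one, one_mul]; rfl
  | smul c u h => rw [map_smul, map_smul, LinearMap.smul_apply, h, smul_mul_assoc, map_smul]
  | add u v hu hv => rw [map_add, map_add, LinearMap.add_apply, hu, hv, add_mul, map_add]
  | mul X u h => rw [gAct_toU_mul, h, map_mul comul, comul_toU, mul_assoc, ev₂_primitive_mul]

/-- Operators applied to the arguments act first, hence multiply the symbol on the right; operators
applied to the result multiply it on the left. -/
theorem ev₂_gAct_left (f g : GroupFun E G) (u : UEnv E G) (w : UEnv E G ⊗[ℝ] UEnv E G) :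
    ev₂ (gAct u f) g w = ev₂ f g (w * (u ⊗ₜ[ℝ] 1)) := by
  induction w using TensorProduct.induction_on with
  | zero => simp
  | add w w' h h' => rw [map_add, h, h', add_mul, map_add]
  | tmul v v' =>
    rw [Algebra.TensorProduct.tmul_mul_tmul, ev₂_tmul, ev₂_tmul, map_mul, mul_one]; rfl

theorem ev₂_gAct_right (f g : GroupFun E G) (u : UEnv E G) (w : UEnv E G ⊗[ℝ] UEnv E G) :
    ev₂ f (gAct u g) w = ev₂ f g (w * (1 ⊗ₜ[ℝ] u)) := by
  induction w using TensorProduct.induction_on with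
  | zero => simp
  | add w w' h h' => rw [map_add, h, h', add_mul, map_add]
  | tmul v v' =>
    rw [Algebra.TensorProduct.tmul_mul_tmul, ev₂_tmul, ev₂_tmul, map_mul gAct v', mul_one]; rfl

/-- Nesting bidifferential operators in the first argument: the outer symbol is spread by `Δ ⊗ id`,
the inner one fills slots 1 and 2. This gives the left side of the cocycle condition before any
shift. -/
theorem ev₂_ev₂_left (f g k : GroupFun E G) (w z : UEnv E G ⊗[ℝ] UEnv E G) :
    ev₂ (ev₂ f g w) k z = ev₃ f g k (comulLeft z * emb12 w) := by
  induction z using TensorProduct.induction_on with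
  | zero => simp
  | add z z' h h' => rw [map_add, h, h', map_add, add_mul, map_add]
  | tmul u v =>
    rw [ev₂_tmul, gAct_ev₂]
    change _ = ev₃ f g k (Algebra.TensorProduct.assoc ℝ ℝ ℝ _ _ _ (comul u ⊗ₜ[ℝ] v) * _)
    generalize comul u = x
    induction x using TensorProduct.induction_on with
    | zero => simp
    | add x x' h h' =>
      rw [TensorProduct.add_tmul, map_add, add_mul, add_mul, map_add, map_add, add_mul, h, h']
    | tmul x x' =>
      induction w using TensorProduct.induction_on with
      | zero => simp
      | add w w' h h' => rw [mul_add, map_add, add_mul, h, h', map_add, mul_add, map_add]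
      | tmul y y' =>
        change _ = ev₃ f g k ((x ⊗ₜ[ℝ] (x' ⊗ₜ[ℝ] v)) * (y ⊗ₜ[ℝ] (y' ⊗ₜ[ℝ] 1)))
        rw [Algebra.TensorProduct.tmul_mul_tmul, Algebra.TensorProduct.tmul_mul_tmul,
          Algebra.TensorProduct.tmul_mul_tmul, ev₃_tmul, ev₂_tmul, ev₂_tmul, mul_one, mul_assoc]

theorem ev₂_ev₂_right (f g k : GroupFun E G) (w z : UEnv E G ⊗[ℝ] UEnv E G) :
    ev₂ f (ev₂ g k w) z = ev₃ f g k (comulRight z * emb23 w) := by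
  induction z using TensorProduct.induction_on with
  | zero => simp
  | add z z' h h' => rw [map_add, h, h', map_add, add_mul, map_add]
  | tmul u v =>
    rw [ev₂_tmul, gAct_ev₂]
    change _ = ev₃ f g k ((u ⊗ₜ[ℝ] comul v) * (1 ⊗ₜ[ℝ] w))
    rw [Algebra.TensorProduct.tmul_mul_tmul, ev₃_tmul, mul_one]

theorem ev₂_one_left (g : GroupFun E G) (w : UEnv E G ⊗[ℝ] UEnv E G) :
    ev₂ 1 g w = ev₁ g (counitLeft w) := by
  induction w using TensorProduct.induction_on with
  | zero => simp
  | add z z' h h' => rw [map_add, h, h', map_add, map_add]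
  | tmul u v =>
    change _ = ev₁ g (counit u • v)
    rw [ev₂_tmul, gAct_one, map_smul, smul_mul_assoc, one_mul]; rfl

theorem ev₂_one_right (g : GroupFun E G) (w : UEnv E G ⊗[ℝ] UEnv E G) :
    ev₂ g 1 w = ev₁ g (counitRight w) := by
  induction w using TensorProduct.induction_on with
  | zero => simp
  | add z z' h h' => rw [map_add, h, h', map_add, map_add]
  | tmul u v =>
    change _ = ev₁ g (counit v • u)
    rw [ev₂_tmul, gAct_one, map_smul, mul_smul_comm, mul_one]; rfl

theorem ev₂_swap (f g : GroupFun E G) (w : UEnv E G ⊗[ℝ] UEnv E G) :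
    ev₂ f g (swap w) = ev₂ g f w := by
  induction w using TensorProduct.induction_on with
  | zero => simp
  | add z z' h h' => rw [map_add, map_add, h, h', map_add]
  | tmul u v =>
    change ev₂ f g (v ⊗ₜ[ℝ] u) = _
    rw [ev₂_tmul, ev₂_tmul, mul_comm]

end GroupAction

/-! ### Values of functions on `𝔥*` -/

section EvalAt

variable {F : Type*} [NormedAddCommGroup F] [NormedSpace ℝ F]
  {A A' : Type*} [Ring A] [Algebra ℝ A] [Ring A'] [Algebra ℝ A']

/-- The value at `μ` of an `A`-valued function. -/
def evalAt (μ : LieDual F) : FunTensor F A →ₐ[ℝ] A :=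
  (Algebra.TensorProduct.lid ℝ A).toAlgHom.comp
    (Algebra.TensorProduct.map
      { toFun := fun f : BaseFun F => f μ
        map_one' := rfl
        map_mul' := fun _ _ => rfl
        map_zero' := rfl
        map_add' := fun _ _ => rfl
        commutes' := fun _ => rfl } (AlgHom.id ℝ A))

theorem evalAt_tmul (μ : LieDual F) (a : BaseFun F) (w : A) : evalAt μ (a ⊗ₜ[ℝ] w) = a μ • w := rfl

theorem evalAt_constFun (μ : LieDual F) (w : A) : evalAt μ (constFun w) = w := one_smul ℝ w

theorem evalAt_onValues (μ : LieDual F) (φ : A →ₐ[ℝ] A') (z : FunTensor F A) :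
    evalAt μ (onValues φ z) = φ (evalAt μ z) := by
  induction z using TensorProduct.induction_on with
  | zero => simp
  | add z z' h h' => rw [map_add, map_add, h, h', map_add, map_add]
  | tmul a w => rw [onValues_tmul, evalAt_tmul, evalAt_tmul, map_smul]

/-- In a basis of `A` over `ℝ` the coordinates of `z` are smooth functions on `𝔥*`, and these are
determined by their values. -/
theorem ext_evalAt {z z' : FunTensor F A} (h : ∀ μ, evalAt μ z = evalAt μ z') : z = z' := by
  let v := Module.Basis.ofVectorSpace ℝ A
  let w : Module.Basis _ (BaseFun F) (FunTensor F A) := Algebra.TensorProduct.basis (BaseFun F) v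
  have key : ∀ (z : FunTensor F A) i μ, w.repr z i μ = v.repr (evalAt μ z) i := by
    intro z i μ
    induction z using TensorProduct.induction_on with
    | zero => simp
    | add z z' h h' =>
      rw [map_add, map_add, map_add, Finsupp.add_apply, Finsupp.add_apply, ← h, ← h']; rfl
    | tmul a x =>
      rw [Algebra.TensorProduct.basis_repr_tmul, evalAt_tmul, map_smul]
      rfl
  refine w.repr.injective (Finsupp.ext fun i => ContMDiffMap.ext fun μ => ?_)
  rw [key, key, h]

end EvalAt

/-! ### Separation of points by families of functionals -/

section Separation

variable {A B : Type*} [Ring A] [Algebra ℝ A] [Ring B] [Algebra ℝ B]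

/-- Contracting the second factor with `ψ j` gives an element of `A` killed by all `φ i`, hence
zero. Its coordinates in a basis of `A` are the values of `ψ j` on the `B`-valued coordinates of
`z`, so these vanish as well. -/
theorem eq_zero_of_evTensor {I J : Type*} (φ : I → A →ₗ[ℝ] ℝ) (ψ : J → B →ₗ[ℝ] ℝ)
    (hφ : ∀ a, (∀ i, φ i a = 0) → a = 0) (hψ : ∀ b, (∀ j, ψ j b = 0) → b = 0)
    (z : A ⊗[ℝ] B) (hz : ∀ i j, evTensor (φ i) (ψ j) z = 0) : z = 0 := by
  classical
  let v := Module.Basis.ofVectorSpace ℝ A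
  let e := TensorProduct.equivFinsuppOfBasisLeft (N := B) v
  let contract : J → A ⊗[ℝ] B →ₗ[ℝ] A := fun j =>
    (TensorProduct.rid ℝ A).toLinearMap ∘ₗ LinearMap.lTensor A (ψ j)
  have h1 : ∀ i j z, φ i (contract j z) = evTensor (φ i) (ψ j) z := by
    intro i j z
    induction z using TensorProduct.induction_on with
    | zero => simp
    | add z z' h h' => rw [map_add, map_add, h, h', map_add]
    | tmul a b =>
      change φ i (ψ j b • a) = φ i a * ψ j b
      rw [map_smul, smul_eq_mul, mul_comm]
  have h2 : ∀ j k z, v.repr (contract j z) k = ψ j (e z k) := by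
    intro j k z
    induction z using TensorProduct.induction_on with
    | zero => simp
    | add z z' h h' =>
      rw [map_add, map_add, Finsupp.add_apply, h, h', map_add, Finsupp.add_apply, map_add]
    | tmul a b =>
      rw [TensorProduct.equivFinsuppOfBasisLeft_apply_tmul_apply, map_smul]
      change v.repr (ψ j b • a) k = _
      rw [map_smul, Finsupp.smul_apply, smul_eq_mul, smul_eq_mul, mul_comm]
  refine e.injective (Finsupp.ext fun k => ?_)
  rw [map_zero, Finsupp.zero_apply]
  refine hψ _ fun j => ?_
  rw [← h2, hφ _ fun i => (h1 i j z).trans (hz i j), map_zero, Finsupp.zero_apply]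

end Separation

/-! ### Faithfulness of the action of `U𝔤` on `C^∞(G)` -/

section TestFunctions

variable {E : Type*} [NormedAddCommGroup E] [NormedSpace ℝ E] [CompleteSpace E]
  {G : Type*} [TopologicalSpace G] [ChartedSpace E G] [Group G] [LieGroup 𝓘(ℝ, E) ∞ G]

/-- `X⃗` as a derivation of `C^∞(G)`. -/
def gDerivation (X : LieAlg E G) : Derivation ℝ (GroupFun E G) (GroupFun E G) :=
  Derivation.mk' (gDeriv X) fun a b => by
    rw [gDeriv_mul, smul_eq_mul, smul_eq_mul]
    ring

theorem gDeriv_pow_succ (X : LieAlg E G) (f : GroupFun E G) (n : ℕ) :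
    gDeriv X (f ^ (n + 1)) = ((n : ℝ) + 1) • (f ^ n * gDeriv X f) := by
  have h := (gDerivation X).leibniz_pow (a := f) (n + 1)
  refine h.trans ?_
  rw [Nat.add_sub_cancel, ← Nat.cast_smul_eq_nsmul ℝ, Nat.cast_add_one]
  rfl

/-- The leading term of a product of vector fields applied to a power of a function. -/
theorem exists_gAct_prod_pow (φ : GroupFun E G) (l : List (LieAlg E G)) (m : ℕ) :
    ∃ g : GroupFun E G, gAct (l.map toU).prod (φ ^ (m + l.length)) =
      ((m + 1).ascFactorial l.length : ℝ) • (φ ^ m * (l.map fun X => gDeriv X φ).prod) +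
        φ ^ (m + 1) * g := by
  induction l generalizing m with
  | nil => exact ⟨0, by rw [List.map_nil, List.prod_nil, map_one]; simp⟩
  | cons X l ih =>
    obtain ⟨g, hg⟩ := ih (m + 1)
    set P := (l.map fun X => gDeriv X φ).prod with hP
    set c : ℝ := ((m + 1 + 1).ascFactorial l.length : ℝ) with hc
    have hc' : ((m + 1).ascFactorial (X :: l).length : ℝ) = c * ((m : ℝ) + 1) := by
      rw [List.length_cons, Nat.ascFactorial_succ, ← Nat.succ_ascFactorial]
      push_cast
      ring
    -- When `X` is applied to the two terms for `m + 1`, only the derivative of `φ ^ (m + 1)` in the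
    -- first loses a power of `φ`; all other terms keep the factor `φ ^ (m + 1)` and are collected
    -- here.
    refine ⟨c • gDeriv X P + ((m : ℝ) + 1 + 1) • (gDeriv X φ * g) + φ * gDeriv X g, ?_⟩
    have e : m + (X :: l).length = m + 1 + l.length := by rw [List.length_cons]; ring
    rw [List.map_cons, List.prod_cons, gAct_toU_mul, e, hg, List.map_cons, List.prod_cons, ← hP,
      hc', map_add, map_smul, gDeriv_mul, gDeriv_mul, gDeriv_pow_succ, gDeriv_pow_succ]
    push_cast
    simp only [Algebra.smul_def, map_mul, map_add, map_one]
    ring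

/-- With `φ` vanishing at `1`, a product of at most `n` fields applied to `φ ^ n` sees only its part
of degree exactly `n`, and there only the product of the values of the differential: the leading
symbol. -/
theorem gAct_prod_pow_apply_one (φ : GroupFun E G) (hφ : φ 1 = 0) (l : List (LieAlg E G)) (n : ℕ)
    (hl : l.length ≤ n) :
    gAct (l.map toU).prod (φ ^ n) 1 =
      if l.length = n then (n.factorial : ℝ) * (l.map fun X => gDeriv X φ 1).prod else 0 := by
  obtain ⟨m, rfl⟩ := Nat.exists_eq_add_of_le' hl
  obtain ⟨g, hg⟩ := exists_gAct_prod_pow φ l m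
  let ev : GroupFun E G →+* ℝ :=
    { toFun := fun f => f 1
      map_one' := rfl
      map_mul' := fun _ _ => rfl
      map_zero' := rfl
      map_add' := fun _ _ => rfl }
  have hev : ∀ f : GroupFun E G, f 1 = ev f := fun _ => rfl
  have hevs : ∀ (c : ℝ) (f : GroupFun E G), ev (c • f) = c * ev f := fun _ _ => rfl
  have h0 : ev φ = 0 := hφ
  rw [hg, hev, map_add, hevs, map_mul, map_mul, map_pow, map_pow, h0, map_list_prod, List.map_map]
  split_ifs with h
  · obtain rfl : m = 0 := by omega
    rw [Nat.zero_add, Nat.zero_add, Nat.one_ascFactorial]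
    rw [pow_zero, one_mul, pow_one, zero_mul, add_zero]
    rfl
  · have hm : m ≠ 0 := fun hm => h (by omega)
    simp [hm]

variable [FiniteDimensional ℝ E] [T2Space G]

/-- A linear functional read in the chart at `1`, recentred to vanish there and cut off by a bump
function equal to one near `1`. -/
theorem exists_testFunction (ξ : E →L[ℝ] ℝ) :
    ∃ φ : GroupFun E G, φ 1 = 0 ∧ ∀ X : LieAlg E G, gDeriv X φ 1 = ξ X := by
  have i1 : IsManifold 𝓘(ℝ, E) 1 G := IsManifold.of_le (n := ∞) (by simp)
  let c : PartialEquiv G E := extChartAt 𝓘(ℝ, E) (1 : G)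
  let f : SmoothBumpFunction 𝓘(ℝ, E) (1 : G) := Classical.arbitrary _
  -- Composition with the inverse of the differential of the chart makes the differential at `1`
  -- equal to `ξ` itself.
  let L : E →L[ℝ] E := (mfderiv 𝓘(ℝ, E) 𝓘(ℝ, E) c (1 : G)).inverse
  let ζ : E →L[ℝ] ℝ := ξ ∘L L
  let g : G → ℝ := fun x => ζ (c x) - ζ (c 1)
  have hg : ContMDiffOn 𝓘(ℝ, E) 𝓘(ℝ, ℝ) ∞ g (chartAt E (1 : G)).source :=
    (ζ.contDiff.sub contDiff_const).contMDiff.comp_contMDiffOn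
      (g := fun z : E => ζ z - ζ (c 1)) (f := c) contMDiffOn_extChartAt
  refine ⟨⟨fun x => f x • g x, f.contMDiff_smul hg⟩, ?_, fun X => ?_⟩
  · change f 1 • (ζ (c 1) - ζ (c 1)) = 0
    rw [sub_self, smul_zero]
  · have he : (fun x => f x • g x) =ᶠ[nhds (1 : G)] ((fun z : E => ζ z - ζ (c 1)) ∘ c) := by
      filter_upwards [f.eventuallyEq_one] with x hx
      rw [hx]
      exact one_smul ℝ _
    have hv : mulInvariantVectorField (I := 𝓘(ℝ, E)) X (1 : G) = X := by
      have h1 : (fun x : G => 1 * x) = id := funext one_mul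
      change mfderiv 𝓘(ℝ, E) 𝓘(ℝ, E) (fun x : G => 1 * x) 1 X = X
      rw [h1, mfderiv_id]
      rfl
    have hm : mfderiv 𝓘(ℝ, E) 𝓘(ℝ, ℝ) (fun x => f x • g x) 1 =
      mfderiv 𝓘(ℝ, E) 𝓘(ℝ, ℝ) ((fun z : E => ζ z - ζ (c 1)) ∘ c) (1 : G) := he.mfderiv_eq
    have hinv := isInvertible_mfderiv_extChartAt (I := 𝓘(ℝ, E))
      (mem_extChartAt_source (I := 𝓘(ℝ, E)) (1 : G))
    have hcomp := mvfderiv_comp_apply (I := 𝓘(ℝ, E)) (I' := 𝓘(ℝ, E)) (1 : G)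
      (g := fun z : E => ζ z - ζ (c 1)) (f := c)
      ((ζ.differentiable.sub_const _).differentiableAt.mdifferentiableAt)
      (mdifferentiableAt_extChartAt (mem_chart_source E (1 : G))) X
    have hL : L (mfderiv 𝓘(ℝ, E) 𝓘(ℝ, E) c (1 : G) X) = X := by
      obtain ⟨e, he⟩ := hinv
      change (mfderiv 𝓘(ℝ, E) 𝓘(ℝ, E) c (1 : G)).inverse (mfderiv 𝓘(ℝ, E) 𝓘(ℝ, E) c (1 : G) X) = X
      rw [← he, ContinuousLinearMap.inverse_equiv]
      exact e.symm_apply_apply X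
    change mvfderiv 𝓘(ℝ, E) (fun x => f x • g x) 1 (mulInvariantVectorField X 1) = _
    rw [hv]
    refine (congrArg (fun T : E →L[ℝ] ℝ => T X) hm).trans (hcomp.trans ?_)
    have hζ : fderiv ℝ (fun z : E => ζ z - ζ (c 1)) (c 1) = ζ := by
      rw [fderiv_sub_const, ContinuousLinearMap.fderiv]
    refine (mvfderiv_apply_eq_fderiv _ _ _).trans ?_
    exact (congrArg (fun T : E →L[ℝ] ℝ => T (mfderiv 𝓘(ℝ, E) 𝓘(ℝ, E) c (1 : G) X)) hζ).trans
      (congrArg ξ hL)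

end TestFunctions

/-! ### The standard filtration of `U𝔤`, leading symbols, and faithfulness. -/

section Faithful

variable {E : Type*} [NormedAddCommGroup E] [NormedSpace ℝ E] [CompleteSpace E]
  {G : Type*} [TopologicalSpace G] [ChartedSpace E G] [Group G] [LieGroup 𝓘(ℝ, E) ∞ G]
  {δ : Type*} (e : Module.Basis δ ℝ (LieAlg E G))

/-- The product in `U𝔤` of a list of basis elements of `𝔤`. -/
def listProd (l : List δ) : UEnv E G := ((l.map e).map toU).prod

theorem listProd_cons (i : δ) (l : List δ) : listProd e (i :: l) = toU (e i) * listProd e l := rfl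

/-- The standard filtration of `U𝔤`. -/
def filtration (n : ℕ) : Submodule ℝ (UEnv E G) :=
  Submodule.span ℝ (listProd e '' {l | l.length ≤ n})

theorem listProd_mem {l : List δ} {n : ℕ} (h : l.length ≤ n) : listProd e l ∈ filtration e n :=
  Submodule.subset_span ⟨l, h, rfl⟩

theorem filtration_mono {m n : ℕ} (h : m ≤ n) : filtration e m ≤ filtration e n :=
  Submodule.span_mono (Set.image_mono fun _ hl => le_trans hl h)

theorem toU_mul_mem {n : ℕ} (X : LieAlg E G) {u : UEnv E G} (hu : u ∈ filtration e n) :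
    toU X * u ∈ filtration e (n + 1) := by
  induction hu using Submodule.span_induction with
  | zero => rw [mul_zero]; exact Submodule.zero_mem _
  | add u v _ _ hu hv => rw [mul_add]; exact Submodule.add_mem _ hu hv
  | smul c u _ hu => rw [mul_smul_comm]; exact Submodule.smul_mem _ _ hu
  | mem u hu =>
    obtain ⟨l, hl, rfl⟩ := hu
    have hX : X ∈ Submodule.span ℝ (Set.range e) := e.mem_span X
    induction hX using Submodule.span_induction with
    | zero => rw [map_zero, zero_mul]; exact Submodule.zero_mem _
    | add X Y _ _ hX hY => rw [map_add, add_mul]; exact Submodule.add_mem _ hX hY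
    | smul c X _ hX => rw [map_smul, smul_mul_assoc]; exact Submodule.smul_mem _ _ hX
    | mem X hX =>
      obtain ⟨i, rfl⟩ := hX
      rw [← listProd_cons]
      exact listProd_mem e (Nat.succ_le_succ hl)

theorem exists_mem_filtration (u : UEnv E G) : ∃ n, u ∈ filtration e n := by
  induction u using uEnv_induction with
  | one => exact ⟨0, listProd_mem e (l := []) le_rfl⟩
  | smul c u h =>
    obtain ⟨n, hn⟩ := h
    exact ⟨n, Submodule.smul_mem _ _ hn⟩
  | add u v hu hv =>
    obtain ⟨m, hm⟩ := hu
    obtain ⟨n, hn⟩ := hv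
    exact ⟨max m n, Submodule.add_mem _ (filtration_mono e (le_max_left _ _) hm)
      (filtration_mono e (le_max_right _ _) hn)⟩
  | mul X u h =>
    obtain ⟨n, hn⟩ := h
    exact ⟨n + 1, toU_mul_mem e X hn⟩

/-- Exchanging two neighbouring factors costs a bracket, which has one factor fewer. -/
theorem listProd_sub_mem {l l' : List δ} (h : l.Perm l') (n : ℕ) (hl : l.length ≤ n + 1) :
    listProd e l - listProd e l' ∈ filtration e n := by
  induction h generalizing n with
  | nil => rw [sub_self]; exact Submodule.zero_mem _
  | @cons i l l' h ih =>
    rw [listProd_cons, listProd_cons, ← mul_sub]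
    rw [List.length_cons] at hl
    cases n with
    | zero =>
      obtain rfl : l = [] := List.eq_nil_of_length_eq_zero (by omega)
      obtain rfl : l' = [] := h.symm.eq_nil
      rw [sub_self, mul_zero]
      exact Submodule.zero_mem _
    | succ n => exact toU_mul_mem e _ (ih n (by omega))
  | swap i j l =>
    rw [List.length_cons, List.length_cons] at hl
    obtain ⟨n, rfl⟩ : ∃ k, n = k + 1 := ⟨n - 1, by omega⟩
    simp only [listProd_cons]
    rw [← mul_assoc, ← mul_assoc, ← sub_mul, ← toU_lie]
    exact toU_mul_mem e _ (listProd_mem e (by omega))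
  | trans h₁ _ ih₁ ih₂ =>
    rw [← sub_add_sub_cancel]
    exact Submodule.add_mem _ (ih₁ n hl) (ih₂ n (by rw [← h₁.length_eq]; exact hl))

/-- The product of basis elements given by a monomial. -/
def monomialProd (α : δ →₀ ℕ) : UEnv E G := listProd e (Finsupp.toMultiset α).toList

/-- A linear section of the symbol map. -/
def ofPoly : MvPolynomial δ ℝ →ₗ[ℝ] UEnv E G :=
  (MvPolynomial.basisMonomials δ ℝ).constr ℝ (monomialProd e)

theorem ofPoly_monomial (α : δ →₀ ℕ) (c : ℝ) :
    ofPoly e (MvPolynomial.monomial α c) = c • monomialProd e α := by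
  have h : MvPolynomial.monomial α c = c • MvPolynomial.basisMonomials δ ℝ α := by
    rw [MvPolynomial.coe_basisMonomials, MvPolynomial.smul_monomial, smul_eq_mul, mul_one]
  rw [h, map_smul, ofPoly, Module.Basis.constr_basis]

/-- Reordering factors only costs lower degree terms, so the top degree part is an ordered
polynomial in the basis. This is merely the spanning half of the Poincaré–Birkhoff–Witt theorem;
uniqueness is not needed, as the test functions detect the polynomial. -/
theorem exists_poly {n : ℕ} {u : UEnv E G} (hu : u ∈ filtration e (n + 1)) :
    ∃ p : MvPolynomial δ ℝ, p ∈ MvPolynomial.homogeneousSubmodule δ ℝ (n + 1) ∧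
      u - ofPoly e p ∈ filtration e n := by
  classical
  induction hu using Submodule.span_induction with
  | zero => exact ⟨0, Submodule.zero_mem _, by rw [map_zero, sub_self]; exact Submodule.zero_mem _⟩
  | add u v _ _ hu hv =>
    obtain ⟨p, hp, hp'⟩ := hu
    obtain ⟨q, hq, hq'⟩ := hv
    refine ⟨p + q, Submodule.add_mem _ hp hq, ?_⟩
    rw [map_add, add_sub_add_comm]
    exact Submodule.add_mem _ hp' hq'
  | smul c u _ hu =>
    obtain ⟨p, hp, hp'⟩ := hu
    refine ⟨c • p, Submodule.smul_mem _ _ hp, ?_⟩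
    rw [map_smul, ← smul_sub]
    exact Submodule.smul_mem _ _ hp'
  | mem u hu =>
    obtain ⟨l, hl, rfl⟩ := hu
    rcases Nat.lt_or_ge n l.length with h | h
    · have hl' : l.length = n + 1 := le_antisymm hl h
      let α : δ →₀ ℕ := Multiset.toFinsupp (l : Multiset δ)
      have hα : Finsupp.toMultiset α = l := Multiset.toFinsupp_toMultiset _
      refine ⟨MvPolynomial.monomial α 1, ?_, ?_⟩
      · refine MvPolynomial.isHomogeneous_monomial 1 ?_
        rw [Finsupp.degree_apply, ← hl', ← Multiset.coe_card, ← hα, Finsupp.card_toMultiset]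
        rfl
      · rw [ofPoly_monomial, one_smul, monomialProd, hα]
        refine listProd_sub_mem e (Multiset.coe_eq_coe.1 ?_) n hl'.le
        rw [Multiset.coe_toList]
    · exact ⟨0, Submodule.zero_mem _, by rw [map_zero, sub_zero]; exact listProd_mem e h⟩

variable [FiniteDimensional ℝ E] [T2Space G]

/-- Write `u` modulo lower degree as a homogeneous polynomial `p` of degree `n + 1`. Applying `u` to
`φ ^ (n + 1)` at the identity yields `(n + 1)!` times the value of `p` at the differential of `φ`.
These differentials are arbitrary, so `p = 0` and the degree drops. -/
theorem eq_zero_of_mem_filtration [Finite δ] (n : ℕ) (u : UEnv E G) (hu : u ∈ filtration e n)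
    (h : ∀ f, ev₁ f u 1 = 0) : u = 0 := by
  induction n generalizing u with
  | zero =>
    have hu' : u ∈ Submodule.span ℝ {(1 : UEnv E G)} := by
      refine Submodule.span_mono ?_ hu
      rintro _ ⟨l, hl, rfl⟩
      obtain rfl : l = [] := List.eq_nil_of_length_eq_zero (Nat.le_zero.1 hl)
      rfl
    obtain ⟨c, rfl⟩ := Submodule.mem_span_singleton.1 hu'
    -- In degree zero `u` is a scalar, recovered by applying it to the constant function `1`.
    have h1 := h 1
    rw [ev₁_apply, map_smul, map_one gAct] at h1
    have hc : c = 0 := by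
      have : c * (1 : ℝ) = 0 := h1
      simpa using this
    rw [hc, zero_smul]
  | succ n ih =>
    obtain ⟨p, hp, hup⟩ := exists_poly e hu
    suffices hp0 : p = 0 by
      rw [hp0, map_zero, sub_zero] at hup
      exact ih u hup h
    refine MvPolynomial.funext fun t => ?_
    -- The covector whose coordinates in the basis `e` are the point `t` at which `p` is to be
    -- evaluated.
    let ξ : E →L[ℝ] ℝ := LinearMap.toContinuousLinearMap (e.constr ℝ t : LieAlg E G →ₗ[ℝ] ℝ)
    have hξ : ∀ i, ξ (e i) = t i := fun i => e.constr_basis ℝ t i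
    obtain ⟨φ, hφ, hφξ⟩ := exists_testFunction (E := E) (G := G) ξ
    let τ : UEnv E G →ₗ[ℝ] ℝ :=
      { toFun := fun u => ev₁ (φ ^ (n + 1)) u 1
        map_add' := fun u v => by rw [map_add]; rfl
        map_smul' := fun c u => by rw [map_smul]; rfl }
    have hτl : ∀ l : List δ, l.length ≤ n + 1 → τ (listProd e l) =
        if l.length = n + 1 then ((n + 1).factorial : ℝ) * (l.map t).prod else 0 := by
      intro l hl
      have h := gAct_prod_pow_apply_one φ hφ (l.map e) (n + 1) (by rw [List.length_map]; exact hl)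
      rw [List.length_map] at h
      refine h.trans ?_
      rw [List.map_map]
      congr 4
      funext i
      exact (hφξ (e i)).trans (hξ i)
    -- The function `φ ^ (n + 1)` vanishes at `1` to an order that operators of degree at most `n`
    -- do not reach.
    have hτ0 : ∀ v ∈ filtration e n, τ v = 0 := by
      intro v hv
      refine Submodule.span_induction (p := fun v _ => τ v = 0) ?_ (map_zero τ) ?_ ?_ hv
      · rintro _ ⟨l, hl, rfl⟩
        have hl' : l.length ≤ n := hl
        rw [hτl l (by omega), if_neg (by omega)]
      · intro u v _ _ hu hv
        rw [map_add, hu, hv, add_zero]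
      · intro c u _ hu
        rw [map_smul, hu, smul_zero]
    have hτp : τ (ofPoly e p) = ((n + 1).factorial : ℝ) * MvPolynomial.eval t p := by
      rw [← MvPolynomial.support_sum_monomial_coeff p, map_sum, map_sum, map_sum, Finset.mul_sum]
      refine Finset.sum_congr rfl fun α hα => ?_
      have hdeg : (Finsupp.toMultiset α).toList.length = n + 1 := by
        rw [Multiset.length_toList, Finsupp.card_toMultiset]
        have := MvPolynomial.IsHomogeneous.degree_eq_sum_deg_support hp hα
        exact this.symm
      rw [ofPoly_monomial, map_smul, monomialProd, hτl _ hdeg.le, if_pos hdeg,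
        MvPolynomial.eval_monomial, ← Multiset.prod_coe, ← Multiset.map_coe, Multiset.coe_toList,
        Finsupp.toMultiset_map, Finsupp.prod_toMultiset, Finsupp.prod_mapDomain_index
          (fun _ => pow_zero _) (fun _ _ _ => pow_add _ _ _), smul_eq_mul]
      ring
    have hz : τ (ofPoly e p) = 0 := by
      have h2 := hτ0 _ hup
      rw [map_sub] at h2
      have h3 : τ u = 0 := h _
      linarith
    rw [hτp] at hz
    have hfac : ((n + 1).factorial : ℝ) ≠ 0 := by positivity
    rw [map_zero]
    exact (mul_eq_zero.1 hz).resolve_left hfac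

omit e

theorem eq_zero_of_ev₁ (u : UEnv E G) (h : ∀ f, ev₁ f u 1 = 0) : u = 0 := by
  have : FiniteDimensional ℝ (LieAlg E G) := inferInstanceAs (FiniteDimensional ℝ E)
  obtain ⟨n, hn⟩ := exists_mem_filtration (Module.finBasis ℝ (LieAlg E G)) u
  exact eq_zero_of_mem_filtration _ n u hn h

/-- Evaluation of a linear map into `C^∞(G)` at the identity. -/
def atOne {A : Type*} [AddCommGroup A] [Module ℝ A] (φ : A →ₗ[ℝ] GroupFun E G) : A →ₗ[ℝ] ℝ where
  toFun a := φ a 1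
  map_add' a b := by rw [map_add]; rfl
  map_smul' c a := by rw [map_smul]; rfl

theorem atOne_evTensor {A B : Type*} [Ring A] [Algebra ℝ A] [Ring B] [Algebra ℝ B]
    (φ : A →ₗ[ℝ] GroupFun E G) (ψ : B →ₗ[ℝ] GroupFun E G) (z : A ⊗[ℝ] B) :
    evTensor (atOne φ) (atOne ψ) z = evTensor φ ψ z 1 := by
  induction z using TensorProduct.induction_on with
  | zero => rw [map_zero, map_zero]; rfl
  | add z z' h h' => rw [map_add, map_add, h, h']; rfl
  | tmul a b => rfl

theorem eq_zero_of_ev₂ (w : UEnv E G ⊗[ℝ] UEnv E G) (h : ∀ f g, ev₂ f g w 1 = 0) : w = 0 :=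
  eq_zero_of_evTensor (fun f => atOne (ev₁ f)) (fun g => atOne (ev₁ g)) eq_zero_of_ev₁
    eq_zero_of_ev₁ w fun f g => (atOne_evTensor _ _ _).trans (h f g)

theorem eq_zero_of_ev₃ (w : UEnv E G ⊗[ℝ] (UEnv E G ⊗[ℝ] UEnv E G))
    (h : ∀ f g k, ev₃ f g k w 1 = 0) : w = 0 :=
  eq_zero_of_evTensor (fun f => atOne (ev₁ f))
    (fun p : GroupFun E G × GroupFun E G => atOne (ev₂ p.1 p.2)) eq_zero_of_ev₁
    (fun w hw => eq_zero_of_ev₂ w fun f g => hw (f, g)) w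
    fun f p => (atOne_evTensor _ _ _).trans (h f p.1 p.2)

end Faithful

/-! ### Mixed partial derivatives -/

section Mixed

variable {A : Type*} [NormedAddCommGroup A] [NormedSpace ℝ A]
  {E : Type*} [NormedAddCommGroup E] [NormedSpace ℝ E]

/-- Both sides are the second derivative of `ψ` in the directions `(ξ, 0)` and `(0, w)`, which is
symmetric. -/
theorem fderiv_fderiv_comm (ψ : A × E → ℝ) (a : A) (z : E) (h : ContDiffAt ℝ ∞ ψ (a, z))
    (ξ : A) (w : E) :
    fderiv ℝ (fun a' => fderiv ℝ (fun z' => ψ (a', z')) z w) a ξ =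
      fderiv ℝ (fun z' => fderiv ℝ (fun a' => ψ (a', z')) a ξ) z w := by
  have hev : ∀ᶠ p in nhds (a, z), DifferentiableAt ℝ ψ p :=
    ((h.of_le (m := 2) (by norm_cast)).eventually (by decide)).mono
      fun p hp => hp.differentiableAt (by simp)
  have hd2 : DifferentiableAt ℝ (fderiv ℝ ψ) (a, z) :=
    (h.fderiv_right (m := ∞) le_rfl).differentiableAt (by simp)
  have hs : IsSymmSndFDerivAt ℝ ψ (a, z) :=
    h.isSymmSndFDerivAt (by rw [minSmoothness_of_isRCLikeNormedField]; norm_cast)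
  have e1 : (fun a' => fderiv ℝ (fun z' => ψ (a', z')) z w) =ᶠ[nhds a]
      fun a' => fderiv ℝ ψ (a', z) (0, w) := by
    have hc : Filter.Tendsto (fun a' : A => (a', z)) (nhds a) (nhds (a, z)) :=
      (Continuous.prodMk_left z).tendsto a
    filter_upwards [hc.eventually hev] with a' ha'
    have := (HasFDerivAt.comp (g := ψ) (f := fun z' : E => (a', z')) z ha'.hasFDerivAt
      (hasFDerivAt_prodMk_right a' z)).fderiv
    exact (congrArg (fun T : E →L[ℝ] ℝ => T w) this).trans (by simp)
  have e2 : (fun z' => fderiv ℝ (fun a' => ψ (a', z')) a ξ) =ᶠ[nhds z]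
      fun z' => fderiv ℝ ψ (a, z') (ξ, 0) := by
    have hc : Filter.Tendsto (fun z' : E => (a, z')) (nhds z) (nhds (a, z)) :=
      (Continuous.prodMk_right a).tendsto z
    filter_upwards [hc.eventually hev] with z' hz'
    have := (HasFDerivAt.comp (g := ψ) (f := fun a' : A => (a', z')) a hz'.hasFDerivAt
      (hasFDerivAt_prodMk_left a z')).fderiv
    exact (congrArg (fun T : A →L[ℝ] ℝ => T ξ) this).trans (by simp)
  rw [e1.fderiv_eq, e2.fderiv_eq]
  have d1 := ((HasFDerivAt.comp (g := fderiv ℝ ψ) (f := fun a' : A => (a', z)) a hd2.hasFDerivAt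
    (hasFDerivAt_prodMk_left a z)).clm_apply
    (hasFDerivAt_const ((0 : A), w) a)).fderiv
  have d2 := ((HasFDerivAt.comp (g := fderiv ℝ ψ) (f := fun z' : E => (a, z')) z hd2.hasFDerivAt
    (hasFDerivAt_prodMk_right a z)).clm_apply
    (hasFDerivAt_const (ξ, (0 : E)) z)).fderiv
  refine (congrArg (fun T : A →L[ℝ] ℝ => T ξ) d1).trans
    (Eq.trans ?_ (congrArg (fun T : E →L[ℝ] ℝ => T w) d2).symm)
  simpa using hs.eq (ξ, 0) (0, w)

variable {M : Type*} [TopologicalSpace M] [ChartedSpace E M] [IsManifold 𝓘(ℝ, E) ∞ M]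

/-- The direction `w` does not depend on `f`, so one `w` serves a whole family of functions
depending on a parameter. -/
theorem exists_mvfderiv_eq_fderiv (x : M) (v : TangentSpace 𝓘(ℝ, E) x) :
    ∃ w : E, ∀ f : M → ℝ, MDifferentiableAt 𝓘(ℝ, E) 𝓘(ℝ, ℝ) f x →
      mvfderiv 𝓘(ℝ, E) f x v =
        fderiv ℝ (f ∘ (extChartAt 𝓘(ℝ, E) x).symm) (extChartAt 𝓘(ℝ, E) x x) w := by
  -- The vector `v` is extended by the same element of `E` at every point; only the value of this
  -- field at `x` enters.
  refine ⟨chartField (fun y : M => (v : E)) x (extChartAt 𝓘(ℝ, E) x x), fun f hf => ?_⟩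
  have hxx : (extChartAt 𝓘(ℝ, E) x).symm (extChartAt 𝓘(ℝ, E) x x) = x := extChartAt_to_inv x
  rw [← mvfderiv_apply_eq_chart (fun y : M => (v : E)) f x _ (mem_extChartAt_target x)
    (by rw [hxx]; exact hf), hxx]

theorem fderiv_mvfderiv_comm (f : A × M → ℝ)
    (hf : ContMDiff (𝓘(ℝ, A).prod 𝓘(ℝ, E)) 𝓘(ℝ, ℝ) ∞ f) (a ξ : A) (x : M)
    (v : TangentSpace 𝓘(ℝ, E) x) :
    fderiv ℝ (fun a' => mvfderiv 𝓘(ℝ, E) (fun y => f (a', y)) x v) a ξ =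
      mvfderiv 𝓘(ℝ, E) (fun y => fderiv ℝ (fun a' => f (a', y)) a ξ) x v := by
  obtain ⟨w, hw⟩ := exists_mvfderiv_eq_fderiv x v
  have h1 : ∀ a', MDifferentiableAt 𝓘(ℝ, E) 𝓘(ℝ, ℝ) (fun y => f (a', y)) x := fun a' =>
    (hf.comp (contMDiff_const.prodMk contMDiff_id)).mdifferentiable (by simp) x
  have h2 : MDifferentiableAt 𝓘(ℝ, E) 𝓘(ℝ, ℝ)
      (fun y => fderiv ℝ (fun a' => f (a', y)) a ξ) x := by
    have h := contMDiff_mvfderiv_param (I := 𝓘(ℝ, E)) (M := A) (fun (y : M) (a' : A) => f (a', y))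
      (hf.comp (contMDiff_snd.prodMk contMDiff_fst)) a ξ
    refine (h.congr fun y => ?_).mdifferentiable (by simp) x
    rw [mvfderiv_apply_eq_fderiv]
  rw [hw _ h2]
  have e : (fun a' => mvfderiv 𝓘(ℝ, E) (fun y => f (a', y)) x v) = fun a' =>
      fderiv ℝ (fun z' => f (a', (extChartAt 𝓘(ℝ, E) x).symm z')) (extChartAt 𝓘(ℝ, E) x x) w :=
    funext fun a' => hw _ (h1 a')
  rw [e]
  have hsm := contMDiffWithinAt_extChartAt_symm_range (n := ∞) (I := 𝓘(ℝ, E)) x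
    (mem_extChartAt_target x)
  rw [ModelWithCorners.range_eq_univ, contMDiffWithinAt_univ] at hsm
  have hψ : ContMDiffAt (𝓘(ℝ, A).prod 𝓘(ℝ, E)) 𝓘(ℝ, ℝ) ∞
      (fun p : A × E => f (p.1, (extChartAt 𝓘(ℝ, E) x).symm p.2))
      (a, extChartAt 𝓘(ℝ, E) x x) :=
    ContMDiffAt.comp (g := f) _ hf.contMDiffAt
      (contMDiffAt_fst.prodMk (ContMDiffAt.comp _ hsm contMDiffAt_snd))
  rw [← modelWithCornersSelf_prod, chartedSpaceSelf_prod] at hψ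
  exact fderiv_fderiv_comm (fun p : A × E => f (p.1, (extChartAt 𝓘(ℝ, E) x).symm p.2)) a _
    hψ.contDiffAt ξ w

end Mixed

/-! ### Derivatives along `𝔥*` commute with left-invariant operators. -/

section TotalDeriv

variable {F : Type*} [NormedAddCommGroup F] [NormedSpace ℝ F]
  {E : Type*} [NormedAddCommGroup E] [NormedSpace ℝ E] [CompleteSpace E]
  {G : Type*} [TopologicalSpace G] [ChartedSpace E G] [Group G] [LieGroup 𝓘(ℝ, E) ∞ G]

theorem totalDeriv_leftDeriv (ξ : LieDual F) (X : LieAlg E G) (f : TotalFun F E G) :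
    totalDeriv ξ (leftDeriv X f) = leftDeriv X (totalDeriv ξ f) :=
  ContMDiffMap.ext fun p =>
    fderiv_mvfderiv_comm f f.contMDiff p.1 ξ p.2 (mulInvariantVectorField X p.2)

theorem totalDeriv_leftAction (ξ : LieDual F) (u : UEnv E G) (f : TotalFun F E G) :
    totalDeriv ξ (leftAction u f) = leftAction u (totalDeriv ξ f) := by
  induction u using uEnv_induction with
  | one => rw [map_one]; rfl
  | smul c u h => rw [map_smul, LinearMap.smul_apply, LinearMap.smul_apply, map_smul, h]
  | add u v hu hv => rw [map_add, LinearMap.add_apply, LinearMap.add_apply, map_add, hu, hv]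
  | mul X u h =>
    rw [map_mul, leftAction_toU, Module.End.mul_apply, Module.End.mul_apply,
      totalDeriv_leftDeriv, h]

theorem totalDeriv_groupIncl (ξ : LieDual F) (f : GroupFun E G) :
    totalDeriv ξ (groupIncl f : TotalFun F E G) = 0 :=
  ContMDiffMap.ext fun p => by
    change fderiv ℝ (fun _ : LieDual F => f p.2) p.1 ξ = 0
    rw [fderiv_fun_const]
    rfl

theorem leftDeriv_baseIncl (X : LieAlg E G) (a : BaseFun F) :
    leftDeriv X (baseIncl a : TotalFun F E G) = 0 := by
  rw [← leftAction_toU, leftAction_baseIncl, counit_toU, zero_smul]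

theorem totalDeriv_baseIncl (ξ : LieDual F) (a : BaseFun F) :
    totalDeriv ξ (baseIncl a : TotalFun F E G) = baseIncl (baseDeriv ξ a) := rfl

end TotalDeriv

/-! ### Right translations by the subgroup -/

section RightTranslation

variable {F : Type*} [NormedAddCommGroup F] [NormedSpace ℝ F]
  {E : Type*} [NormedAddCommGroup E] [NormedSpace ℝ E] [CompleteSpace E]
  {G : Type*} [TopologicalSpace G] [ChartedSpace E G] [Group G] [LieGroup 𝓘(ℝ, E) ∞ G]

/-- `f ↦ (x ↦ f (x a))` on `C^∞(G)`. -/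
def gRight (a : G) : GroupFun E G →ₐ[ℝ] GroupFun E G :=
  pullback ⟨fun x => x * a, contMDiff_mul_right⟩

theorem gRight_apply (a x : G) (f : GroupFun E G) : gRight a f x = f (x * a) := rfl

theorem restr_rightTranslate (a : G) (μ : LieDual F) (f : TotalFun F E G) :
    restr μ (rightTranslate a f) = gRight a (restr μ f) := rfl

/-- `f ↦ (x ↦ f (a x))` on `C^∞(G)`. -/
def gLeft (a : G) : GroupFun E G →ₐ[ℝ] GroupFun E G :=
  pullback ⟨fun x => a * x, contMDiff_mul_left⟩

theorem restr_leftTranslate (a : G) (μ : LieDual F) (f : TotalFun F E G) :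
    restr μ (leftTranslate a f) = gLeft a (restr μ f) := rfl

theorem gDeriv_apply_eq (X : LieAlg E G) (f : GroupFun E G) (x : G) :
    gDeriv X f x = mvfderiv 𝓘(ℝ, E) (fun y => f (x * y)) 1 X := by
  have hm : MDifferentiableAt 𝓘(ℝ, E) 𝓘(ℝ, E) (fun y : G => x * y) 1 :=
    (contMDiff_mul_left (I := 𝓘(ℝ, E)) (n := ∞)).mdifferentiable (by simp) 1
  exact (mvfderiv_comp_apply_of_eq (I := 𝓘(ℝ, E)) (I' := 𝓘(ℝ, E)) (x := (1 : G))
    (y := x) (g := f) (f := fun y => x * y)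
    (f.contMDiff.mdifferentiable (by simp) x) hm (mul_one x) X).symm

theorem gLeft_gDeriv (a : G) (X : LieAlg E G) (f : GroupFun E G) :
    gDeriv X (gLeft a f) = gLeft a (gDeriv X f) := by
  ext x
  change gDeriv X (gLeft a f) x = gDeriv X f (a * x)
  rw [gDeriv_apply_eq, gDeriv_apply_eq]
  simp only [mul_assoc]
  rfl

theorem gAct_gLeft (a : G) (u : UEnv E G) (f : GroupFun E G) :
    gAct u (gLeft a f) = gLeft a (gAct u f) := by
  induction u using uEnv_induction with
  | one => rw [map_one]; rfl
  | smul c u h => rw [map_smul, LinearMap.smul_apply, LinearMap.smul_apply, map_smul, h]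
  | add u v hu hv => rw [map_add, LinearMap.add_apply, LinearMap.add_apply, map_add, hu, hv]
  | mul X u h => rw [gAct_toU_mul, gAct_toU_mul, h, gLeft_gDeriv]

variable {H : Type*} [TopologicalSpace H] [ChartedSpace F H] [CommGroup H]
  [LieGroup 𝓘(ℝ, F) ∞ H] {ι : H →* G} (hι : ContMDiff 𝓘(ℝ, F) 𝓘(ℝ, E) ∞ ι)

include hι

theorem gDeriv_lieIncl (h : F) (f : GroupFun E G) (x : G) :
    gDeriv (lieIncl ι h) f x = mvfderiv 𝓘(ℝ, F) (fun s => f (x * ι s)) 1 (h : F) := by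
  rw [gDeriv_apply_eq]
  have hm : MDifferentiableAt 𝓘(ℝ, E) 𝓘(ℝ, ℝ) (fun y : G => f (x * y)) 1 :=
    (f.contMDiff.comp contMDiff_mul_left).mdifferentiable (by simp) 1
  exact (mvfderiv_comp_apply_of_eq (I := 𝓘(ℝ, E)) (I' := 𝓘(ℝ, F)) (x := (1 : H))
    (y := (1 : G)) (g := fun y : G => f (x * y)) (f := ι) hm
    (hι.mdifferentiable (by simp) 1) (map_one ι) h).symm

/-- Right translations by `H` commute with the fields generated by `𝔥` because `H` is commutative.
-/
theorem gDeriv_gRight (h : F) (s : H) (f : GroupFun E G) :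
    gDeriv (lieIncl ι h) (gRight (ι s) f) = gRight (ι s) (gDeriv (lieIncl ι h) f) := by
  ext x
  rw [gRight_apply, gDeriv_lieIncl hι, gDeriv_lieIncl hι]
  have e : (fun t => gRight (ι s) f (x * ι t)) = fun t => f (x * ι s * ι t) := funext fun t => by
    rw [gRight_apply, mul_assoc, mul_assoc, ← map_mul, ← map_mul, mul_comm t s]
  rw [e]

omit hι in
/-- The velocity at `t₀` of a curve in `H`, translated to the identity. -/
def velocity (c : ℝ → H) (t₀ : ℝ) : F :=
  mfderiv 𝓘(ℝ, ℝ) 𝓘(ℝ, F) (fun t => (c t₀)⁻¹ * c t) t₀ (1 : ℝ)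

variable {c : ℝ → H} (hc : ContMDiff 𝓘(ℝ, ℝ) 𝓘(ℝ, F) ∞ c)

include hc

/-- Arbitrary smooth curves in `H` take the place of one-parameter subgroups; the velocity
translated to the identity plays the role of the generator. -/
theorem hasDerivAt_curve (f : GroupFun E G) (x : G) (t₀ : ℝ) :
    HasDerivAt (fun t => f (x * ι (c t)))
      (gRight (ι (c t₀)) (gDeriv (lieIncl ι (velocity (F := F) c t₀)) f) x) t₀ := by
  have hsm : ContMDiff 𝓘(ℝ, ℝ) 𝓘(ℝ, ℝ) ∞ (fun t => f (x * ι (c t))) :=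
    f.contMDiff.comp (contMDiff_mul_left.comp (hι.comp hc))
  have hd : DifferentiableAt ℝ (fun t => f (x * ι (c t))) t₀ :=
    hsm.contDiff.differentiable (by simp) t₀
  refine hd.hasDerivAt.congr_deriv ?_
  rw [gRight_apply, gDeriv_lieIncl hι]
  have h1 : MDifferentiableAt 𝓘(ℝ, F) 𝓘(ℝ, ℝ) (fun s => f (x * ι (c t₀) * ι s)) 1 :=
    (f.contMDiff.comp (contMDiff_mul_left.comp hι)).mdifferentiable (by simp) 1
  have h2 : MDifferentiableAt 𝓘(ℝ, ℝ) 𝓘(ℝ, F) (fun t => (c t₀)⁻¹ * c t) t₀ :=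
    (contMDiff_mul_left.comp hc).mdifferentiable (by simp) t₀
  have h3 := mvfderiv_comp_apply_of_eq (I := 𝓘(ℝ, F)) (I' := 𝓘(ℝ, ℝ)) (x := t₀) (y := (1 : H))
    (g := fun s => f (x * ι (c t₀) * ι s)) (f := fun t => (c t₀)⁻¹ * c t) h1 h2
    (inv_mul_cancel (c t₀)) (1 : ℝ)
  have e : (fun s => f (x * ι (c t₀) * ι s)) ∘ (fun t => (c t₀)⁻¹ * c t) =
      fun t => f (x * ι (c t)) := funext fun t => by
    change f (x * ι (c t₀) * ι ((c t₀)⁻¹ * c t)) = _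
    rw [mul_assoc, ← map_mul, mul_inv_cancel_left]
  rw [e] at h3
  refine Eq.trans ?_ h3
  exact (mvfderiv_apply_eq_fderiv _ _ _).symm

/-- The family of right translates of `f` along a curve in `H`. -/
def curveTranslates (f : GroupFun E G) : TotalFun ℝ E G :=
  ⟨fun p => f (p.2 * ι (c (p.1 1))), f.contMDiff.comp (contMDiff_snd.mul (hι.comp (hc.comp
    ((ContinuousLinearMap.apply ℝ ℝ (1 : ℝ)).contDiff.contMDiff.comp contMDiff_fst))))⟩

theorem restr_curveTranslates (f : GroupFun E G) (τ : LieDual ℝ) :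
    restr τ (curveTranslates hι hc f) = gRight (ι (c (τ 1))) f := rfl

theorem restr_totalDeriv_curveTranslates (f : GroupFun E G) (τ : LieDual ℝ) :
    restr τ (totalDeriv (ContinuousLinearMap.id ℝ ℝ) (curveTranslates hι hc f)) =
      gRight (ι (c (τ 1))) (gDeriv (lieIncl ι (velocity (F := F) c (τ 1))) f) := by
  ext x
  change fderiv ℝ (fun τ : LieDual ℝ => f (x * ι (c (τ 1)))) τ (ContinuousLinearMap.id ℝ ℝ) = _
  have h := (hasDerivAt_curve hι hc f x (τ 1)).hasFDerivAt.comp τ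
    (ContinuousLinearMap.apply ℝ ℝ (1 : ℝ)).hasFDerivAt
  refine (congrArg (fun T : LieDual ℝ →L[ℝ] ℝ => T (ContinuousLinearMap.id ℝ ℝ)) h.fderiv).trans ?_
  simp

/-- Differentiation along the curve passes through `u⃗`: the translates form one smooth function of
the parameter and the group point, and the parameter derivative commutes with left-invariant
operators. -/
theorem hasDerivAt_gAct_curve (u : UEnv E G) (f : GroupFun E G) (x : G) (t₀ : ℝ) :
    HasDerivAt (fun t => gAct u (gRight (ι (c t)) f) x)
      (gAct u (gRight (ι (c t₀)) (gDeriv (lieIncl ι (velocity (F := F) c t₀)) f)) x) t₀ := by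
  -- The parameter line is `LieDual ℝ`, so that the translates become an instance of `TotalFun`; `L`
  -- identifies it with `ℝ`.
  let L : ℝ →L[ℝ] LieDual ℝ := ContinuousLinearMap.smulRightL ℝ ℝ ℝ (ContinuousLinearMap.id ℝ ℝ)
  have hL : ∀ t, L t 1 = t := fun t => by simp [L]
  have hL1 : L 1 = ContinuousLinearMap.id ℝ ℝ := by ext; simp [L]
  let K := leftAction u (curveTranslates hι hc f)
  have hK : ∀ t, gAct u (gRight (ι (c t)) f) x = K (L t, x) := fun t => by
    have h := restr_leftAction u (L t) (curveTranslates hι hc f)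
    rw [restr_curveTranslates, hL] at h
    exact (DFunLike.congr_fun h x).symm
  have hd : DifferentiableAt ℝ (fun τ : LieDual ℝ => K (τ, x)) (L t₀) :=
    (contDiff_slice K x).differentiable (by simp) _
  have h1 := (hd.hasFDerivAt.comp t₀ L.hasFDerivAt).hasDerivAt
  rw [funext hK]
  refine h1.congr_deriv ?_
  rw [ContinuousLinearMap.comp_apply, hL1]
  have h2 := congrArg (restr (L t₀)) (totalDeriv_leftAction (ContinuousLinearMap.id ℝ ℝ) u
    (curveTranslates hι hc f))
  rw [restr_leftAction, restr_totalDeriv_curveTranslates, hL] at h2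
  exact DFunLike.congr_fun h2 x

end RightTranslation

/-! ### Invariant elements of `U𝔤` and right translations by a connected subgroup -/

section Diagonal

theorem hasDerivAt_diagonal (K : ℝ × ℝ → ℝ) (t : ℝ) (hK : DifferentiableAt ℝ K (t, t)) {k l : ℝ}
    (h1 : HasDerivAt (fun s => K (s, t)) k t) (h2 : HasDerivAt (fun s => K (t, s)) l t) :
    HasDerivAt (fun s => K (s, s)) (k + l) t := by
  have e1 := h1.unique (HasFDerivAt.comp_hasDerivAt (l := K) (f := fun s => (s, t)) t
    hK.hasFDerivAt ((hasDerivAt_id t).prodMk (hasDerivAt_const t t)))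
  have e2 := h2.unique (HasFDerivAt.comp_hasDerivAt (l := K) (f := fun s => (t, s)) t
    hK.hasFDerivAt ((hasDerivAt_const t t).prodMk (hasDerivAt_id t)))
  refine (HasFDerivAt.comp_hasDerivAt (l := K) (f := fun s => (s, s)) t
    hK.hasFDerivAt ((hasDerivAt_id t).prodMk (hasDerivAt_id t))).congr_deriv ?_
  rw [e1, e2, ← map_add]
  simp

end Diagonal

/-! ### Smooth curves in `H` reaching nearby points and prescribing a velocity direction. -/

section Curves

variable {F : Type*} [NormedAddCommGroup F] [NormedSpace ℝ F]
  {H : Type*} [TopologicalSpace H] [ChartedSpace F H] [CommGroup H] [LieGroup 𝓘(ℝ, F) ∞ H]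

/-- A smooth curve through `s` which is a sine-parametrized segment in the chart at `s`. -/
def chartCurve (s : H) (w : F) (t : ℝ) : H :=
  (extChartAt 𝓘(ℝ, F) s).symm (extChartAt 𝓘(ℝ, F) s s + Real.sin t • w)

/-- Since `|sin| ≤ 1`, the segment never leaves a ball inside the chart, so the curve is smooth on
all of `ℝ`. -/
theorem exists_contMDiff_chartCurve (s : H) :
    ∃ ε > 0, ∀ w : F, ‖w‖ < ε → ContMDiff 𝓘(ℝ, ℝ) 𝓘(ℝ, F) ∞ (chartCurve s w) := by
  obtain ⟨ε, hε, hb⟩ := Metric.mem_nhds_iff.1 (extChartAt_target_mem_nhds (I := 𝓘(ℝ, F)) s)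
  refine ⟨ε, hε, fun w hw => ?_⟩
  refine (contMDiffOn_extChartAt_symm (I := 𝓘(ℝ, F)) s).comp_contMDiff (n := ∞)
    (f := fun t : ℝ => extChartAt 𝓘(ℝ, F) s s + Real.sin t • w) ?_ fun t => hb ?_
  · exact (contDiff_const.add (Real.contDiff_sin.smul contDiff_const)).contMDiff
  · rw [mem_ball_iff_norm, add_sub_cancel_left, norm_smul]
    calc ‖Real.sin t‖ * ‖w‖ ≤ 1 * ‖w‖ :=
          mul_le_mul_of_nonneg_right (Real.abs_sin_le_one t) (norm_nonneg w)
      _ < ε := by rwa [one_mul]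

theorem chartCurve_zero (s : H) (w : F) : chartCurve s w 0 = s := by
  rw [chartCurve, Real.sin_zero, zero_smul, add_zero, extChartAt_to_inv]

/-- The direction has to be shrunk to fit into the chart, so `h` is reached only up to a nonzero
scalar; this is harmless for the linear conditions to be tested. -/
theorem exists_curve_velocity (h : F) :
    ∃ c : ℝ → H, ContMDiff 𝓘(ℝ, ℝ) 𝓘(ℝ, F) ∞ c ∧ c 0 = 1 ∧
      ∃ ε : ℝ, ε ≠ 0 ∧ velocity (F := F) c 0 = ε • h := by
  have i1 : IsManifold 𝓘(ℝ, F) 1 H := IsManifold.of_le (n := ∞) (by simp)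
  obtain ⟨ε, hε, hc⟩ := exists_contMDiff_chartCurve (F := F) (1 : H)
  have ht := mem_extChartAt_target (I := 𝓘(ℝ, F)) (1 : H)
  set z := extChartAt 𝓘(ℝ, F) (1 : H) 1 with hz
  have hinv := isInvertible_mfderivWithin_extChartAt_symm (I := 𝓘(ℝ, F)) ht
  have hs := mdifferentiableWithinAt_extChartAt_symm (I := 𝓘(ℝ, F)) ht
  rw [ModelWithCorners.range_eq_univ] at hs hinv
  rw [mdifferentiableWithinAt_univ] at hs
  rw [mfderivWithin_univ] at hinv
  let L : F →L[ℝ] F := mfderiv 𝓘(ℝ, F) 𝓘(ℝ, F) (extChartAt 𝓘(ℝ, F) (1 : H)).symm z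
  obtain ⟨w, hw⟩ : ∃ w, L w = h := by
    obtain ⟨e, he⟩ := hinv
    refine ⟨e.symm h, ?_⟩
    have : (e : F → F) (e.symm h) = h := e.apply_symm_apply h
    exact (congrArg (fun T : F →L[ℝ] F => T (e.symm h)) he.symm).trans this
  obtain ⟨r, hr, hrw⟩ : ∃ r : ℝ, r ≠ 0 ∧ ‖r • w‖ < ε := by
    refine ⟨ε / (‖w‖ + 1), by positivity, ?_⟩
    rw [norm_smul, Real.norm_of_nonneg (by positivity), div_mul_eq_mul_div,
      div_lt_iff₀ (by positivity)]
    nlinarith [norm_nonneg w]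
  refine ⟨chartCurve 1 (r • w), hc _ hrw, chartCurve_zero _ _, r, hr, ?_⟩
  have e1 : (fun t => (chartCurve (1 : H) (r • w) 0)⁻¹ * chartCurve 1 (r • w) t) =
      (extChartAt 𝓘(ℝ, F) (1 : H)).symm ∘ fun t : ℝ => z + Real.sin t • (r • w) := funext fun t => by
    rw [chartCurve_zero, inv_one, one_mul]; rfl
  have hd : HasDerivAt (fun t : ℝ => z + Real.sin t • (r • w)) (r • w) 0 := by
    have := ((Real.hasDerivAt_sin 0).smul_const (r • w)).const_add z
    rwa [Real.cos_zero, one_smul] at this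
  have hz0 : z + Real.sin 0 • (r • w) = z := by rw [Real.sin_zero, zero_smul, add_zero]
  have h3 := mfderiv_comp_apply_of_eq (I := 𝓘(ℝ, ℝ)) (I' := 𝓘(ℝ, F)) (I'' := 𝓘(ℝ, F)) (x := (0 : ℝ))
    (y := z) (g := (extChartAt 𝓘(ℝ, F) (1 : H)).symm) (f := fun t : ℝ => z + Real.sin t • (r • w))
    hs hd.differentiableAt.mdifferentiableAt hz0 (1 : ℝ)
  have h4 : velocity (F := F) (chartCurve (1 : H) (r • w)) 0 =
      (mfderiv 𝓘(ℝ, ℝ) 𝓘(ℝ, F) ((extChartAt 𝓘(ℝ, F) (1 : H)).symm ∘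
        fun t : ℝ => z + Real.sin t • (r • w)) 0 : ℝ →L[ℝ] F) 1 := by
    rw [velocity]
    exact congrArg (fun φ : ℝ → H => (mfderiv 𝓘(ℝ, ℝ) 𝓘(ℝ, F) φ 0 : ℝ →L[ℝ] F) 1) e1
  rw [h4]
  refine Eq.trans h3 ?_
  have h5 : (mfderiv 𝓘(ℝ, ℝ) 𝓘(ℝ, F) (fun t : ℝ => z + Real.sin t • (r • w)) 0 : ℝ →L[ℝ] F) 1 =
      r • w := by
    have : mfderiv 𝓘(ℝ, ℝ) 𝓘(ℝ, F) (fun t : ℝ => z + Real.sin t • (r • w)) 0 =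
      fderiv ℝ (fun t : ℝ => z + Real.sin t • (r • w)) 0 := mfderiv_eq_fderiv
    refine (congrArg (fun T : ℝ →L[ℝ] F => T 1) this).trans ?_
    exact hd.deriv
  refine (congrArg L h5).trans ?_
  rw [map_smul, hw]

end Curves

/-! ### Infinitesimal `𝔥`-invariance versus invariance under right translations by `H`. -/

section Invariance

variable {F : Type*} [NormedAddCommGroup F] [NormedSpace ℝ F]
  {E : Type*} [NormedAddCommGroup E] [NormedSpace ℝ E] [CompleteSpace E]
  {G : Type*} [TopologicalSpace G] [ChartedSpace E G] [Group G] [LieGroup 𝓘(ℝ, E) ∞ G]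
  {H : Type*} [TopologicalSpace H] [ChartedSpace F H] [CommGroup H]
  [LieGroup 𝓘(ℝ, F) ∞ H] {ι : H →* G} (hι : ContMDiff 𝓘(ℝ, F) 𝓘(ℝ, E) ∞ ι)

include hι

section

variable {c : ℝ → H} (hc : ContMDiff 𝓘(ℝ, ℝ) 𝓘(ℝ, F) ∞ c)

include hc

theorem gRight_gRight_inv (s : H) (f : GroupFun E G) : gRight (ι s) (gRight (ι s⁻¹) f) = f := by
  ext x
  rw [gRight_apply, gRight_apply, mul_assoc, ← map_mul, mul_inv_cancel, map_one, mul_one]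

/-- Differentiate the constant function `s ↦ f (x ι(c s) ι(c s)⁻¹)` as the diagonal of a function of
two parameters. -/
theorem gDeriv_velocity_inv (t₀ : ℝ) (f : GroupFun E G) (x : G) :
    gDeriv (lieIncl ι (velocity (F := F) (fun t => (c t)⁻¹) t₀)) f x =
      -gDeriv (lieIncl ι (velocity (F := F) c t₀)) f x := by
  have hc' : ContMDiff 𝓘(ℝ, ℝ) 𝓘(ℝ, F) ∞ (fun t => (c t)⁻¹) := hc.inv
  let K : ℝ × ℝ → ℝ := fun p => f (x * ι (c p.1) * ι (c p.2)⁻¹)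
  have hK : ContMDiff (𝓘(ℝ, ℝ).prod 𝓘(ℝ, ℝ)) 𝓘(ℝ, ℝ) ∞ K :=
    f.contMDiff.comp ((contMDiff_mul_left.comp (hι.comp (hc.comp contMDiff_fst))).mul
      (hι.comp (hc'.comp contMDiff_snd)))
  rw [← modelWithCornersSelf_prod, chartedSpaceSelf_prod] at hK
  have h1 := hasDerivAt_curve hι hc (gRight (ι (c t₀)⁻¹) f) x t₀
  have h2 := hasDerivAt_curve hι hc' f (x * ι (c t₀)) t₀
  rw [gDeriv_gRight hι, gRight_gRight_inv hι hc] at h1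
  have h := hasDerivAt_diagonal K t₀ (hK.contDiff.differentiable (by simp) _) h1 h2
  have hconst : (fun s => K (s, s)) = fun _ => f x := funext fun s => by
    change f (x * ι (c s) * ι (c s)⁻¹) = f x
    rw [mul_assoc, ← map_mul, mul_inv_cancel, map_one, mul_one]
  rw [hconst] at h
  have h0 := h.unique (hasDerivAt_const t₀ (f x))
  rw [gRight_apply, mul_assoc, ← map_mul, mul_inv_cancel, map_one, mul_one] at h0
  linarith

/-- Conjugating `u⃗` by right translations along the curve has zero derivative: the contributions of
the translation and of its inverse cancel because `u` commutes with `𝔥`. -/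
theorem gAct_curve_conj_const (u : UEnv E G) (hu : ∀ h : F, Commute (toU (lieIncl ι h)) u)
    (f : GroupFun E G) (x : G) (t t' : ℝ) :
    gAct u (gRight (ι (c t)) f) (x * ι (c t)⁻¹) = gAct u (gRight (ι (c t')) f) (x * ι (c t')⁻¹) := by
  have hc' : ContMDiff 𝓘(ℝ, ℝ) 𝓘(ℝ, F) ∞ (fun t => (c t)⁻¹) := hc.inv
  have key : ∀ t₀, HasDerivAt (fun t => gAct u (gRight (ι (c t)) f) (x * ι (c t)⁻¹)) 0 t₀ := by
    intro t₀
    let L : ℝ →L[ℝ] LieDual ℝ := ContinuousLinearMap.smulRightL ℝ ℝ ℝ (ContinuousLinearMap.id ℝ ℝ)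
    have hL : ∀ t, L t 1 = t := fun t => by simp [L]
    let K : ℝ × ℝ → ℝ := fun p => gAct u (gRight (ι (c p.1)) f) (x * ι (c p.2)⁻¹)
    have hKe : K = fun p => leftAction u (curveTranslates hι hc f) (L p.1, x * ι (c p.2)⁻¹) :=
      funext fun p => by
        have h := restr_leftAction u (L p.1) (curveTranslates hι hc f)
        rw [restr_curveTranslates, hL] at h
        exact (DFunLike.congr_fun h _).symm
    have hK : ContMDiff (𝓘(ℝ, ℝ).prod 𝓘(ℝ, ℝ)) 𝓘(ℝ, ℝ) ∞ K := by
      rw [hKe]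
      exact (leftAction u (curveTranslates hι hc f)).contMDiff.comp
        ((L.contDiff.contMDiff.comp contMDiff_fst).prodMk
          (contMDiff_mul_left.comp (hι.comp (hc'.comp contMDiff_snd))))
    rw [← modelWithCornersSelf_prod, chartedSpaceSelf_prod] at hK
    have h1 := hasDerivAt_gAct_curve hι hc u f (x * ι (c t₀)⁻¹) t₀
    have h2 := hasDerivAt_curve hι hc' (gAct u (gRight (ι (c t₀)) f)) x t₀
    have h := hasDerivAt_diagonal K t₀ (hK.contDiff.differentiable (by simp) _) h1 h2
    refine h.congr_deriv ?_
    rw [gRight_apply, gDeriv_velocity_inv hι hc, ← gDeriv_gRight hι, ← gAct_toU,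
      ← Module.End.mul_apply, ← Module.End.mul_apply, ← map_mul, ← map_mul, (hu _).eq, add_neg_cancel]
  exact is_const_of_deriv_eq_zero (fun s => (key s).differentiableAt) (fun s => (key s).deriv) t t'

end

/-- The conjugate of `u⃗` by translation by `s'` is locally constant in `s'`, hence constant as `H`
is connected; compare `s' = s` with `s' = 1`. -/
theorem gAct_gRight [ConnectedSpace H] (u : UEnv E G)
    (hu : ∀ h : F, Commute (toU (lieIncl ι h)) u) (s : H) (f : GroupFun E G) :
    gAct u (gRight (ι s) f) = gRight (ι s) (gAct u f) := by
  ext x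
  let Φ : H → ℝ := fun s' => gAct u (gRight (ι s') f) (x * ι s * ι s'⁻¹)
  have hΦ : IsLocallyConstant Φ := by
    refine (IsLocallyConstant.iff_eventually_eq Φ).2 fun s₀ => ?_
    obtain ⟨ε, hε, hc⟩ := exists_contMDiff_chartCurve (F := F) s₀
    have hcont : Filter.Tendsto (fun s' => extChartAt 𝓘(ℝ, F) s₀ s' - extChartAt 𝓘(ℝ, F) s₀ s₀)
        (nhds s₀) (nhds 0) := by
      have := (continuousAt_extChartAt (I := 𝓘(ℝ, F)) s₀).tendsto.sub_const
        (extChartAt 𝓘(ℝ, F) s₀ s₀)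
      rwa [sub_self] at this
    filter_upwards [extChartAt_source_mem_nhds (I := 𝓘(ℝ, F)) s₀,
      hcont.eventually (Metric.ball_mem_nhds 0 hε)] with s' hs' hs''
    -- The sine-parametrized segment is at `s'` for `t = π / 2` and at `s₀` for `t = 0`.
    have h := gAct_curve_conj_const hι (hc _ (mem_ball_zero_iff.1 hs'')) u hu f (x * ι s)
      (Real.pi / 2) 0
    rw [chartCurve_zero, chartCurve, Real.sin_pi_div_two, one_smul, add_sub_cancel,
      PartialEquiv.left_inv _ hs'] at h
    exact h
  have h := hΦ.apply_eq_of_preconnectedSpace s 1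
  change gAct u (gRight (ι s) f) (x * ι s * ι s⁻¹) = gAct u (gRight (ι 1) f) (x * ι s * ι 1⁻¹) at h
  have h1 : gRight (ι 1) f = f := by
    ext y; rw [gRight_apply, map_one, mul_one]
  rw [h1, mul_assoc, ← map_mul, mul_inv_cancel, inv_one, map_one, mul_one, mul_one] at h
  rw [h, gRight_apply]

theorem hasDerivAt_ev₂_curve {c : ℝ → H} (hc : ContMDiff 𝓘(ℝ, ℝ) 𝓘(ℝ, F) ∞ c) (hc0 : c 0 = 1)
    (f g : GroupFun E G) (w : UEnv E G ⊗[ℝ] UEnv E G) (x : G) :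
    HasDerivAt (fun t => ev₂ (gRight (ι (c t)) f) (gRight (ι (c t)) g) w x)
      (ev₂ f g (w * (toU (lieIncl ι (velocity (F := F) c 0)) ⊗ₜ[ℝ] 1 +
        1 ⊗ₜ[ℝ] toU (lieIncl ι (velocity (F := F) c 0)))) x) 0 := by
  have hR : ∀ f : GroupFun E G, gRight (ι (c 0)) f = f := fun f => by
    ext y; rw [gRight_apply, hc0, map_one, mul_one]
  induction w using TensorProduct.induction_on with
  | zero =>
    simp only [map_zero, zero_mul]
    exact hasDerivAt_const _ _
  | add w w' h h' =>
    rw [add_mul, map_add]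
    simp only [map_add]
    exact h.add h'
  | tmul u v =>
    have h1 := hasDerivAt_gAct_curve hι hc u f x 0
    have h2 := hasDerivAt_gAct_curve hι hc v g x 0
    have h := h1.mul h2
    rw [hR, hR, hR, hR] at h
    refine h.congr_deriv ?_
    rw [mul_add, Algebra.TensorProduct.tmul_mul_tmul, Algebra.TensorProduct.tmul_mul_tmul, map_add,
      ev₂_tmul, ev₂_tmul, mul_one, mul_one, map_mul, map_mul, gAct_toU]
    rfl

/-- Differentiate the invariance along a curve through `1`. Translating the arguments multiplies `w`
by `Δ(h)` on the right, translating the result multiplies it on the left; faithfulness then gives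
the commutation. -/
theorem commute_of_ev₂_invariant [FiniteDimensional ℝ E] [T2Space G]
    (w : UEnv E G ⊗[ℝ] UEnv E G)
    (hw : ∀ (s : H) f g, ev₂ (gRight (ι s) f) (gRight (ι s) g) w = gRight (ι s) (ev₂ f g w))
    (h : F) : Commute (toU (lieIncl ι h) ⊗ₜ[ℝ] 1 + 1 ⊗ₜ[ℝ] toU (lieIncl ι h)) w := by
  obtain ⟨c, hc, hc0, ε, hε, hv⟩ := exists_curve_velocity (F := F) (H := H) h
  have key : Commute (toU (lieIncl (E := E) ι (ε • h)) ⊗ₜ[ℝ] (1 : UEnv E G) +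
      (1 : UEnv E G) ⊗ₜ[ℝ] toU (lieIncl (E := E) ι (ε • h))) w := by
    rw [← hv]
    refine sub_eq_zero.1 (eq_zero_of_ev₂ _ fun f g => ?_)
    have h1 := hasDerivAt_ev₂_curve hι hc hc0 f g w 1
    simp only [hw] at h1
    have h2 := hasDerivAt_curve hι hc (ev₂ f g w) 1 0
    have h3 := h2.unique h1
    rw [gRight_apply, hc0, map_one, mul_one, ← ev₂_primitive_mul] at h3
    rw [map_sub]
    exact sub_eq_zero.2 h3
  -- The scalar left over from the choice of curve is cancelled.
  rw [map_smul, map_smul, ← TensorProduct.smul_tmul', TensorProduct.tmul_smul, ← smul_add] at key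
  have := key.smul_left ε⁻¹
  rwa [smul_smul, inv_mul_cancel₀ hε, one_smul] at this

end Invariance

/-! ### Operators given by functions on `𝔥*` -/

section EvTotal

variable {F : Type*} [NormedAddCommGroup F] [NormedSpace ℝ F]
  {E : Type*} [NormedAddCommGroup E] [NormedSpace ℝ E] [CompleteSpace E]
  {G : Type*} [TopologicalSpace G] [ChartedSpace E G] [Group G] [LieGroup 𝓘(ℝ, E) ∞ G]
  {A : Type*} [Ring A] [Algebra ℝ A]

/-- `a ⊗ w ↦ a φ(w)`, a function on `M`. -/
def evTotal (φ : A →ₗ[ℝ] GroupFun E G) : FunTensor F A →ₗ[ℝ] TotalFun F E G :=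
  LinearMap.mul' ℝ (TotalFun F E G) ∘ₗ
    TensorProduct.map baseIncl.toLinearMap (groupIncl.toLinearMap ∘ₗ φ)

theorem evTotal_tmul (φ : A →ₗ[ℝ] GroupFun E G) (a : BaseFun F) (w : A) :
    evTotal φ (a ⊗ₜ[ℝ] w) = baseIncl a * groupIncl (φ w) := rfl

theorem restr_evTotal (φ : A →ₗ[ℝ] GroupFun E G) (μ : LieDual F) (z : FunTensor F A) :
    restr μ (evTotal φ z) = φ (evalAt μ z) := by
  induction z using TensorProduct.induction_on with
  | zero => simp
  | add z z' h h' => rw [map_add, map_add, h, h', map_add, map_add]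
  | tmul a w => rw [evTotal_tmul, restr_baseIncl_mul, restr_groupIncl, evalAt_tmul, map_smul]

theorem restr_opOne (z : FunTensor F (UEnv E G)) (μ : LieDual F) (f : TotalFun F E G) :
    restr μ (opOne z f) = gAct (evalAt μ z) (restr μ f) := by
  induction z using TensorProduct.induction_on with
  | zero => simp
  | add z z' h h' => rw [map_add, LinearMap.add_apply, map_add, h, h', map_add, map_add]; rfl
  | tmul a w =>
    rw [opOne_tmul, restr_baseIncl_mul, restr_leftAction, evalAt_tmul, map_smul]; rfl

theorem opOne_mul (z z' : FunTensor F (UEnv E G)) (f : TotalFun F E G) :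
    opOne (z * z') f = opOne z (opOne z' f) :=
  ext_restr fun μ => by
    rw [restr_opOne, restr_opOne, restr_opOne, map_mul, map_mul, Module.End.mul_apply]

theorem opOne_one (f : TotalFun F E G) : opOne 1 f = f :=
  ext_restr fun μ => by rw [restr_opOne, map_one, map_one]; rfl

theorem opOne_baseIncl (z : FunTensor F (UEnv E G)) (a : BaseFun F) :
    opOne z (baseIncl a) = opOne (onValues (Algebra.ofId ℝ (UEnv E G)) (onValues counit z))
      (baseIncl a) :=
  ext_restr fun μ => by
    rw [restr_opOne, restr_opOne, evalAt_onValues, evalAt_onValues, restr_baseIncl,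
      Algebra.algebraMap_eq_smul_one, map_smul, map_smul, gAct_one, gAct_one, Algebra.ofId_apply, AlgHom.commutes]
    rfl

theorem opTwo_groupIncl (z : FunTensor F (UEnv E G ⊗[ℝ] UEnv E G)) (f g : GroupFun E G) :
    opTwo z (groupIncl f) (groupIncl g) = evTotal (ev₂ f g) z := by
  induction z using TensorProduct.induction_on with
  | zero => simp
  | add z z' h h' => rw [map_add, LinearMap.add_apply, LinearMap.add_apply, h, h', map_add]
  | tmul a w =>
    induction w using TensorProduct.induction_on with
    | zero => simp
    | add w w' h h' =>
      rw [TensorProduct.tmul_add, map_add, LinearMap.add_apply, LinearMap.add_apply, h, h', map_add]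
    | tmul u v =>
      rw [opTwo_tmul, evTotal_tmul, ev₂_tmul, leftAction_groupIncl, leftAction_groupIncl, map_mul]

theorem opOne_groupIncl (z : FunTensor F (UEnv E G)) (f : GroupFun E G) :
    opOne z (groupIncl f) = evTotal (ev₁ f) z :=
  ext_restr fun μ => by rw [restr_opOne, restr_evTotal, restr_groupIncl, ev₁_apply]

theorem HLin.seriesOp (T : PowerSeries (FunTensor F (UEnv E G))) : HLin (seriesOp T) :=
  ⟨fun x y => by ext n : 1; simp [DynStar.seriesOp, Finset.sum_add_distrib], fun x => by
    ext n : 1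
    cases n with
    | zero => simp [DynStar.seriesOp]
    | succ n =>
      rw [PowerSeries.coeff_succ_X_mul, DynStar.seriesOp, DynStar.seriesOp, PowerSeries.coeff_mk,
        PowerSeries.coeff_mk, Finset.Nat.sum_antidiagonal_succ']
      simp [PowerSeries.coeff_succ_X_mul]⟩

theorem coeff_seriesOp_C (T : PowerSeries (FunTensor F (UEnv E G))) (f : TotalFun F E G) (n : ℕ) :
    coeff n (seriesOp T (PowerSeries.C f)) = opOne (coeff n T) f := by
  rw [seriesOp, PowerSeries.coeff_mk, Finset.sum_eq_single (n, 0)]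
  · simp
  · rintro ⟨i, j⟩ h h'
    rw [PowerSeries.coeff_C, if_neg, map_zero]
    rintro rfl
    exact h' (by simpa using h)
  · simp

theorem seriesOp_mul (T T' : PowerSeries (FunTensor F (UEnv E G)))
    (f : PowerSeries (TotalFun F E G)) : seriesOp (T * T') f = seriesOp T (seriesOp T' f) := by
  refine HLin.ext (HLin.seriesOp _) ((HLin.seriesOp _).comp (HLin.seriesOp _)) (fun a => ?_) f
  ext n : 1
  rw [coeff_seriesOp_C, PowerSeries.coeff_mul, map_sum, LinearMap.sum_apply, seriesOp,
    PowerSeries.coeff_mk]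
  exact Finset.sum_congr rfl fun p _ => by rw [coeff_seriesOp_C, opOne_mul]

theorem seriesOp_one (f : PowerSeries (TotalFun F E G)) : seriesOp 1 f = f := by
  refine HLin.ext (HLin.seriesOp _) HLin.id (fun a => ?_) f
  ext n : 1
  rw [coeff_seriesOp_C, id, PowerSeries.coeff_C, PowerSeries.coeff_one]
  split_ifs with h
  · exact opOne_one a
  · rw [map_zero]; rfl

theorem seriesOp_groupIncl (T : PowerSeries (FunTensor F (UEnv E G))) (f : GroupFun E G) :
    seriesOp T (cst (groupIncl f)) = mapCoeff (evTotal (ev₁ f)) T := by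
  ext n : 1
  rw [coeff_seriesOp_C, coeff_mapCoeff, opOne_groupIncl]

/-- Used with `j` the identity for one function, and with `j = Δ` for a product of two. -/
theorem seriesOp_mapCoeff (T : PowerSeries (FunTensor F (UEnv E G))) (φ : A →ₗ[ℝ] GroupFun E G)
    (j : UEnv E G →ₐ[ℝ] A) (h : ∀ u w, gAct u (φ w) = φ (j u * w))
    (Z : PowerSeries (FunTensor F A)) :
    seriesOp T (mapCoeff (evTotal φ) Z) = mapCoeff (evTotal φ) (onSeries j T * Z) := by
  ext n : 1
  rw [seriesOp, PowerSeries.coeff_mk, coeff_mapCoeff, PowerSeries.coeff_mul, map_sum]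
  refine Finset.sum_congr rfl fun p _ => ext_restr fun μ => ?_
  rw [coeff_mapCoeff, coeff_onSeries, restr_opOne, restr_evTotal, restr_evTotal, map_mul,
    evalAt_onValues, h]

theorem seriesOp_baseIncl (T : PowerSeries (FunTensor F (UEnv E G))) (hT : onSeries counit T = 1)
    (a : BaseFun F) : seriesOp T (cst (baseIncl a)) = cst (baseIncl a) := by
  conv_rhs => rw [← seriesOp_one (cst (baseIncl a))]
  ext n : 1
  rw [coeff_seriesOp_C, coeff_seriesOp_C, opOne_baseIncl, ← coeff_onSeries, hT,
    PowerSeries.coeff_one, PowerSeries.coeff_one]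
  split_ifs
  · rw [map_one]
  · rw [map_zero]

theorem seriesOp₂_groupIncl (K : PowerSeries (FunTensor F (UEnv E G ⊗[ℝ] UEnv E G)))
    (f g : GroupFun E G) :
    seriesOp₂ K (groupIncl f) (groupIncl g) = mapCoeff (evTotal (ev₂ f g)) K := by
  ext n : 1
  rw [seriesOp₂, PowerSeries.coeff_mk, coeff_mapCoeff, opTwo_groupIncl]

end EvTotal

/-! ### Multiplication by functions on `𝔥*` -/

section BaseProduct

variable {F : Type*} [NormedAddCommGroup F] [NormedSpace ℝ F] [FiniteDimensional ℝ F]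
  {E : Type*} [NormedAddCommGroup E] [NormedSpace ℝ E] [CompleteSpace E]
  {G : Type*} [TopologicalSpace G] [ChartedSpace E G] [Group G] [LieGroup 𝓘(ℝ, E) ∞ G]
  {H : Type*} [TopologicalSpace H] [ChartedSpace F H] [CommGroup H]
  {κ : Type*} [Fintype κ] (ι : H →* G) (b : Module.Basis κ ℝ F)
  {A A' : Type*} [Ring A] [Algebra ℝ A] [Ring A'] [Algebra ℝ A']

/-- The operator `∑_i ∂/∂λ^i ⊗ h⃗_i`. -/
def mixedOp : Module.End ℝ (FunTensor F (GroupFun E G)) :=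
  ∑ i, TensorProduct.map (baseDeriv (dualVec b i)) (gDeriv (lieIncl ι (b i)))

theorem mixedOp_tmul (a : BaseFun F) (f : GroupFun E G) :
    mixedOp ι b (a ⊗ₜ[ℝ] f) =
      ∑ i, baseDeriv (dualVec b i) a ⊗ₜ[ℝ] gDeriv (lieIncl ι (b i)) f := by
  rw [mixedOp, LinearMap.sum_apply]
  rfl

/-- Associative `ħ`-bilinear products for which functions on `𝔥*` multiply as usual and act from
the left on functions on `G` by `exp (c ħ ∑_i ∂/∂λ^i ⊗ h⃗_i)`. -/
structure IsBaseProduct (c : ℝ) (P : PowerSeries (TotalFun F E G) → PowerSeries (TotalFun F E G) →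
    PowerSeries (TotalFun F E G)) : Prop where
  left : ∀ y, HLin fun x => P x y
  right : ∀ x, HLin (P x)
  assoc : ∀ x y z, P (P x y) z = P x (P y z)
  base : ∀ a a' : BaseFun F, P (cst (baseIncl a)) (cst (baseIncl a')) = cst (baseIncl (a * a'))
  group : ∀ (a : BaseFun F) (f : GroupFun E G), P (cst (baseIncl a)) (cst (groupIncl f)) =
    mapCoeff (evTotal LinearMap.id) (expOp c (mixedOp ι b) (PowerSeries.C (a ⊗ₜ[ℝ] f)))

/-- Left multiplication by `η i` corresponds to the vector field of `h_i`. -/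
def HasWeight (η : κ → A) (φ : A →ₗ[ℝ] GroupFun E G) : Prop :=
  ∀ i w, φ (η i * w) = gDeriv (lieIncl ι (b i)) (φ w)

variable {ι b} {c : ℝ} {P : PowerSeries (TotalFun F E G) → PowerSeries (TotalFun F E G) →
    PowerSeries (TotalFun F E G)} (hP : IsBaseProduct ι b c P)
  {η : κ → A} {φ : A →ₗ[ℝ] GroupFun E G} (hφ : HasWeight ι b η φ)
  (hη : ∀ i j, Commute (η i) (η j))

include hP hφ

/-- Through a map of weight `η`, star multiplication by a function of `λ` becomes the shift along
`η` on the level of tensors. -/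
theorem IsBaseProduct.group_weight (a : BaseFun F) (w : A) :
    P (cst (baseIncl a)) (cst (groupIncl (φ w))) =
      mapCoeff (evTotal φ) (shift b c η (PowerSeries.C (a ⊗ₜ[ℝ] w))) := by
  have h : ∀ z : FunTensor F A, LinearMap.lTensor (BaseFun F) φ (shiftOp b η z) =
      mixedOp ι b (LinearMap.lTensor (BaseFun F) φ z) := fun z => by
    induction z using TensorProduct.induction_on with
    | zero => simp
    | add z z' h h' => rw [map_add, map_add, h, h', map_add, map_add]
    | tmul a w =>
      rw [shiftOp_tmul, map_sum, LinearMap.lTensor_tmul, mixedOp_tmul]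
      exact Finset.sum_congr rfl fun i _ => by rw [LinearMap.lTensor_tmul, hφ]
  have e : evTotal (F := F) φ = evTotal LinearMap.id ∘ₗ LinearMap.lTensor (BaseFun F) φ :=
    TensorProduct.ext' fun _ _ => rfl
  have h2 : mapCoeff (evTotal φ) (shift b c η (PowerSeries.C (a ⊗ₜ[ℝ] w))) =
      mapCoeff (evTotal LinearMap.id) (mapCoeff (LinearMap.lTensor (BaseFun F) φ)
        (expOp c (shiftOp b η) (PowerSeries.C (a ⊗ₜ[ℝ] w)))) := by
    rw [e]; ext n : 1; simp only [coeff_mapCoeff]; rfl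
  rw [hP.group, h2, mapCoeff_expOp c h, mapCoeff_C]
  rfl

omit hP hφ in
-- The series is `a(λ + cħη)`, whose coefficients lie in the double centralizer of the constants `η
-- i`.
theorem commute_shift_baseFun (a : BaseFun F)
    (Y : PowerSeries (FunTensor F A))
    (hY : ∀ n, coeff n Y ∈ centralizing F η) :
    Commute (shift b c η (PowerSeries.C (a ⊗ₜ[ℝ] 1))) Y := by
  let Z : Subalgebra ℝ (FunTensor F A) := Subalgebra.centralizer ℝ (centralizing F η)
  have hZ : ∀ z, z ∈ Z ↔ ∀ y ∈ centralizing F η, y * z = z * y := fun z =>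
    Subalgebra.mem_centralizer_iff ℝ
  have hD : ∀ z ∈ Z, shiftOp b η z ∈ Z := by
    intro z hz
    rw [shiftOp_apply]
    refine Subalgebra.sum_mem _ fun i _ => Subalgebra.mul_mem _ ?_ ?_
    · exact (hZ _).2 fun y hy => (mem_centralizing.1 hy i).eq.symm
    · refine (hZ _).2 fun y hy => ?_
      -- Differentiate `y z = z y`. The derivative of `y` again commutes with the `η i`, hence with
      -- `z`, so what remains is the commutation of `y` with the derivative of `z`.
      have h := congrArg (valDeriv A (dualVec b i)) ((hZ z).1 hz y hy)
      rw [valDeriv_mul, valDeriv_mul, (hZ z).1 hz _ (valDeriv_mem_centralizing _ hy),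
        add_comm] at h
      exact add_right_cancel h
  have hcomm : ∀ y : FunTensor F A, y * (a ⊗ₜ[ℝ] 1) = (a ⊗ₜ[ℝ] 1) * y := fun y => by
    induction y using TensorProduct.induction_on with
    | zero => simp
    | add y y' h h' => rw [add_mul, mul_add, h, h']
    | tmul a' w =>
      rw [Algebra.TensorProduct.tmul_mul_tmul, Algebra.TensorProduct.tmul_mul_tmul, mul_one,
        one_mul, mul_comm]
  have h0 : (a ⊗ₜ[ℝ] (1 : A) : FunTensor F A) ∈ Z := (hZ _).2 fun y _ => hcomm y
  have hn : ∀ n, (shiftOp b η ^ n) (a ⊗ₜ[ℝ] (1 : A)) ∈ Z := fun n => by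
    induction n with
    | zero => exact h0
    | succ n ih => rw [pow_succ', Module.End.mul_apply]; exact hD _ ih
  ext n : 1
  rw [PowerSeries.coeff_mul, PowerSeries.coeff_mul, ← Finset.Nat.sum_antidiagonal_swap]
  refine Finset.sum_congr rfl fun p _ => ?_
  rw [shift_eq_expOp, coeff_expOp_C, coeff_expOp_C]
  exact ((hZ _).1 (Subalgebra.smul_mem _ (hn _) _) _ (hY _)).symm

include hη

/-- After the substitution by the invertible shift, star multiplication by `a` is ordinary
multiplication by `a ⊗ 1` (`key`). Shifting back produces `a(λ + cħη)` on the left, and invariance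
of `Y` lets it pass to the right of `Y`. -/
theorem IsBaseProduct.base_mapCoeff (a : BaseFun F) (Y : PowerSeries (FunTensor F A))
    (hY : ∀ n, coeff n Y ∈ centralizing F η) (w : A) :
    P (cst (baseIncl a)) (mapCoeff (evTotal φ) (Y * PowerSeries.C (constFun w))) =
      mapCoeff (evTotal φ) (Y * shift b c η (PowerSeries.C (a ⊗ₜ[ℝ] w))) := by
  have hbase : ∀ n, coeff n (PowerSeries.C (a ⊗ₜ[ℝ] (1 : A) : FunTensor F A)) ∈
      centralizing F η := fun n => by
    rw [PowerSeries.coeff_C]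
    split_ifs
    · refine mem_centralizing.2 fun i => ?_
      change (1 ⊗ₜ[ℝ] η i) * (a ⊗ₜ[ℝ] 1) = (a ⊗ₜ[ℝ] 1) * (1 ⊗ₜ[ℝ] η i)
      simp
    · exact Subalgebra.zero_mem _
  have key : ∀ V, P (cst (baseIncl a)) (mapCoeff (evTotal φ) (shift b c η V)) =
      mapCoeff (evTotal φ) (shift b c η (PowerSeries.C (a ⊗ₜ[ℝ] 1) * V)) := by
    refine HLin.ext_tensor ((hP.right _).comp ((HLin.mapCoeff _).comp (HLin.shift b c η)))
      ((HLin.mapCoeff _).comp ((HLin.shift b c η).comp (HLin.mul_left _))) fun a' w' => ?_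
    rw [← hP.group_weight hφ, ← hP.assoc, hP.base, hP.group_weight hφ, ← map_mul,
      Algebra.TensorProduct.tmul_mul_tmul, one_mul]
  have h := key (shift b (-c) η (Y * PowerSeries.C (constFun w)))
  rw [shift_neg_cancel, shift_mul b c hη _ _ hbase, shift_neg_cancel, ← mul_assoc,
    (commute_shift_baseFun a Y hY).eq, mul_assoc] at h
  rw [h]
  have e : (PowerSeries.C (a ⊗ₜ[ℝ] w : FunTensor F A)) =
      PowerSeries.C (a ⊗ₜ[ℝ] 1) * PowerSeries.C (constFun w) := by
    rw [← map_mul]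
    change _ = PowerSeries.C ((a ⊗ₜ[ℝ] 1) * (1 ⊗ₜ[ℝ] w))
    rw [Algebra.TensorProduct.tmul_mul_tmul, one_mul, mul_one]
  rw [e, shift_mul b c hη _ _ hbase, shift_C_constFun]

/-- The central computation. Write the first argument as a series of products `a ⋆ φ(w)`, at the
price of the inverse shift along `η`. Associativity moves `a` outside the product with `k`, where it
acts by the shift along `η' = ζ + j(η)`. The `j(η)` part cancels the inverse shift, so only the
shift along the new slots `ζ` survives. -/
theorem IsBaseProduct.mapCoeff_left {η' : κ → A'} {φ' : A' →ₗ[ℝ] GroupFun E G}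
    (hφ' : HasWeight ι b η' φ') (hη' : ∀ i j, Commute (η' i) (η' j)) (j : A →ₐ[ℝ] A') (ζ : κ → A')
    (hζ : ∀ i, η' i = ζ i + j (η i)) (hζ' : ∀ i i', Commute (ζ i) (j (η i')))
    (Y : PowerSeries (FunTensor F A')) (hY : ∀ n, coeff n Y ∈ centralizing F η')
    (k : PowerSeries (TotalFun F E G))
    (hk : ∀ w, P (cst (groupIncl (φ w))) k =
      mapCoeff (evTotal φ') (Y * PowerSeries.C (constFun (j w))))
    (Z : PowerSeries (FunTensor F A)) :
    P (mapCoeff (evTotal φ) Z) k = mapCoeff (evTotal φ') (Y * shift b c ζ (onSeries j Z)) := by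
  have key : ∀ Z', P (mapCoeff (evTotal φ) (shift b c η Z')) k =
      mapCoeff (evTotal φ') (Y * shift b c η' (onSeries j Z')) := by
    refine HLin.ext_tensor ((hP.left k).comp ((HLin.mapCoeff _).comp (HLin.shift b c η)))
      ((HLin.mapCoeff _).comp ((HLin.mul_left Y).comp ((HLin.shift b c η').comp
        (HLin.onSeries j)))) fun a w => ?_
    rw [← hP.group_weight hφ, hP.assoc, hk, hP.base_mapCoeff hφ' hη' a Y hY, onSeries_C,
      onValues_tmul]
  have h := key (shift b (-c) η Z)
  rw [shift_neg_cancel, onSeries_shift, show η' = fun i => ζ i + j (η i) from funext hζ,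
    shift_add b c ζ _ hζ', shift_neg_cancel] at h
  exact h

end BaseProduct

/-! ### Differential operators -/

section DiffOp

variable {C : Type*} [CommRing C] [Algebra ℝ C]

theorem isDiffOp_zero (n : ℕ) : IsDiffOp n (0 : Module.End ℝ C) := by
  induction n with
  | zero => intro f g; simp
  | succ n ih => intro f; rwa [zero_mul, mul_zero, sub_zero]

theorem IsDiffOp.add {n : ℕ} {D D' : Module.End ℝ C} (h : IsDiffOp n D) (h' : IsDiffOp n D') :
    IsDiffOp n (D + D') := by
  induction n generalizing D D' with
  | zero => intro f g; rw [LinearMap.add_apply, LinearMap.add_apply, h, h', mul_add]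
  | succ n ih =>
    intro f
    rw [add_mul, mul_add, add_sub_add_comm]
    exact ih (h f) (h' f)

theorem IsDiffOp.smul {n : ℕ} {D : Module.End ℝ C} (h : IsDiffOp n D) (c : ℝ) :
    IsDiffOp n (c • D) := by
  induction n generalizing D with
  | zero => intro f g; rw [LinearMap.smul_apply, LinearMap.smul_apply, h, mul_smul_comm]
  | succ n ih =>
    intro f
    have e : c • D * LinearMap.mulLeft ℝ f - LinearMap.mulLeft ℝ f * (c • D) =
        c • (D * LinearMap.mulLeft ℝ f - LinearMap.mulLeft ℝ f * D) := by
      rw [smul_mul_assoc, mul_smul_comm, smul_sub]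
    rw [e]
    exact ih (h f)

theorem IsDiffOp.commutator_eq_zero {D : Module.End ℝ C} (h : IsDiffOp 0 D) (f : C) :
    D * LinearMap.mulLeft ℝ f - LinearMap.mulLeft ℝ f * D = 0 :=
  LinearMap.ext fun g => sub_eq_zero.2 (h f g)

theorem IsDiffOp.succ {n : ℕ} {D : Module.End ℝ C} (h : IsDiffOp n D) : IsDiffOp (n + 1) D := by
  induction n generalizing D with
  | zero => intro f; rw [h.commutator_eq_zero]; exact isDiffOp_zero 0
  | succ n ih => exact fun f => ih (h f)

theorem IsDiffOp.mono {n m : ℕ} {D : Module.End ℝ C} (h : IsDiffOp n D) (hnm : n ≤ m) :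
    IsDiffOp m D :=
  Nat.le_induction h (fun _ _ h => h.succ) m hnm

theorem IsDiffOp.mul {n m : ℕ} {D D' : Module.End ℝ C} (h : IsDiffOp n D) (h' : IsDiffOp m D') :
    IsDiffOp (n + m) (D * D') := by
  -- Induction on a bound for the total order, since the commutator of a product lowers the order of
  -- one factor or the other.
  suffices H : ∀ (k n m : ℕ) (D D' : Module.End ℝ C), n + m ≤ k → IsDiffOp n D → IsDiffOp m D' →
      IsDiffOp k (D * D') from H _ n m D D' le_rfl h h'
  intro k
  induction k with
  | zero =>
    intro n m D D' hk h h'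
    obtain ⟨rfl, rfl⟩ : n = 0 ∧ m = 0 := by omega
    intro f g
    rw [Module.End.mul_apply, Module.End.mul_apply, h' f g, h f]
  | succ k ih =>
    intro n m D D' hk h h' f
    have e : D * D' * LinearMap.mulLeft ℝ f - LinearMap.mulLeft ℝ f * (D * D') =
        D * (D' * LinearMap.mulLeft ℝ f - LinearMap.mulLeft ℝ f * D') +
          (D * LinearMap.mulLeft ℝ f - LinearMap.mulLeft ℝ f * D) * D' := by
      rw [mul_sub, sub_mul, mul_assoc, mul_assoc, mul_assoc]
      abel
    rw [e]
    refine IsDiffOp.add ?_ ?_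
    · cases m with
      | zero => rw [h'.commutator_eq_zero, mul_zero]; exact isDiffOp_zero k
      | succ m => exact ih n m _ _ (by omega) h (h' f)
    · cases n with
      | zero => rw [h.commutator_eq_zero, zero_mul]; exact isDiffOp_zero k
      | succ n => exact ih n m _ _ (by omega) (h f) h'

theorem isDiffOp_mulLeft (f : C) : IsDiffOp 0 (LinearMap.mulLeft ℝ f) := fun g k => by
  simp only [LinearMap.mulLeft_apply]; ring

theorem isDiffOp_of_leibniz (D : Module.End ℝ C) (h : ∀ f g, D (f * g) = D f * g + f * D g) :
    IsDiffOp 1 D := fun f => by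
  have e : D * LinearMap.mulLeft ℝ f - LinearMap.mulLeft ℝ f * D = LinearMap.mulLeft ℝ (D f) :=
    LinearMap.ext fun g => by
      simp only [LinearMap.sub_apply, Module.End.mul_apply, LinearMap.mulLeft_apply, h]; ring
  rw [e]
  exact isDiffOp_mulLeft _

/-- Differential operators of some finite order. -/
def HasFiniteOrder (D : Module.End ℝ C) : Prop := ∃ n, IsDiffOp n D

theorem HasFiniteOrder.add {D D' : Module.End ℝ C} (h : HasFiniteOrder D) (h' : HasFiniteOrder D') :
    HasFiniteOrder (D + D') := by
  obtain ⟨⟨n, h⟩, ⟨m, h'⟩⟩ := h, h'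
  exact ⟨max n m, (h.mono (le_max_left n m)).add (h'.mono (le_max_right n m))⟩

theorem HasFiniteOrder.mul {D D' : Module.End ℝ C} (h : HasFiniteOrder D) (h' : HasFiniteOrder D') :
    HasFiniteOrder (D * D') := by
  obtain ⟨⟨n, h⟩, ⟨m, h'⟩⟩ := h, h'
  exact ⟨n + m, h.mul h'⟩

theorem IsBidiffOp.add {B B' : C →ₗ[ℝ] C →ₗ[ℝ] C} (h : IsBidiffOp B) (h' : IsBidiffOp B') :
    IsBidiffOp (B + B') := by
  obtain ⟨⟨n, h⟩, ⟨m, h'⟩⟩ := h, h'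
  exact ⟨max n m, fun g =>
    ⟨((h g).1.mono (le_max_left n m)).add ((h' g).1.mono (le_max_right n m)),
      ((h g).2.mono (le_max_left n m)).add ((h' g).2.mono (le_max_right n m))⟩⟩

theorem isBidiffOp_sum {α : Type*} (s : Finset α) (B : α → C →ₗ[ℝ] C →ₗ[ℝ] C)
    (h : ∀ a ∈ s, IsBidiffOp (B a)) : IsBidiffOp (∑ a ∈ s, B a) :=
  Finset.sum_induction B IsBidiffOp (fun _ _ => IsBidiffOp.add)
    ⟨0, fun _ => ⟨isDiffOp_zero 0, isDiffOp_zero 0⟩⟩ h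

theorem IsBidiffOp.comp {B : C →ₗ[ℝ] C →ₗ[ℝ] C} (h : IsBidiffOp B) {D D' D'' : Module.End ℝ C}
    (hD : HasFiniteOrder D) (hD' : HasFiniteOrder D') (hD'' : HasFiniteOrder D'') :
    IsBidiffOp ((B.compl₁₂ D D').compr₂ D'') := by
  obtain ⟨n, h⟩ := h
  obtain ⟨⟨m, hD⟩, ⟨m', hD'⟩, ⟨m'', hD''⟩⟩ := hD, hD', hD''
  refine ⟨m'' + (n + max m m'), fun g => ⟨?_, ?_⟩⟩
  · exact hD''.mul ((h (D g)).1.mul (hD'.mono (le_max_right m m')))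
  · exact hD''.mul ((h (D' g)).2.mul (hD.mono (le_max_left m m')))

end DiffOp

/-! ### Formal bilinear operators -/

section BilinSeries

variable {C : Type*} [CommRing C] [Algebra ℝ C] (B : ℕ → C →ₗ[ℝ] C →ₗ[ℝ] C)

/-- The `ħ`-bilinear extension of `∑_n ħ^n B_n`. -/
def bilinSeries (f g : PowerSeries C) : PowerSeries C :=
  PowerSeries.mk fun n => ∑ p ∈ Finset.HasAntidiagonal.antidiagonal n,
    ∑ q ∈ Finset.HasAntidiagonal.antidiagonal p.2, B p.1 (coeff q.1 f) (coeff q.2 g)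

theorem HLin.bilinSeries_left (g : PowerSeries C) : HLin fun f => bilinSeries B f g :=
  ⟨fun x y => by ext n : 1; simp [bilinSeries, Finset.sum_add_distrib], fun x => by
    ext n : 1
    cases n with
    | zero => simp [bilinSeries]
    | succ n =>
      rw [PowerSeries.coeff_succ_X_mul, bilinSeries, bilinSeries, PowerSeries.coeff_mk,
        PowerSeries.coeff_mk, Finset.Nat.sum_antidiagonal_succ']
      simp [Finset.Nat.sum_antidiagonal_succ, PowerSeries.coeff_succ_X_mul]⟩

theorem HLin.bilinSeries_right (f : PowerSeries C) : HLin (bilinSeries B f) :=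
  ⟨fun x y => by ext n : 1; simp [bilinSeries, Finset.sum_add_distrib], fun x => by
    ext n : 1
    cases n with
    | zero => simp [bilinSeries]
    | succ n =>
      rw [PowerSeries.coeff_succ_X_mul, bilinSeries, bilinSeries, PowerSeries.coeff_mk,
        PowerSeries.coeff_mk, Finset.Nat.sum_antidiagonal_succ']
      simp [Finset.Nat.sum_antidiagonal_succ', PowerSeries.coeff_succ_X_mul]⟩

theorem coeff_bilinSeries_C (f g : C) (n : ℕ) :
    coeff n (bilinSeries B (PowerSeries.C f) (PowerSeries.C g)) = B n f g := by
  rw [bilinSeries, PowerSeries.coeff_mk, Finset.sum_eq_single (n, 0)]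
  · simp
  · rintro ⟨i, j⟩ h h'
    refine Finset.sum_eq_zero fun q hq => ?_
    have h := Finset.HasAntidiagonal.mem_antidiagonal.1 h
    have hq := Finset.HasAntidiagonal.mem_antidiagonal.1 hq
    rw [PowerSeries.coeff_C, PowerSeries.coeff_C]
    split_ifs with h1 h2
    · exact absurd (Prod.ext (by dsimp at *; omega) (by dsimp at *; omega)) h'
    · simp
    · simp
    · simp
  · simp

/-- An `ħ`-bilinear product is determined by its values on constant series; this identifies the
conjugate with the series of its cochains. -/
theorem eq_bilinSeries {S : PowerSeries C → PowerSeries C → PowerSeries C}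
    (hl : ∀ g, HLin fun f => S f g) (hr : ∀ f, HLin (S f))
    (h : ∀ f g n, coeff n (S (PowerSeries.C f) (PowerSeries.C g)) = B n f g)
    (f g : PowerSeries C) : S f g = bilinSeries B f g :=
  HLin.ext (hl g) (HLin.bilinSeries_left B g) (fun a =>
    HLin.ext (hr _) (HLin.bilinSeries_right B _) (fun c => by
      ext n : 1
      rw [h, coeff_bilinSeries_C]) g) f

end BilinSeries

/-! ### Conjugation of star products -/

section Conjugate

variable {F : Type*} [NormedAddCommGroup F] [NormedSpace ℝ F]
  {E : Type*} [NormedAddCommGroup E] [NormedSpace ℝ E] [CompleteSpace E]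
  {G : Type*} [TopologicalSpace G] [ChartedSpace E G] [Group G] [LieGroup 𝓘(ℝ, E) ∞ G]

theorem leftDeriv_mul (X : LieAlg E G) (f g : TotalFun F E G) :
    leftDeriv X (f * g) = leftDeriv X f * g + f * leftDeriv X g :=
  ext_restr fun μ => by
    simp only [map_add, map_mul, restr_leftDeriv, gDeriv_mul]

theorem hasFiniteOrder_leftAction (u : UEnv E G) :
    HasFiniteOrder (leftAction u : Module.End ℝ (TotalFun F E G)) := by
  induction u using uEnv_induction with
  | one => rw [map_one]; exact ⟨0, fun f g => rfl⟩
  | smul c u h =>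
    obtain ⟨n, h⟩ := h
    rw [map_smul]; exact ⟨n, h.smul c⟩
  | add u v hu hv => rw [map_add]; exact hu.add hv
  | mul X u h =>
    rw [map_mul]
    refine HasFiniteOrder.mul ⟨1, ?_⟩ h
    rw [leftAction_toU]
    exact isDiffOp_of_leibniz _ (leftDeriv_mul X)

theorem hasFiniteOrder_opOne (z : FunTensor F (UEnv E G)) : HasFiniteOrder (opOne z) := by
  induction z using TensorProduct.induction_on with
  | zero => rw [map_zero]; exact ⟨0, isDiffOp_zero 0⟩
  | add z z' h h' => rw [map_add]; exact h.add h'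
  | tmul a u => exact HasFiniteOrder.mul ⟨0, isDiffOp_mulLeft _⟩ (hasFiniteOrder_leftAction u)

theorem seriesOp_inv₁_self {T : PowerSeries (FunTensor F (UEnv E G))} (h : constantCoeff T = 1)
    (f : PowerSeries (TotalFun F E G)) : seriesOp (inv₁ T) (seriesOp T f) = f := by
  rw [← seriesOp_mul, inv₁_mul T h, seriesOp_one]

theorem seriesOp_self_inv₁ {T : PowerSeries (FunTensor F (UEnv E G))} (h : constantCoeff T = 1)
    (f : PowerSeries (TotalFun F E G)) : seriesOp T (seriesOp (inv₁ T) f) = f := by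
  rw [← seriesOp_mul, mul_inv₁ T h, seriesOp_one]

theorem constantCoeff_inv₁ {A : Type*} [Ring A] (T : PowerSeries A) (h : constantCoeff T = 1) :
    constantCoeff (inv₁ T) = 1 := by
  have := congrArg constantCoeff (mul_inv₁ T h)
  rwa [map_mul, h, one_mul, map_one] at this

theorem onSeries_inv₁ {A A' : Type*} [Ring A] [Algebra ℝ A] [Ring A'] [Algebra ℝ A']
    (φ : A →ₐ[ℝ] A') {T : PowerSeries (FunTensor F A)} (h : constantCoeff T = 1)
    (hT : onSeries φ T = 1) : onSeries φ (inv₁ T) = 1 := by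
  have := congrArg (onSeries φ) (mul_inv₁ T h)
  rwa [map_mul, hT, one_mul, map_one] at this

theorem IsStarProduct.exists_bilinSeries {bracket : TotalFun F E G → TotalFun F E G → TotalFun F E G}
    {S : PowerSeries (TotalFun F E G) → PowerSeries (TotalFun F E G) →
      PowerSeries (TotalFun F E G)} (hS : IsStarProduct bracket S) :
    ∃ B : ℕ → TotalFun F E G →ₗ[ℝ] TotalFun F E G →ₗ[ℝ] TotalFun F E G,
      (∀ k, IsBidiffOp (B k)) ∧ (∀ f g, B 0 f g = f * g) ∧
      (∀ f g, B 1 f g - B 1 g f = bracket f g) ∧ S = bilinSeries B := by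
  obtain ⟨B, h1, h2, h3, h4⟩ := hS.cochains
  exact ⟨B, h1, h2, h3, funext fun f => funext fun g => PowerSeries.ext fun n => by
    rw [h4, bilinSeries, PowerSeries.coeff_mk]⟩

theorem IsStarProduct.hlin_left {bracket : TotalFun F E G → TotalFun F E G → TotalFun F E G}
    {S : PowerSeries (TotalFun F E G) → PowerSeries (TotalFun F E G) →
      PowerSeries (TotalFun F E G)} (hS : IsStarProduct bracket S) (g : PowerSeries (TotalFun F E G)) :
    HLin fun f => S f g := by
  obtain ⟨B, -, -, -, rfl⟩ := hS.exists_bilinSeries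
  exact HLin.bilinSeries_left B g

theorem IsStarProduct.hlin_right {bracket : TotalFun F E G → TotalFun F E G → TotalFun F E G}
    {S : PowerSeries (TotalFun F E G) → PowerSeries (TotalFun F E G) →
      PowerSeries (TotalFun F E G)} (hS : IsStarProduct bracket S) (f : PowerSeries (TotalFun F E G)) :
    HLin (S f) := by
  obtain ⟨B, -, -, -, rfl⟩ := hS.exists_bilinSeries
  exact HLin.bilinSeries_right B f

theorem seriesOp_one_fun {T : PowerSeries (FunTensor F (UEnv E G))} (hT : onSeries counit T = 1) :
    seriesOp T 1 = 1 := by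
  have := seriesOp_baseIncl T hT 1
  rwa [map_one, cst, map_one] at this

/-- The coefficients of the conjugate of `∑_n ħ^n B_n` by `∑_n ħ^n T_n`, with inverse
`∑_n ħ^n R_n`. -/
def conjCochain (T R : PowerSeries (FunTensor F (UEnv E G)))
    (B : ℕ → TotalFun F E G →ₗ[ℝ] TotalFun F E G →ₗ[ℝ] TotalFun F E G) (n : ℕ) :
    TotalFun F E G →ₗ[ℝ] TotalFun F E G →ₗ[ℝ] TotalFun F E G :=
  ∑ s ∈ Finset.HasAntidiagonal.antidiagonal n, ∑ p ∈ Finset.HasAntidiagonal.antidiagonal s.2,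
    ∑ q ∈ Finset.HasAntidiagonal.antidiagonal p.2,
      ((B p.1).compl₁₂ (opOne (coeff q.1 T)) (opOne (coeff q.2 T))).compr₂ (opOne (coeff s.1 R))

theorem conjCochain_apply (T R : PowerSeries (FunTensor F (UEnv E G)))
    (B : ℕ → TotalFun F E G →ₗ[ℝ] TotalFun F E G →ₗ[ℝ] TotalFun F E G) (n : ℕ)
    (f g : TotalFun F E G) :
    conjCochain T R B n f g = coeff n (seriesOp R (bilinSeries B (seriesOp T (PowerSeries.C f))
      (seriesOp T (PowerSeries.C g)))) := by
  rw [seriesOp, PowerSeries.coeff_mk, conjCochain]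
  simp only [LinearMap.sum_apply, bilinSeries, PowerSeries.coeff_mk, map_sum, coeff_seriesOp_C]
  rfl

theorem IsStarProduct.conjugate {bracket : TotalFun F E G → TotalFun F E G → TotalFun F E G}
    {S : PowerSeries (TotalFun F E G) → PowerSeries (TotalFun F E G) →
      PowerSeries (TotalFun F E G)} (hS : IsStarProduct bracket S)
    {T : PowerSeries (FunTensor F (UEnv E G))} (h1 : constantCoeff T = 1)
    (hT : onSeries counit T = 1) : IsStarProduct bracket (conjugate T S) where
  cochains := by
    obtain ⟨B, hB, hB0, hB1, rfl⟩ := hS.exists_bilinSeries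
    have hT0 : coeff 0 T = 1 := by rwa [PowerSeries.coeff_zero_eq_constantCoeff_apply]
    have hR0 : coeff 0 (inv₁ T) = 1 := by
      rw [PowerSeries.coeff_zero_eq_constantCoeff_apply, constantCoeff_inv₁ T h1]
    refine ⟨conjCochain T (inv₁ T) B, fun n => ?_, fun f g => ?_, fun f g => ?_, fun f g n => ?_⟩
    · refine isBidiffOp_sum _ _ fun s _ => isBidiffOp_sum _ _ fun p _ => isBidiffOp_sum _ _ fun q _ => ?_
      exact (hB _).comp (hasFiniteOrder_opOne _) (hasFiniteOrder_opOne _) (hasFiniteOrder_opOne _)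
    · simp [conjCochain, hT0, hR0, opOne_one, hB0]
    -- The new first-order cochain adds `T₁f · g + f · T₁g + R₁(fg)`, where `T₁` and `R₁` are the
    -- `ħ`-coefficients of `T` and its inverse. This is symmetric and drops out of the
    -- antisymmetrization.
    · rw [← hB1]
      simp only [conjCochain, Finset.Nat.sum_antidiagonal_eq_sum_range_succ_mk,
        Finset.sum_range_succ, Finset.sum_range_zero, zero_add, LinearMap.add_apply,
        LinearMap.compr₂_apply, LinearMap.compl₁₂_apply, Nat.sub_self, Nat.sub_zero, hT0, hR0,
        opOne_one, hB0]
      ring_nf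
    · have h := eq_bilinSeries (conjCochain T (inv₁ T) B)
        (S := DynStar.conjugate T (bilinSeries B))
        (fun g => (HLin.seriesOp _).comp ((HLin.bilinSeries_left B _).comp (HLin.seriesOp T)))
        (fun f => (HLin.seriesOp _).comp ((HLin.bilinSeries_right B _).comp (HLin.seriesOp T)))
        (fun f g n => (conjCochain_apply T (inv₁ T) B n f g).symm) f g
      rw [h, bilinSeries, PowerSeries.coeff_mk]
  assoc f g h := by
    simp only [DynStar.conjugate, seriesOp_self_inv₁ h1, hS.assoc]
  one_left f := by
    rw [DynStar.conjugate, seriesOp_one_fun hT, hS.one_left, seriesOp_inv₁_self h1]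
  one_right f := by
    rw [DynStar.conjugate, seriesOp_one_fun hT, hS.one_right, seriesOp_inv₁_self h1]

end Conjugate

/-! ### Invariance under translations -/

section Translations

variable {F : Type*} [NormedAddCommGroup F] [NormedSpace ℝ F]
  {E : Type*} [NormedAddCommGroup E] [NormedSpace ℝ E] [CompleteSpace E]
  {G : Type*} [TopologicalSpace G] [ChartedSpace E G] [Group G] [LieGroup 𝓘(ℝ, E) ∞ G]
  {H : Type*} [TopologicalSpace H] [ChartedSpace F H] [CommGroup H]
  {ι : H →* G}

theorem seriesOp_map (T : PowerSeries (FunTensor F (UEnv E G)))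
    (τ : TotalFun F E G →ₐ[ℝ] TotalFun F E G)
    (h : ∀ n f, opOne (coeff n T) (τ f) = τ (opOne (coeff n T) f))
    (f : PowerSeries (TotalFun F E G)) :
    seriesOp T (PowerSeries.map τ.toRingHom f) = PowerSeries.map τ.toRingHom (seriesOp T f) := by
  ext n : 1
  rw [PowerSeries.coeff_map, seriesOp, seriesOp, PowerSeries.coeff_mk, PowerSeries.coeff_mk,
    map_sum]
  exact Finset.sum_congr rfl fun p _ => by rw [PowerSeries.coeff_map]; exact h _ _

theorem opOne_leftTranslate (z : FunTensor F (UEnv E G)) (a : G) (f : TotalFun F E G) :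
    opOne z (leftTranslate a f) = leftTranslate a (opOne z f) :=
  ext_restr fun μ => by
    rw [restr_opOne, restr_leftTranslate, restr_leftTranslate, restr_opOne, gAct_gLeft]

theorem opOne_rightTranslate [ConnectedSpace H] [LieGroup 𝓘(ℝ, F) ∞ H]
    (hι : ContMDiff 𝓘(ℝ, F) 𝓘(ℝ, E) ∞ ι) (z : FunTensor F (UEnv E G))
    (hz : ∀ h : F, Commute (constFun (toU (lieIncl ι h))) z) (s : H) (f : TotalFun F E G) :
    opOne z (rightTranslate (ι s) f) = rightTranslate (ι s) (opOne z f) :=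
  ext_restr fun μ => by
    rw [restr_opOne, restr_rightTranslate, restr_rightTranslate, restr_opOne,
      gAct_gRight hι _ fun h => ?_]
    have := (hz h).map (evalAt μ)
    rwa [evalAt_constFun] at this

theorem commute_C_iff {A : Type*} [Ring A] (a : A) (T : PowerSeries A) :
    Commute (PowerSeries.C a) T ↔ ∀ n, Commute a (coeff n T) := by
  refine ⟨fun h n => ?_, fun h => PowerSeries.ext fun n => ?_⟩
  · have := congrArg (coeff n) h.eq
    rwa [PowerSeries.coeff_C_mul, PowerSeries.coeff_mul_C] at this
  · rw [PowerSeries.coeff_C_mul, PowerSeries.coeff_mul_C, (h n).eq]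

theorem commute_inv₁ {A : Type*} [Ring A] {T : PowerSeries A} (h : constantCoeff T = 1)
    {x : PowerSeries A} (hx : Commute x T) : Commute x (inv₁ T) := by
  have e : inv₁ T * (T * x) * inv₁ T = inv₁ T * (x * T) * inv₁ T := by rw [hx.eq]
  rw [← mul_assoc, inv₁_mul T h, one_mul, mul_assoc, mul_assoc, mul_inv₁ T h, mul_one] at e
  exact e

theorem IsGauge.inv {T : PowerSeries (FunTensor F (UEnv E G))} (hT : IsGauge ι T) :
    IsGauge ι (inv₁ T) :=
  ⟨constantCoeff_inv₁ T hT.constant_term,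
    fun h => (commute_C_iff _ _).1 (commute_inv₁ hT.constant_term
      ((commute_C_iff _ _).2 (hT.invariant h))),
    onSeries_inv₁ _ hT.constant_term hT.counit⟩

end Translations

/-! ### Weights -/

section Weights

variable {F : Type*} [NormedAddCommGroup F] [NormedSpace ℝ F] [FiniteDimensional ℝ F]
  {E : Type*} [NormedAddCommGroup E] [NormedSpace ℝ E] [FiniteDimensional ℝ E] [CompleteSpace E]
  {G : Type*} [TopologicalSpace G] [T2Space G] [ChartedSpace E G] [Group G]
  [LieGroup 𝓘(ℝ, E) ∞ G]
  {H : Type*} [TopologicalSpace H] [ChartedSpace F H] [CommGroup H]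
  {κ : Type*} [Fintype κ] {ι : H →* G} {b : Module.Basis κ ℝ F}
  {A A' : Type*} [Ring A] [Algebra ℝ A] [Ring A'] [Algebra ℝ A']

theorem hasWeight_ev₁ (f : GroupFun E G) : HasWeight ι b (hU ι b) (ev₁ f) :=
  fun _ w => ev₁_toU_mul _ f w

theorem hasWeight_ev₂ (f g : GroupFun E G) :
    HasWeight ι b (fun i => comul (hU ι b i)) (ev₂ f g) := fun i w => by
  rw [← ev₂_primitive_mul, ← comul_toU]
  rfl

theorem comulLeft_comul_toU (X : LieAlg E G) :
    comulLeft (comul (toU X)) = slot1 (toU X) + slot2 (toU X) + slot3 (toU X) := by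
  rw [comul_toU, map_add]
  change Algebra.TensorProduct.assoc ℝ ℝ ℝ _ _ _ (comul (toU X) ⊗ₜ[ℝ] 1) +
    Algebra.TensorProduct.assoc ℝ ℝ ℝ _ _ _ (comul 1 ⊗ₜ[ℝ] toU X) = _
  rw [comul_toU, map_one, TensorProduct.add_tmul, map_add]
  rfl

theorem comulRight_comul_toU (X : LieAlg E G) :
    comulRight (comul (toU X)) = slot1 (toU X) + slot2 (toU X) + slot3 (toU X) := by
  rw [comul_toU, map_add]
  change toU X ⊗ₜ[ℝ] comul 1 + 1 ⊗ₜ[ℝ] comul (toU X) = _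
  rw [comul_toU, map_one, TensorProduct.tmul_add, ← add_assoc]
  rfl

theorem hasWeight_ev₃ (f g k : GroupFun E G) :
    HasWeight ι b (fun i => comulLeft (comul (hU ι b i))) (ev₃ f g k) := fun i w => by
  rw [← ev₃_primitive_mul, ← comulLeft_comul_toU]
  rfl

/-- The operator `h' ⊗ 1` is invariant under right translations since `H` is commutative, so it
commutes with `Δ(h)`; applying `id ⊗ ε` leaves the commutation of `h` with `h'`. -/
theorem commute_toU_lieIncl [LieGroup 𝓘(ℝ, F) ∞ H] (hι : ContMDiff 𝓘(ℝ, F) 𝓘(ℝ, E) ∞ ι)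
    (h h' : F) : Commute (toU (lieIncl ι h) : UEnv E G) (toU (lieIncl ι h')) := by
  have key := commute_of_ev₂_invariant hι (toU (lieIncl ι h') ⊗ₜ[ℝ] (1 : UEnv E G))
    (fun s f g => by
      rw [ev₂_tmul, ev₂_tmul, gAct_toU, gDeriv_gRight hι, map_mul, map_one]; rfl) h
  have := key.map (counitRight (E := E) (G := G))
  have e : ∀ u v : UEnv E G, counitRight (u ⊗ₜ[ℝ] v) = counit v • u := fun u v => rfl
  rwa [map_add, e, e, e, map_one, counit_toU, one_smul, zero_smul, add_zero, one_smul] at this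

theorem commute_onValues (j : A →ₐ[ℝ] A') (v : A') (hv : ∀ w, Commute v (j w))
    (z : FunTensor F A) : Commute (constFun v) (onValues j z) := by
  induction z using TensorProduct.induction_on with
  | zero => rw [map_zero]; exact Commute.zero_right _
  | add z z' h h' => rw [map_add]; exact h.add_right h'
  | tmul a w =>
    rw [onValues_tmul]
    change (1 ⊗ₜ[ℝ] v) * (a ⊗ₜ[ℝ] j w) = (a ⊗ₜ[ℝ] j w) * (1 ⊗ₜ[ℝ] v)
    rw [Algebra.TensorProduct.tmul_mul_tmul, Algebra.TensorProduct.tmul_mul_tmul, one_mul, mul_one,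
      (hv w).eq]

theorem onSeries_id (x : PowerSeries (FunTensor F A)) : onSeries (AlgHom.id ℝ A) x = x := by
  ext n : 1
  rw [coeff_onSeries]
  exact ext_evalAt fun μ => by rw [evalAt_onValues]; rfl

theorem mapCoeff_evTotal_eq {φ : A →ₗ[ℝ] GroupFun E G} {φ' : A' →ₗ[ℝ] GroupFun E G}
    (j : A →ₐ[ℝ] A') (w : A') (h : ∀ v, φ v = φ' (j v * w)) (Y : PowerSeries (FunTensor F A)) :
    mapCoeff (evTotal φ) Y =
      mapCoeff (evTotal φ') (onSeries j Y * PowerSeries.C (constFun w)) := by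
  ext n : 1
  rw [coeff_mapCoeff, coeff_mapCoeff, PowerSeries.coeff_mul_C, coeff_onSeries]
  refine ext_restr fun μ => ?_
  rw [restr_evTotal, restr_evTotal, map_mul, evalAt_onValues, evalAt_constFun, h]

theorem eq_of_evTotal {I : Type*} (φ : I → A →ₗ[ℝ] GroupFun E G)
    (hφ : ∀ w, (∀ i, φ i w 1 = 0) → w = 0) {z z' : FunTensor F A}
    (h : ∀ i, evTotal (φ i) z = evTotal (φ i) z') : z = z' := by
  refine ext_evalAt fun μ => sub_eq_zero.1 (hφ _ fun i => ?_)
  rw [map_sub, ← restr_evTotal, ← restr_evTotal, h, sub_self]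
  rfl

theorem eq_of_mapCoeff_evTotal {I : Type*} (φ : I → A →ₗ[ℝ] GroupFun E G)
    (hφ : ∀ w, (∀ i, φ i w 1 = 0) → w = 0) {Z Z' : PowerSeries (FunTensor F A)}
    (h : ∀ i, mapCoeff (evTotal (φ i)) Z = mapCoeff (evTotal (φ i)) Z') : Z = Z' := by
  ext n : 1
  refine eq_of_evTotal φ hφ fun i => ?_
  rw [← coeff_mapCoeff, h, coeff_mapCoeff]

end Weights

/-! ### Products of functions on `𝔥*` and functions on `G` -/

section Theta

variable {F : Type*} [NormedAddCommGroup F] [NormedSpace ℝ F] [FiniteDimensional ℝ F]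
  {E : Type*} [NormedAddCommGroup E] [NormedSpace ℝ E] [CompleteSpace E]
  {G : Type*} [TopologicalSpace G] [ChartedSpace E G] [Group G] [LieGroup 𝓘(ℝ, E) ∞ G]
  {H : Type*} [TopologicalSpace H] [ChartedSpace F H] [CommGroup H]
  {κ : Type*} [Fintype κ] {ι : H →* G} {b : Module.Basis κ ℝ F}

theorem leftDeriv_groupIncl (X : LieAlg E G) (f : GroupFun E G) :
    leftDeriv X (groupIncl f : TotalFun F E G) = groupIncl (gDeriv X f) := by
  rw [← leftAction_toU, leftAction_groupIncl, gAct_toU]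

/-- Common part of the two mixed products. On a function of `λ` and a function on `G` one half of
`θ` vanishes, because `h⃗_i` kills the former and `∂_i` the latter; the other half is `∓½` times
`mixedOp`. -/
theorem Theta_eq (c : ℝ)
    (j : FunTensor F (GroupFun E G) →ₗ[ℝ] TotalFun F E G ⊗[ℝ] TotalFun F E G)
    (hj : j ∘ₗ (c • mixedOp ι b) = theta ι b ∘ₗ j)
    (hm : LinearMap.mul' ℝ (TotalFun F E G) ∘ₗ j = evTotal LinearMap.id)
    (x y : TotalFun F E G) (z : FunTensor F (GroupFun E G)) (hz : j z = x ⊗ₜ[ℝ] y) :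
    Theta ι b x y = mapCoeff (evTotal LinearMap.id) (expOp c (mixedOp ι b) (PowerSeries.C z)) := by
  ext n : 1
  rw [coeff_mapCoeff, coeff_expOp_C, Theta, PowerSeries.coeff_mk, ← hz, ← pow_intertwine (LinearMap.congr_fun hj),
    ← LinearMap.comp_apply, hm, smul_pow, LinearMap.smul_apply, map_smul, map_smul, smul_smul]
  congr 1
  ring

theorem Theta_base_group (a : BaseFun F) (f : GroupFun E G) :
    Theta ι b (baseIncl a) (groupIncl f) =
      mapCoeff (evTotal LinearMap.id) (expOp (-1 / 2) (mixedOp ι b)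
        (PowerSeries.C (a ⊗ₜ[ℝ] f))) := by
  refine Theta_eq (-1 / 2) (TensorProduct.map baseIncl.toLinearMap groupIncl.toLinearMap)
    (TensorProduct.ext' fun a f => ?_)
    (TensorProduct.ext' fun a f => rfl) _ _ _ rfl
  simp only [LinearMap.comp_apply, LinearMap.smul_apply, mixedOp_tmul, map_smul, map_sum,
    TensorProduct.map_tmul, AlgHom.toLinearMap_apply, theta, LinearMap.sum_apply,
    LinearMap.sub_apply, leftDeriv_baseIncl, totalDeriv_baseIncl, leftDeriv_groupIncl,
    TensorProduct.zero_tmul, zero_sub, Finset.sum_neg_distrib, smul_neg, neg_div, neg_smul, map_neg]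

theorem Theta_group_base (a : BaseFun F) (f : GroupFun E G) :
    Theta ι b (groupIncl f) (baseIncl a) =
      mapCoeff (evTotal LinearMap.id) (expOp (1 / 2) (mixedOp ι b)
        (PowerSeries.C (a ⊗ₜ[ℝ] f))) := by
  refine Theta_eq (1 / 2) ((TensorProduct.comm ℝ _ _).toLinearMap ∘ₗ
      TensorProduct.map baseIncl.toLinearMap groupIncl.toLinearMap)
    (TensorProduct.ext' fun a f => ?_)
    (TensorProduct.ext' fun a f => mul_comm _ _) _ _ _ rfl
  simp only [LinearMap.comp_apply, LinearMap.smul_apply, mixedOp_tmul, map_smul, map_sum,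
    TensorProduct.map_tmul, AlgHom.toLinearMap_apply, theta, LinearMap.sum_apply,
    LinearMap.sub_apply, leftDeriv_baseIncl, totalDeriv_baseIncl, leftDeriv_groupIncl,
    LinearEquiv.coe_coe, TensorProduct.comm_tmul, TensorProduct.tmul_zero, sub_zero]

variable {r : FunTensor F (LieAlg E G ⊗[ℝ] LieAlg E G)}
  {S : PowerSeries (TotalFun F E G) → PowerSeries (TotalFun F E G) → PowerSeries (TotalFun F E G)}

theorem IsCompatible.isBaseProduct (hS : IsCompatible ι b r S) : IsBaseProduct ι b (-1 / 2) S where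
  left := hS.star.hlin_left
  right := hS.star.hlin_right
  assoc := hS.star.assoc
  base a a' := by rw [hS.base_base, map_mul]
  group a f := by rw [hS.base_group, Theta_base_group]

/-- Passing to the opposite product turns statements about first arguments into statements about
second ones, with the sign of the shift reversed. -/
theorem IsCompatible.isBaseProduct_flip (hS : IsCompatible ι b r S) :
    IsBaseProduct ι b (1 / 2) fun x y => S y x where
  left := hS.star.hlin_right
  right := hS.star.hlin_left
  assoc x y z := (hS.star.assoc z y x).symm
  base a a' := by rw [hS.base_base, map_mul, mul_comm]
  group a f := by rw [hS.group_base, Theta_group_base]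

theorem IsBaseProduct.conjugate_group {c : ℝ} {P : PowerSeries (TotalFun F E G) →
    PowerSeries (TotalFun F E G) → PowerSeries (TotalFun F E G)} (hP : IsBaseProduct ι b c P)
    (hη : ∀ i j, Commute (hU ι b i : UEnv E G) (hU ι b j)) {T : PowerSeries (FunTensor F (UEnv E G))}
    (hT : IsGauge ι T) (a : BaseFun F) (g : GroupFun E G) :
    seriesOp (inv₁ T) (P (seriesOp T (cst (baseIncl a))) (seriesOp T (cst (groupIncl g)))) =
      P (cst (baseIncl a)) (cst (groupIncl g)) := by
  -- With `Y = T` and `w = 1` this says that star multiplication by `a` and `T⃗` commute on `g`, so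
  -- that the outer `T⃗⁻¹` cancels.
  have h := hP.base_mapCoeff (φ := ev₁ g) (η := hU ι b) (fun _ w => ev₁_toU_mul _ g w) hη a T
    (fun n => mem_centralizing.2 fun i => hT.invariant _ n) 1
  rw [map_one, map_one, mul_one] at h
  rw [seriesOp_baseIncl T hT.counit, seriesOp_groupIncl, h,
    seriesOp_mapCoeff _ (ev₁ g) (AlgHom.id ℝ _) (fun u w => by rw [ev₁_apply, ev₁_apply, map_mul gAct]; rfl)]
  have h' := hP.group_weight (φ := ev₁ g) (η := hU ι b) (fun _ w => ev₁_toU_mul _ g w) a 1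
  rw [ev₁_apply, map_one] at h'
  rw [onSeries_id, ← mul_assoc, inv₁_mul T hT.constant_term, one_mul, ← h',
    Module.End.one_apply]

end Theta

/-! ### Symbols of compatible star products -/

section Symbols

variable {F : Type*} [NormedAddCommGroup F] [NormedSpace ℝ F] [FiniteDimensional ℝ F]
  {E : Type*} [NormedAddCommGroup E] [NormedSpace ℝ E] [FiniteDimensional ℝ E] [CompleteSpace E]
  {G : Type*} [TopologicalSpace G] [T2Space G] [ChartedSpace E G] [Group G]
  [LieGroup 𝓘(ℝ, E) ∞ G]
  {H : Type*} [TopologicalSpace H] [ChartedSpace F H] [CommGroup H] [LieGroup 𝓘(ℝ, F) ∞ H]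
  {κ : Type*} [Fintype κ] {ι : H →* G} {b : Module.Basis κ ℝ F}
  (hι : ContMDiff 𝓘(ℝ, F) 𝓘(ℝ, E) ∞ ι)
  {r : FunTensor F (LieAlg E G ⊗[ℝ] LieAlg E G)}
  {S : PowerSeries (TotalFun F E G) → PowerSeries (TotalFun F E G) → PowerSeries (TotalFun F E G)}
  (hS : IsCompatible ι b r S)
  {K : PowerSeries (FunTensor F (UEnv E G ⊗[ℝ] UEnv E G))} (hK : IsSymbol S K)
  {T : PowerSeries (FunTensor F (UEnv E G))} (hT : IsGauge ι T)

include hK in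
theorem IsSymbol.eq_mapCoeff (f g : GroupFun E G) :
    S (cst (groupIncl f)) (cst (groupIncl g)) = mapCoeff (evTotal (ev₂ f g)) K := by
  rw [hK, seriesOp₂_groupIncl]

include hι in
theorem hU_commute (i j : κ) : Commute (hU ι b i : UEnv E G) (hU ι b j) :=
  commute_toU_lieIncl hι _ _

include hι hS hK in
theorem IsSymbol.zero_weight (h : F) (n : ℕ) : Commute
    (constFun (1 ⊗ₜ[ℝ] toU (lieIncl ι h) + toU (lieIncl ι h) ⊗ₜ[ℝ] 1)) (coeff n K) := by
  have key : ∀ μ, Commute (toU (lieIncl ι h) ⊗ₜ[ℝ] 1 + 1 ⊗ₜ[ℝ] toU (lieIncl ι h))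
      (evalAt μ (coeff n K)) := fun μ =>
    commute_of_ev₂_invariant hι _ (fun s f g => by
      have h := congrArg (fun x => restr μ (coeff n x))
        (hS.right_invariant s (cst (groupIncl f)) (cst (groupIncl g)))
      have e : ∀ f : GroupFun E G, PowerSeries.map (rightTranslate (ι s)).toRingHom
          (cst (groupIncl f)) = (cst (groupIncl (gRight (ι s) f)) :
            PowerSeries (TotalFun F E G)) := fun f => PowerSeries.map_C _ _
      rw [e, e, hK.eq_mapCoeff, hK.eq_mapCoeff] at h
      simp only [PowerSeries.coeff_map, coeff_mapCoeff, restr_evTotal] at h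
      rw [h]
      refine (restr_rightTranslate (ι s) μ _).trans ?_
      rw [restr_evTotal]) h
  refine ext_evalAt fun μ => ?_
  rw [map_mul, map_mul, evalAt_constFun, add_comm]
  exact (key μ).eq

include hι hS hK in
theorem IsSymbol.mem_centralizing (n : ℕ) :
    coeff n K ∈ centralizing F fun i => comul (hU ι b i) :=
  DynStar.mem_centralizing.2 fun i => by
    have := hK.zero_weight hι hS (b i) n
    rw [add_comm] at this
    change Commute (constFun (comul (toU (lieIncl ι (b i))))) _
    rwa [comul_toU]

theorem comul_hU (i : κ) : comul (hU ι b i) = (1 : UEnv E G) ⊗ₜ[ℝ] hU ι b i +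
    hU ι b i ⊗ₜ[ℝ] (1 : UEnv E G) := by
  rw [add_comm]
  exact comul_toU _

theorem commute_includeLeft {A B : Type*} [Ring A] [Algebra ℝ A] [Ring B] [Algebra ℝ B] (u : B)
    (v : A) : Commute ((1 : A) ⊗ₜ[ℝ] u) (v ⊗ₜ[ℝ] (1 : B)) := by
  rw [Commute, SemiconjBy, Algebra.TensorProduct.tmul_mul_tmul,
    Algebra.TensorProduct.tmul_mul_tmul, one_mul, mul_one, one_mul, mul_one]

theorem commute_slot1_emb23 {A : Type*} [Ring A] [Algebra ℝ A] (u : A) (w : A ⊗[ℝ] A) :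
    Commute (slot1 u) (emb23 w) := (commute_includeLeft w u).symm

theorem commute_slot3_emb12 {A : Type*} [Ring A] [Algebra ℝ A] (u : A) (w : A ⊗[ℝ] A) :
    Commute (slot3 u) (emb12 w) := by
  induction w using TensorProduct.induction_on with
  | zero => rw [map_zero]; exact Commute.zero_right _
  | add w w' h h' => rw [map_add]; exact h.add_right h'
  | tmul x y =>
    change (1 ⊗ₜ[ℝ] (1 ⊗ₜ[ℝ] u)) * (x ⊗ₜ[ℝ] (y ⊗ₜ[ℝ] 1)) =
      (x ⊗ₜ[ℝ] (y ⊗ₜ[ℝ] 1)) * (1 ⊗ₜ[ℝ] (1 ⊗ₜ[ℝ] u))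
    simp only [Algebra.TensorProduct.tmul_mul_tmul, one_mul, mul_one]

include hι hT in
-- Invariance of `T₁(λ - ½ħh^{(2)})` is needed so that it can be part of the factor `Y` when the
-- second argument is treated.
theorem shift_includeLeft_mem_centralizing (n : ℕ) :
    coeff n (shift b (-1 / 2) (fun i => (1 : UEnv E G) ⊗ₜ[ℝ] hU ι b i)
      (onSeries Algebra.TensorProduct.includeLeft T)) ∈
        centralizing F fun i => comul (hU ι b i) := by
  refine shift_mem_centralizing b (fun i j => ?_) _ (fun n => ?_) n
  · rw [comul_hU]
    refine Commute.add_left ?_ (commute_includeLeft (hU ι b j) (hU ι b i)).symm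
    exact (hU_commute hι i j).map
      (Algebra.TensorProduct.includeRight : UEnv E G →ₐ[ℝ] UEnv E G ⊗[ℝ] UEnv E G)
  · rw [coeff_onSeries]
    refine DynStar.mem_centralizing.2 fun i => ?_
    rw [comul_hU, map_add]
    refine Commute.add_left (commute_onValues _ _ (fun w => commute_includeLeft (hU ι b i) w) _) ?_
    have := (hT.invariant (b i) n).map
      (onValues (Algebra.TensorProduct.includeLeft : UEnv E G →ₐ[ℝ] UEnv E G ⊗[ℝ] UEnv E G))
    exact this

include hι hS hK hT in
theorem IsSymbol.gauge : IsSymbol (conjugate T S) (gauge ι b T K) := fun f g => by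
  have hη : ∀ i j, Commute (hU ι b i : UEnv E G) (hU ι b j) := hU_commute hι
  have hη' : ∀ i j, Commute (comul (hU ι b i : UEnv E G)) (comul (hU ι b j)) :=
    fun i j => (hη i j).map comul
  -- Needed for all `q`, since the next step evaluates it at the functions `w⃗ g`.
  have h1 : ∀ q : GroupFun E G, S (seriesOp T (cst (groupIncl f))) (cst (groupIncl q)) =
      mapCoeff (evTotal (ev₂ f q)) (K * shift b (-1 / 2)
        (fun i => (1 : UEnv E G) ⊗ₜ[ℝ] hU ι b i)
        (onSeries Algebra.TensorProduct.includeLeft T)) := fun q => by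
    rw [seriesOp_groupIncl]
    refine hS.isBaseProduct.mapCoeff_left (hasWeight_ev₁ f) hη (hasWeight_ev₂ f q) hη' _ _
      comul_hU (fun i j => commute_includeLeft _ _) K (hK.mem_centralizing hι hS) _ (fun w => ?_) T
    rw [ev₁_apply, hK.eq_mapCoeff, mapCoeff_evTotal_eq (AlgHom.id ℝ _) (w ⊗ₜ[ℝ] 1)
      (fun v => ev₂_gAct_left f q w v), onSeries_id]
    rfl
  -- The second argument, via the opposite product: the coproduct `Δ(h_i)` exceeds slot 2 by
  -- `h_i^{(1)}`, whence the shift of `T_2`.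
  have h2 := hS.isBaseProduct_flip.mapCoeff_left (hasWeight_ev₁ g) hη (hasWeight_ev₂ f g) hη'
    Algebra.TensorProduct.includeRight (fun i => hU ι b i ⊗ₜ[ℝ] (1 : UEnv E G))
    (fun i => (comul_hU i).trans (add_comm _ _)) (fun i j => (commute_includeLeft _ _).symm) _
    (mul_coeff_mem_centralizing (hK.mem_centralizing hι hS)
      (shift_includeLeft_mem_centralizing hι hT)) (seriesOp T (cst (groupIncl f)))
    (fun w => by
      rw [h1, ev₁_apply, mapCoeff_evTotal_eq (AlgHom.id ℝ _) (1 ⊗ₜ[ℝ] w)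
        (fun v => ev₂_gAct_right f g w v), onSeries_id]
      rfl) T
  rw [← seriesOp_groupIncl] at h2
  rw [conjugate, h2, seriesOp_mapCoeff _ _ comul (gAct_ev₂ f g), seriesOp₂_groupIncl,
    DynStar.gauge, ← mul_assoc, ← mul_assoc]

include hι hS hK in
theorem IsSymbol.shifted_cocycle :
    onSeries comulLeft K * shift b (-1 / 2) (fun i => slot3 (hU ι b i)) (onSeries emb12 K) =
      onSeries comulRight K *
        shift b (1 / 2) (fun i => slot1 (hU ι b i)) (onSeries emb23 K) := by
  have hη : ∀ i j, Commute (comul (hU ι b i : UEnv E G)) (comul (hU ι b j)) :=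
    fun i j => (hU_commute hι i j).map comul
  have hη' : ∀ i j, Commute (comulLeft (comul (hU ι b i : UEnv E G)))
      (comulLeft (comul (hU ι b j))) := fun i j => (hη i j).map comulLeft
  refine eq_of_mapCoeff_evTotal
    (fun p : GroupFun E G × GroupFun E G × GroupFun E G => ev₃ p.1 p.2.1 p.2.2)
    (fun w hw => eq_zero_of_ev₃ w fun f g k => hw (f, g, k)) fun ⟨f, g, k⟩ => ?_
  -- Evaluates `(f ⋆ g) ⋆ k`: the iterated coproduct of `h_i` exceeds its part in slots 1 and 2 by
  -- `h_i^{(3)}`.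
  have h1 := hS.isBaseProduct.mapCoeff_left (hasWeight_ev₂ f g) hη (hasWeight_ev₃ f g k) hη'
    emb12 (fun i => slot3 (hU ι b i))
    (fun i => by
      rw [hU, comulLeft_comul_toU, add_comm, comul_toU, map_add]; rfl)
    (fun i j => commute_slot3_emb12 _ _)
    (onSeries comulLeft K) (fun n => by
      rw [coeff_onSeries]
      exact onValues_mem_centralizing _ (hK.mem_centralizing hι hS n)) (cst (groupIncl k))
    (fun w => by
      rw [hK.eq_mapCoeff, mapCoeff_evTotal_eq comulLeft _ (ev₂_ev₂_left f g k w)]) K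
  -- Evaluates `f ⋆ (g ⋆ k)` through the opposite product, with `h_i^{(1)}` left over.
  -- Coassociativity on `h_i` makes the weights on both sides agree.
  have h2 := hS.isBaseProduct_flip.mapCoeff_left (hasWeight_ev₂ g k) hη (hasWeight_ev₃ f g k) hη'
    emb23 (fun i => slot1 (hU ι b i))
    (fun i => by
      rw [hU, comulLeft_comul_toU, add_assoc, comul_toU, map_add]; rfl)
    (fun i j => commute_slot1_emb23 _ _)
    (onSeries comulRight K) (fun n => by
      rw [coeff_onSeries]
      have := onValues_mem_centralizing comulRight (hK.mem_centralizing hι hS n)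
      have e : ∀ i, comulRight (comul (hU ι b i : UEnv E G)) = comulLeft (comul (hU ι b i)) :=
        fun i => (comulRight_comul_toU _).trans (comulLeft_comul_toU _).symm
      simpa only [e] using this) (cst (groupIncl f))
    (fun w => by
      rw [hK.eq_mapCoeff, mapCoeff_evTotal_eq comulRight _ (ev₂_ev₂_right f g k w)]) K
  rw [← hK.eq_mapCoeff] at h1 h2
  exact h1.symm.trans ((hS.star.assoc _ _ _).trans h2)

include hS hK in
-- Operators act on the constant function `1` by the counit, so this is the unit law `1 ⋆ g = g`
-- read on symbols.
theorem IsSymbol.normal_left : onSeries counitLeft K = 1 :=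
  eq_of_mapCoeff_evTotal ev₁ eq_zero_of_ev₁ fun g => by
    have h := hK.eq_mapCoeff 1 g
    rw [map_one, cst, map_one, hS.star.one_left, mapCoeff_evTotal_eq counitLeft 1
      (fun w => (ev₂_one_left g w).trans (by rw [mul_one])), map_one, map_one, mul_one] at h
    rw [← h, ← map_one PowerSeries.C, mapCoeff_C]
    change _ = PowerSeries.C (evTotal (ev₁ g) (1 ⊗ₜ[ℝ] 1))
    rw [evTotal_tmul, map_one, one_mul, ev₁_apply, map_one]
    rfl

include hS hK in
theorem IsSymbol.normal_right : onSeries counitRight K = 1 :=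
  eq_of_mapCoeff_evTotal ev₁ eq_zero_of_ev₁ fun g => by
    have h := hK.eq_mapCoeff g 1
    rw [map_one, cst, cst, map_one PowerSeries.C, hS.star.one_right, mapCoeff_evTotal_eq counitRight 1
      (fun w => (ev₂_one_right g w).trans (by rw [mul_one])), map_one, map_one, mul_one] at h
    rw [← h, ← map_one PowerSeries.C, mapCoeff_C]
    change _ = PowerSeries.C (evTotal (ev₁ g) (1 ⊗ₜ[ℝ] 1))
    rw [evTotal_tmul, map_one, one_mul, ev₁_apply, map_one]
    rfl

/-- The derivatives `∂_i` kill functions on `G`, so on these the bracket sees only `r`. -/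
theorem poissonBracket_groupIncl (f g : GroupFun E G) :
    poissonBracket ι b r (groupIncl f) (groupIncl g) = evTotal (ev₂ f g) (rToU r) := by
  rw [poissonBracket, opTwo_groupIncl, Finset.sum_eq_zero fun i _ => ?_, zero_add]
  rw [totalDeriv_groupIncl, totalDeriv_groupIncl, mul_zero, zero_mul, sub_zero]

theorem evTotal_ev₂_swap (f g : GroupFun E G) (z : FunTensor F (UEnv E G ⊗[ℝ] UEnv E G)) :
    evTotal (ev₂ f g) (onValues swap z) = evTotal (ev₂ g f) z :=
  ext_restr fun μ => by rw [restr_evTotal, restr_evTotal, evalAt_onValues, ev₂_swap]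

include hι hS hK in
theorem IsSymbol.isQuantization : IsQuantization ι b r K := by
  obtain ⟨B, -, hB0, hB1, hB⟩ := hS.star.exists_bilinSeries
  -- On functions on `G` the cochains are the operators with symbols the coefficients of `K`; orders
  -- `0` and `1` give the constant term and the classical limit.
  have hc : ∀ n f g, B n (groupIncl f) (groupIncl g) = evTotal (ev₂ f g) (coeff n K) :=
    fun n f g => by
      rw [← coeff_bilinSeries_C, ← hB, ← coeff_mapCoeff, ← hK.eq_mapCoeff]
  have hfaith : ∀ w : UEnv E G ⊗[ℝ] UEnv E G,
      (∀ p : GroupFun E G × GroupFun E G, ev₂ p.1 p.2 w 1 = 0) → w = 0 :=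
    fun w hw => eq_zero_of_ev₂ w fun f g => hw (f, g)
  refine ⟨?_, hK.zero_weight hι hS, hK.shifted_cocycle hι hS, hK.normal_left hS,
    hK.normal_right hS, ?_⟩
  · rw [← PowerSeries.coeff_zero_eq_constantCoeff_apply]
    refine eq_of_evTotal (fun p : GroupFun E G × GroupFun E G => ev₂ p.1 p.2) hfaith
      fun ⟨f, g⟩ => ?_
    rw [← hc, hB0]
    change _ = evTotal (ev₂ f g) (1 ⊗ₜ[ℝ] (1 ⊗ₜ[ℝ] 1))
    rw [evTotal_tmul, ev₂_tmul, map_one, map_one, one_mul, ← map_mul]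
    rfl
  · refine eq_of_evTotal (fun p : GroupFun E G × GroupFun E G => ev₂ p.1 p.2) hfaith
      fun ⟨f, g⟩ => ?_
    rw [← poissonBracket_groupIncl (ι := ι) (b := b), ← hB1, map_sub, evTotal_ev₂_swap, hc, hc]

include hι hS hT in
theorem IsCompatible.conjugate [ConnectedSpace H] : IsCompatible ι b r (conjugate T S) where
  star := hS.star.conjugate hT.constant_term hT.counit
  left_invariant a f g := by
    have h : ∀ T : PowerSeries (FunTensor F (UEnv E G)), ∀ f, _ := fun T =>
      seriesOp_map T (leftTranslate a) fun n f => opOne_leftTranslate _ a f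
    rw [DynStar.conjugate, h, h, hS.left_invariant, h]
    rfl
  right_invariant s f g := by
    have h : ∀ {T : PowerSeries (FunTensor F (UEnv E G))}, IsGauge ι T → ∀ f, _ := fun {T} hT =>
      seriesOp_map T (rightTranslate (ι s)) fun n f =>
        opOne_rightTranslate hι _ (fun h => hT.invariant h n) s f
    rw [DynStar.conjugate, h hT, h hT, hS.right_invariant, h hT.inv]
    rfl
  base_base f g := by
    rw [DynStar.conjugate, seriesOp_baseIncl T hT.counit, seriesOp_baseIncl T hT.counit,
      hS.base_base, ← map_mul, seriesOp_baseIncl _ hT.inv.counit]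
  base_group f g :=
    (hS.isBaseProduct.conjugate_group (hU_commute hι) hT f g).trans (hS.base_group f g)
  group_base f g :=
    (hS.isBaseProduct_flip.conjugate_group (hU_commute hι) hT f g).trans (hS.group_base f g)
  group_group := by
    obtain ⟨K, hK⟩ := hS.group_group
    exact ⟨_, hK.gauge hι hS hT⟩

end Symbols

end DynStar

end

theorem mainTheorem10
    {F : Type*} [NormedAddCommGroup F] [NormedSpace ℝ F] [FiniteDimensional ℝ F]
    {E : Type*} [NormedAddCommGroup E] [NormedSpace ℝ E] [FiniteDimensional ℝ E] [CompleteSpace E]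
    {G : Type*} [TopologicalSpace G] [T2Space G] [ChartedSpace E G] [Group G]
    [LieGroup 𝓘(ℝ, E) ∞ G]
    {H : Type*} [TopologicalSpace H] [ConnectedSpace H] [ChartedSpace F H] [CommGroup H]
    [LieGroup 𝓘(ℝ, F) ∞ H]
    (ι : H →* G) (hι : DynStar.IsLieSubgroup (F := F) (E := E) ι)
    {κ : Type*} [Fintype κ] (b : Module.Basis κ ℝ F)
    (r : DynStar.FunTensor F (DynStar.LieAlg E G ⊗[ℝ] DynStar.LieAlg E G))
    (hr : DynStar.IsTriangularDynamicalRMatrix ι b r)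
    (S : PowerSeries (DynStar.TotalFun F E G) → PowerSeries (DynStar.TotalFun F E G) →
      PowerSeries (DynStar.TotalFun F E G))
    (hS : DynStar.IsCompatible ι b r S)
    (T : PowerSeries (DynStar.FunTensor F (DynStar.UEnv E G)))
    (hT : DynStar.IsGauge ι T) :
    DynStar.IsCompatible ι b r (DynStar.conjugate T S) ∧
    ∀ K : PowerSeries (DynStar.FunTensor F (DynStar.UEnv E G ⊗[ℝ] DynStar.UEnv E G)),
      DynStar.IsSymbol S K →
        DynStar.IsSymbol (DynStar.conjugate T S) (DynStar.gauge ι b T K) ∧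
        DynStar.IsQuantization ι b r (DynStar.gauge ι b T K) := by
  have hconj := hS.conjugate hι.smooth hT
  exact ⟨hconj, fun K hK =>
    have hK' := hK.gauge hι.smooth hS hT
    -- The cocycle condition for `E` needs no direct computation: `E` is the symbol of the
    -- conjugated product, already known to be compatible.
    ⟨hK', hK'.isQuantization hι.smooth hconj⟩⟩
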